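/- Let $\mathbf k$ be a field. **Permutations.** Let $\mathfrak S=\bigsqcup_{n\ge 0}\mathfrak S_n$, let $\epsilon$ be the permutation of size $0$, and let $\mathcal{HS}=\bigoplus_n \mathcal{HS}_n$, where $\mathcal{HS}_n$ is the $\mathbf k$-vector space with basis $\mathfrak S_n$. For $\mu\in\mathfrak S_m$, $\nu\in\mathfrak S_n$ let $\mu\bullet\nu\in\mathfrak S_{m+n}$ be given by $(\mu\bullet\nu)(i)=\mu(i)+n$ for $i\le m$ and $(\mu\bullet\nu)(i)=\nu(i-m)$ for $i>m$. A gap $\gamma\in\{0,\dots,n\}$ is a *global descent* of $\omega\in\mathfrak S_n$ if $\omega(\{1,\dots,\gamma\})=\{n-\gamma+1,\dots,n\}$, and $\omega$ is *atomic* if it has no global descent other than $0$ and $n$. Each $\omega$ factorizes uniquely as $\omega_1\bullet\cdots\bullet\omega_\ell$ with $\omega_i\neq\epsilon$ atomic. The coproduct is $\Delta(\omega)=\sum_{i=0}^{\ell}(\omega_1\bullet\cdots\bullet\omega_i)\otimes(\omega_{i+1}\bullet\cdots\bullet\omega_\ell)$, and $\pi \mathbin{\sqcup\!\!\sqcup}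 \omega$ is the sum (with multiplicities) of the $\bullet$-products of all shuffles of the atomic factorizations of $\pi$ and of $\omega$. The unit is $\epsilon$, and the counit is $1$ on $\epsilon$ and $0$ on all other permutations. **Pipe dreams.** A pipe dream of size $n$ is a filling with crosses and elbows of the boxes $(i,j)$ (row $i$, column $j$), $i,j\ge0$, $i+j\le n$, with elbows in the boxes with $i+j=n$. In a cross, both pipes go straight; in an elbow, the pipe coming from the left turns up and the pipe coming from below turns right. Pipe $i$ enters on the left in row $i$. We only consider pipe dreams that are reduced (any two pipes cross at most once) and have an elbow in the box $(0,0)$. Let $\Pi_n$ be the set of those of size $n$, and $\mathcal{HP}=\bigoplus_n\mathcal{HP}_n$, where $\mathcal{HP}_n$ is the $\mathbf k$-vector space with basis $\Pi_n$. The exiting permutation $\omega_P\in\mathfrak S_n$ of $P\in\Pi_n$ lists the labels of the nonzero pipes in the order of their exits at the top of the columns $1,\dots,n$. *Coproduct.* The horizontal packing $H_k(P)\in\Pi_k$ keeps only the pipes entering in the rows $0,\dots,k$: each cross between two of them stays in its row and moves to the left by the number of removed pipes passing to its left; the other boxes are elbows. The vertical packing $V_k(P)\in\Pi_k$ is defined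 symmetrically (exchanging rows and columns) from the pipes exiting in the columns $0,\dots,k$. For $P\in\Pi_n$ set $\Delta(P)=\sum_\gamma V_\gamma(P)\otimes H_{n-\gamma}(P)$, the sum over all global descents $\gamma$ of $\omega_P$. *Product.* For $P\in\Pi_m$, $Q\in\Pi_n$ and a global descent $\gamma$ of $\omega_P$, the insertion of $Q$ in $P$ at gap $\gamma$ is the element of $\Pi_{m+n}$ obtained from $P$ by inserting $n$ columns after column $\gamma$ and $n$ rows after row $m-\gamma$, filling with $Q$ the triangle of boxes located in the rows $m-\gamma,\dots,m-\gamma+n$ and in the columns $\gamma,\dots,\gamma+n$, and filling with crosses the remaining boxes of the new rows and columns. A $P/Q$-shuffle is a word $s$ with $m$ letters $p$ and $n$ letters $q$ such that the number of letters $p$ before each letter $q$ is a global descent of $\omega_P$ and the number of letters $q$ before each letter $p$ is a global descent of $\omega_Q$. For such $s$, let $P\star_s Q$ be obtained by untangling $Q$ (by vertical and horizontal packings) at all gaps marked by the maximal blocks of letters $p$, and inserting the resulting pipe dreams successively in $P$ at the positions of the maximal blocks of letters $q$. Set $P\star Q=\sum_s P\star_s Q$, the sum over all $P/Q$-shuffles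 $s$. The unit is the pipe dream of size $0$ (a single elbow), and the counit is $1$ on it and $0$ on all other pipe dreams. **Statement.** The above operations on pipe dreams are well defined (they produce reduced pipe dreams with an elbow in the top left corner). With them, $(\mathcal{HP},\star,\Delta)$ is a graded connected Hopf algebra and $(\mathcal{HS},\mathbin{\sqcup\!\!\sqcup},\Delta)$ is a graded connected commutative Hopf algebra. The linear map $\omega\colon\mathcal{HP}\to\mathcal{HS}$ that sends each pipe dream $P$ to its exiting permutation $\omega_P$ is a surjective morphism of graded Hopf algebras. -/

import Mathlib

open scoped TensorProduct

universe u

/-! ## Graded connected Hopf algebras given by structure maps on a vector space -/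

/-- A product, a unit, a coproduct and a counit on a vector space, without any axiom. -/
structure HopfData (k : Type u) (V : Type u) [Field k] [AddCommGroup V] [Module k V] where
  mul : V →ₗ[k] V →ₗ[k] V
  one : V
  comul : V →ₗ[k] V ⊗[k] V
  counit : V →ₗ[k] k

/-- The four structure maps `D` satisfy all the axioms of a graded connected Hopf algebra
with homogeneous components `A 0, A 1, A 2, …`. -/
structure IsGradedConnectedHopf {k V : Type u} [Field k] [AddCommGroup V] [Module k V]
    (D : HopfData k V) (A : ℕ → Submodule k V) : Prop where
  -- algebra
  mul_assoc : ∀ x y z, D.mul (D.mul x y) z = D.mul x (D.mul y z)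
  one_mul : ∀ x, D.mul D.one x = x
  mul_one : ∀ x, D.mul x D.one = x
  -- coalgebra
  coassoc : TensorProduct.assoc k V V V ∘ₗ D.comul.rTensor V ∘ₗ D.comul
    = D.comul.lTensor V ∘ₗ D.comul
  counit_comul : D.counit.rTensor V ∘ₗ D.comul = TensorProduct.mk k k V 1
  comul_counit : D.counit.lTensor V ∘ₗ D.comul = (TensorProduct.mk k V k).flip 1
  -- the coproduct and the counit are morphisms of algebras
  counit_one : D.counit D.one = 1
  counit_mul : ∀ x y, D.counit (D.mul x y) = D.counit x * D.counit y
  comul_one : D.comul D.one = D.one ⊗ₜ[k] D.one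
  comul_mul : ∀ x y,
    D.comul (D.mul x y) = TensorProduct.map₂ D.mul D.mul (D.comul x) (D.comul y)
  -- there is a graded antipode
  antipode : ∃ S : V →ₗ[k] V,
    TensorProduct.lift D.mul ∘ₗ S.rTensor V ∘ₗ D.comul
      = (LinearMap.toSpanSingleton k V D.one) ∘ₗ D.counit ∧
    TensorProduct.lift D.mul ∘ₗ S.lTensor V ∘ₗ D.comul
      = (LinearMap.toSpanSingleton k V D.one) ∘ₗ D.counit ∧
    ∀ n, ∀ x ∈ A n, S x ∈ A n
  -- grading
  isInternal : DirectSum.IsInternal A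
  mul_mem : ∀ m n, ∀ x ∈ A m, ∀ y ∈ A n, D.mul x y ∈ A (m + n)
  comul_mem : ∀ n, ∀ x ∈ A n, D.comul x ∈
    ⨆ p ∈ Finset.HasAntidiagonal.antidiagonal n, LinearMap.range (TensorProduct.mapIncl (A p.1) (A p.2))
  counit_eq_zero : ∀ n, n ≠ 0 → ∀ x ∈ A n, D.counit x = 0
  -- connectedness
  connected : A 0 = Submodule.span k {D.one}

namespace IsGradedConnectedHopf

variable {k V : Type u} [Field k] [AddCommGroup V] [Module k V]
  {D : HopfData k V} {A : ℕ → Submodule k V}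

/-- The vector space `V`, carrying the Hopf algebra structure given by `D`. -/
def Carrier (_h : IsGradedConnectedHopf D A) : Type u := V

variable (h : IsGradedConnectedHopf D A)

instance : AddCommGroup h.Carrier := inferInstanceAs (AddCommGroup V)

instance : Module k h.Carrier := inferInstanceAs (Module k V)

/-- The identity map from `V` to the Hopf algebra on `V`. -/
def of : V ≃ₗ[k] h.Carrier := LinearEquiv.refl k V

instance : Ring h.Carrier :=
  { (inferInstance : AddCommGroup h.Carrier) with
    mul := fun x y => D.mul x y
    one := D.one
    left_distrib := fun x y z => (D.mul x).map_add y z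
    right_distrib := fun x y z => LinearMap.map_add₂ D.mul x y z
    zero_mul := fun x => LinearMap.map_zero₂ D.mul x
    mul_zero := fun x => (D.mul x).map_zero
    mul_assoc := h.mul_assoc
    one_mul := h.one_mul
    mul_one := h.mul_one }

instance : Algebra k h.Carrier :=
  Algebra.ofModule (fun r x y => LinearMap.map_smul₂ D.mul r x y)
    (fun r x y => (D.mul x).map_smul r y)

instance : Coalgebra k h.Carrier where
  comul := D.comul
  counit := D.counit
  coassoc := h.coassoc
  rTensor_counit_comp_comul := h.counit_comul
  lTensor_counit_comp_comul := h.comul_counit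

theorem tensor_mul (x y : h.Carrier ⊗[k] h.Carrier) :
    x * y = TensorProduct.map₂ (LinearMap.mul k h.Carrier) (LinearMap.mul k h.Carrier) x y := by
  induction x using TensorProduct.induction_on with
  | zero => simp
  | add a b ha hb => rw [add_mul, ha, hb, map_add, LinearMap.add_apply]
  | tmul a b =>
    induction y using TensorProduct.induction_on with
    | zero => simp
    | add c d hc hd => rw [mul_add, hc, hd, map_add]
    | tmul c d => simp

instance : Bialgebra k h.Carrier :=
  Bialgebra.mk' k h.Carrier h.counit_one (fun {a b} => h.counit_mul a b) h.comul_one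
    (fun {a b} => (h.comul_mul a b).trans (h.tensor_mul _ _).symm)

theorem linearMap_eq :
    Algebra.linearMap k h.Carrier = LinearMap.toSpanSingleton k V D.one := by
  refine LinearMap.ext fun r => ?_
  exact (Algebra.linearMap_apply k h.Carrier r).trans (Algebra.algebraMap_eq_smul_one r)

noncomputable instance : HopfAlgebra k h.Carrier where
  antipode := h.antipode.choose
  mul_antipode_rTensor_comul := by
    rw [h.linearMap_eq]
    exact h.antipode.choose_spec.1
  mul_antipode_lTensor_comul := by
    rw [h.linearMap_eq]
    exact h.antipode.choose_spec.2.1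

end IsGradedConnectedHopf

/-! ## The Hopf algebra of permutations -/

/-- The set of all permutations of `{0, …, n - 1}` for all `n`
(positions and values are numbered from `0`). -/
abbrev Permutation : Type := Σ n : ℕ, Equiv.Perm (Fin n)

namespace Permutation

theorem ext_val {a b : Permutation} (h : a.1 = b.1)
    (h' : ∀ i (ha : i < a.1) (hb : i < b.1), (a.2 ⟨i, ha⟩ : ℕ) = b.2 ⟨i, hb⟩) : a = b := by
  obtain ⟨n, a⟩ := a
  obtain ⟨m, b⟩ := b
  obtain rfl : n = m := h
  congr 1
  ext i
  exact h' i i.2 i.2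

/-- The gap `γ` is a global descent: the first `γ` positions are sent to the last `γ` values. -/
def IsGlobalDescent (ω : Permutation) (γ : ℕ) : Prop :=
  γ ≤ ω.1 ∧ ∀ i : Fin ω.1, (i : ℕ) < γ ↔ ω.1 - γ ≤ (ω.2 i : ℕ)

instance (ω : Permutation) (γ : ℕ) : Decidable (IsGlobalDescent ω γ) := by
  unfold IsGlobalDescent
  infer_instance

def globalDescents (ω : Permutation) : Finset ℕ :=
  (Finset.range (ω.1 + 1)).filter (IsGlobalDescent ω)

/-- No global descents other than the first and the last gap. -/
def IsAtomic (ω : Permutation) : Prop :=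
  ∀ γ, IsGlobalDescent ω γ → γ = 0 ∨ γ = ω.1

/-- The permutation of size `0`. -/
def eps : Permutation := ⟨0, 1⟩

/-- The product `μ • ν`: the values of `μ`, shifted up by the size of `ν`, followed by `ν`. -/
def gdProd (μ ν : Permutation) : Permutation :=
  ⟨μ.1 + ν.1, finSumFinEquiv.symm.trans ((Equiv.sumCongr μ.2 ν.2).trans
    ((Equiv.sumComm _ _).trans (finSumFinEquiv.trans (finCongr (Nat.add_comm ν.1 μ.1)))))⟩

theorem gdProd_left (μ ν : Permutation) (i : ℕ) (h : i < μ.1) :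
    ((gdProd μ ν).2 ⟨i, Nat.lt_add_right _ h⟩ : ℕ) = μ.2 ⟨i, h⟩ + ν.1 := by
  change (finCongr (Nat.add_comm ν.1 μ.1) (finSumFinEquiv (Sum.swap (Sum.map μ.2 ν.2
    (finSumFinEquiv.symm (Fin.castAdd ν.1 ⟨i, h⟩))))) : ℕ) = _
  rw [finSumFinEquiv_symm_apply_castAdd]
  simp [add_comm]

theorem gdProd_right (μ ν : Permutation) (i : ℕ) (h : i < ν.1) :
    ((gdProd μ ν).2 ⟨μ.1 + i, Nat.add_lt_add_left h _⟩ : ℕ) = ν.2 ⟨i, h⟩ := by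
  change (finCongr (Nat.add_comm ν.1 μ.1) (finSumFinEquiv (Sum.swap (Sum.map μ.2 ν.2
    (finSumFinEquiv.symm (Fin.natAdd μ.1 ⟨i, h⟩))))) : ℕ) = _
  rw [finSumFinEquiv_symm_apply_natAdd]
  simp

/-- The product `ω₁ • ω₂ • … • ωₗ` of a list of permutations. -/
def listProd (l : List Permutation) : Permutation := l.foldr gdProd eps

theorem exists_split (ω : Permutation) (γ : ℕ) (h : IsGlobalDescent ω γ) :
    ∃ μ ν : Permutation, μ.1 = γ ∧ gdProd μ ν = ω := by
  obtain ⟨n, w⟩ := ω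
  obtain ⟨hγ, h⟩ := h
  obtain ⟨m, rfl⟩ : ∃ m, n = γ + m := ⟨n - γ, by simp at hγ; omega⟩
  simp only [Nat.add_sub_cancel_left] at h
  have h1 : ∀ i : Fin γ, m ≤ (w (Fin.castAdd m i) : ℕ) := fun i => (h _).1 (by simp)
  have h2 : ∀ i : Fin m, (w (Fin.natAdd γ i) : ℕ) < m := fun i => by
    have := h (Fin.natAdd γ i)
    simp at this
    omega
  let f : Fin γ → Fin γ := fun i => ⟨w (Fin.castAdd m i) - m, by
    have := (w (Fin.castAdd m i)).2
    have := h1 i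
    omega⟩
  let g : Fin m → Fin m := fun i => ⟨w (Fin.natAdd γ i), h2 i⟩
  have hf : Function.Injective f := fun i j hij => by
    have hv : (w (Fin.castAdd m i) : ℕ) - m = w (Fin.castAdd m j) - m := congrArg Fin.val hij
    have := h1 i
    have := h1 j
    have e : w (Fin.castAdd m i) = w (Fin.castAdd m j) := Fin.ext (by omega)
    exact Fin.castAdd_injective _ _ (w.injective e)
  have hg : Function.Injective g := fun i j hij => by
    have hv : (g i : ℕ) = g j := congrArg Fin.val hij
    have e : w (Fin.natAdd γ i) = w (Fin.natAdd γ j) := Fin.ext hv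
    exact Fin.natAdd_injective _ _ (w.injective e)
  refine ⟨⟨γ, Equiv.ofBijective f (Finite.injective_iff_bijective.1 hf)⟩,
    ⟨m, Equiv.ofBijective g (Finite.injective_iff_bijective.1 hg)⟩, rfl, ext_val rfl ?_⟩
  intro i hi hi'
  by_cases hlt : i < γ
  · refine (gdProd_left _ _ i hlt).trans ?_
    have := h1 ⟨i, hlt⟩
    simp only [Equiv.ofBijective_apply, f]
    exact Nat.sub_add_cancel this
  · obtain ⟨j, rfl⟩ : ∃ j, i = γ + j := ⟨i - γ, by omega⟩
    have hj : j < m := Nat.lt_of_add_lt_add_left hi'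
    exact gdProd_right _ _ j hj

theorem IsGlobalDescent.gdProd {μ : Permutation} {γ : ℕ} (h : IsGlobalDescent μ γ)
    (ν : Permutation) : IsGlobalDescent (gdProd μ ν) γ := by
  obtain ⟨h1, h2⟩ := h
  have hs : (Permutation.gdProd μ ν).1 = μ.1 + ν.1 := rfl
  refine ⟨by omega, ?_⟩
  rintro ⟨i, hi⟩
  have hi' : i < μ.1 + ν.1 := hi
  change i < γ ↔ μ.1 + ν.1 - γ ≤ _
  by_cases hlt : i < μ.1
  · rw [gdProd_left μ ν i hlt]
    have := h2 ⟨i, hlt⟩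
    simp only at this
    omega
  · obtain ⟨j, rfl⟩ : ∃ j, i = μ.1 + j := ⟨i - μ.1, by omega⟩
    have hj : j < ν.1 := by omega
    rw [gdProd_right μ ν j hj]
    have := (ν.2 ⟨j, hj⟩).2
    omega

/-- Every permutation is a product of nontrivial atomic permutations. -/
theorem exists_factorization (ω : Permutation) :
    ∃ l : List Permutation, (∀ a ∈ l, IsAtomic a ∧ a ≠ eps) ∧ listProd l = ω := by
  induction hn : ω.1 using Nat.strong_induction_on generalizing ω with
  | _ n ih =>
    by_cases h0 : n = 0
    · refine ⟨[], by simp, ext_val ?_ ?_⟩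
      · change 0 = ω.1
        omega
      · intro i ha hb
        omega
    · have hex : ∃ γ, 0 < γ ∧ IsGlobalDescent ω γ :=
        ⟨ω.1, by omega, le_rfl, fun i => by simp⟩
      classical
      obtain ⟨hpos, hgd⟩ := Nat.find_spec hex
      have hmin : ∀ δ, 0 < δ → IsGlobalDescent ω δ → Nat.find hex ≤ δ :=
        fun δ h1 h2 => Nat.find_min' hex ⟨h1, h2⟩
      generalize Nat.find hex = γ at hpos hgd hmin
      obtain ⟨μ, ν, hμ, rfl⟩ := exists_split ω γ hgd
      have hsz : (gdProd μ ν).1 = μ.1 + ν.1 := rfl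
      obtain ⟨l, hl, hprod⟩ := ih ν.1 (by omega) ν rfl
      refine ⟨μ :: l, ?_, ?_⟩
      · intro a ha
        rcases List.mem_cons.1 ha with rfl | ha
        · refine ⟨fun δ hδ => ?_, fun he => ?_⟩
          · rcases Nat.eq_zero_or_pos δ with h | h
            · exact Or.inl h
            · have h3 := hmin δ h (hδ.gdProd ν)
              have h4 := hδ.1
              exact Or.inr (by omega)
          · rw [he] at hμ
            simp [eps] at hμ
            omega
        · exact hl a ha
      · change gdProd μ (listProd l) = _
        rw [hprod]

/-- The factorization `ω = ω₁ • ω₂ • … • ωₗ` into nontrivial atomic permutations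
(which is unique). -/
noncomputable def atoms (ω : Permutation) : List Permutation := (exists_factorization ω).choose

end Permutation

/-- All shuffles of two lists, with multiplicities. -/
def listShuffles {α : Type*} : List α → List α → List (List α)
  | [], l => [l]
  | a :: l, [] => [a :: l]
  | a :: l, b :: l' =>
    (listShuffles l (b :: l')).map (a :: ·) ++ (listShuffles (a :: l) l').map (b :: ·)

/-- The vector space with basis the permutations. -/
abbrev HS (k : Type u) [Field k] : Type u := Permutation →₀ k

namespace HS

variable (k : Type u) [Field k]

/-- The basis element attached to a permutation. -/
noncomputable def basis (ω : Permutation) : HS k := Finsupp.single ω 1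

/-- The shuffle product, the deconcatenation coproduct, and their unit and counit. -/
noncomputable def hopfData : HopfData k (HS k) where
  mul := Finsupp.lift (HS k →ₗ[k] HS k) k Permutation fun π =>
    Finsupp.lift (HS k) k Permutation fun ω =>
      ((listShuffles π.atoms ω.atoms).map fun l => basis k (Permutation.listProd l)).sum
  one := basis k Permutation.eps
  comul := Finsupp.lift (HS k ⊗[k] HS k) k Permutation fun ω =>
    ∑ i ∈ Finset.range (ω.atoms.length + 1),
      basis k (Permutation.listProd (ω.atoms.take i)) ⊗ₜ[k]
        basis k (Permutation.listProd (ω.atoms.drop i))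
  counit := Finsupp.lift k k Permutation fun ω => if ω = Permutation.eps then 1 else 0

/-- The span of the permutations of size `n`. -/
noncomputable def grading (n : ℕ) : Submodule k (HS k) :=
  Submodule.span k (basis k '' {ω | ω.1 = n})

end HS

/-! ## Pipe dreams -/

/-- A filling with crosses and elbows of the triangle of boxes `(i, j)` (row `i` from the top,
column `j` from the left, both numbered from `0`) with `i + j ≤ n`, given by the size `n` and the
set of boxes filled with a cross. All other boxes are filled with an elbow. -/
@[ext]
structure Filling where
  n : ℕ
  crosses : Finset (ℕ × ℕ)
deriving DecidableEq

namespace Filling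

mutual

/-- The label of the pipe that enters the box `(i, j)` through its left side. The pipe that enters
the triangle on the left side in row `i` has label `i`. In a cross, both pipes go straight.
In an elbow, the pipe coming from the left turns up and the pipe coming from below turns right. -/
def west (X : Filling) (i j : ℕ) : ℕ :=
  match j with
  | 0 => i
  | j + 1 => if (i, j) ∈ X.crosses then west X i j else south X i j
termination_by (j, X.n - i)

/-- The label of the pipe that enters the box `(i, j)` through its bottom side. There is such a
pipe only for `i + j < n`; the value for other boxes is irrelevant. -/
def south (X : Filling) (i j : ℕ) : ℕ :=
  if i + j < X.n then
    if (i + 1, j) ∈ X.crosses then south X (i + 1) j else west X (i + 1) j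
  else 0
termination_by (j, X.n - i)

end

/-- The label of the pipe that leaves the box `(i, j)` through its top side. -/
def north (X : Filling) (i j : ℕ) : ℕ :=
  if (i, j) ∈ X.crosses then X.south i j else X.west i j

/-- The filling is a reduced pipe dream with an elbow in the top left corner: there is no cross
outside of the triangle, on its boundary `i + j = n` or in the box `(0, 0)`, and any two pipes
cross at most once. -/
def IsPipeDream (X : Filling) : Prop :=
  (∀ c ∈ X.crosses, c.1 + c.2 < X.n) ∧ (0, 0) ∉ X.crosses ∧
    ∀ c ∈ X.crosses, ∀ d ∈ X.crosses,
      s(X.west c.1 c.2, X.south c.1 c.2) = s(X.west d.1 d.2, X.south d.1 d.2) → c = d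

instance (X : Filling) : Decidable X.IsPipeDream := by
  unfold IsPipeDream
  infer_instance

/-- Reflection exchanging rows and columns. -/
def transpose (X : Filling) : Filling := ⟨X.n, X.crosses.image Prod.swap⟩

/-- Horizontal packing: keep only the pipes entering in the rows `0, …, k`. Each cross between two
of these pipes stays in its row, and moves to the left as many steps as the number of removed pipes
passing to its left, so that its new column is the number of kept pipes passing to its left. -/
def hPack (k : ℕ) (X : Filling) : Filling :=
  ⟨k, (X.crosses.filter fun c => X.west c.1 c.2 ≤ k ∧ X.south c.1 c.2 ≤ k).image fun c =>
    (c.1, ((Finset.range c.2).filter fun j => X.north c.1 j ≤ k).card)⟩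

/-- Vertical packing, defined symmetrically: keep only the pipes exiting in the
columns `0, …, k`. -/
def vPack (k : ℕ) (X : Filling) : Filling := (hPack k X.transpose).transpose

/-- Insertion of `Y` into `X` at the gap `γ`: insert `Y.n` new columns after column `γ` and
`Y.n` new rows after row `X.n - γ` of `X`, fill with `Y` the triangle of boxes located in the
rows `X.n - γ, …, X.n - γ + Y.n` and columns `γ, …, γ + Y.n`, and fill with crosses the other boxes
of the new columns (above that triangle) and of the new rows (to the left of that triangle). -/
def insert (X : Filling) (γ : ℕ) (Y : Filling) : Filling :=
  ⟨X.n + Y.n,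
    (X.crosses.image fun c =>
      (if c.1 ≤ X.n - γ then c.1 else c.1 + Y.n, if c.2 ≤ γ then c.2 else c.2 + Y.n)) ∪
    (Y.crosses.image fun c => (X.n - γ + c.1, γ + c.2)) ∪
    (Finset.range (X.n - γ) ×ˢ Finset.Ioc γ (γ + Y.n)) ∪
    (Finset.Ioc (X.n - γ) (X.n - γ + Y.n) ×ˢ Finset.range γ)⟩

/-- Auxiliary to `tangle`. The list consists of the remaining blocks of the word, `X` is the result
of the insertions made so far, `Y` is the part that has not been inserted yet, and `γ` is the
number of letters that have been read. -/
def tangleBlocks (X Y : Filling) (γ : ℕ) : List (List Bool) → Filling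
  | [] => X
  | b :: bs =>
    if b.head? = some true then tangleBlocks X Y (γ + b.length) bs
    else tangleBlocks (X.insert γ (Y.vPack b.length)) (Y.hPack (Y.n - b.length))
      (γ + b.length) bs

/-- Tangling `X` and `Y` according to a word `s` on the letters `p = true` and `q = false`:
untangle `Y` at all gaps marked by blocks of letters `p` into smaller fillings `Y₁, …, Yₗ`,
and insert these successively, from left to right, in `X` at the positions of the blocks of
letters `q`. -/
def tangle (X Y : Filling) (s : List Bool) : Filling :=
  tangleBlocks X Y 0 (s.splitBy (· == ·))

end Filling

/-- Reduced pipe dreams with an elbow in the top left corner. -/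
abbrev PipeDream : Type := {X : Filling // X.IsPipeDream}

namespace PipeDream

theorem multiset_row (X : Filling) (i m : ℕ) :
    (Multiset.range m).map (X.north i) + {X.west i m} =
      {i} + (Multiset.range m).map (X.south i) := by
  induction m with
  | zero => simp [Filling.west]
  | succ m ih =>
    rw [Multiset.range_succ, Multiset.map_cons, Multiset.map_cons]
    have h : ({X.north i m} : Multiset ℕ) + {X.west i (m + 1)} = {X.west i m} + {X.south i m} := by
      rw [Filling.west, Filling.north]
      split_ifs
      · exact add_comm _ _
      · rfl
    rw [← Multiset.singleton_add, ← Multiset.singleton_add, add_right_comm, h, add_right_comm,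
      add_comm {X.west i m}, ih, add_assoc, add_comm (Multiset.map _ _)]

theorem multiset_north (P : PipeDream) (d i : ℕ) (h : i + d = P.1.n) :
    (Multiset.range (d + 1)).map (P.1.north i) = (Multiset.range (d + 1)).map (i + ·) := by
  induction d generalizing i with
  | zero =>
    have hc : (i, 0) ∉ P.1.crosses := fun hc => by
      have := P.2.1 _ hc
      simp only at this
      omega
    simp [Filling.north, hc, Filling.west]
  | succ d ih =>
    have hc : (i, d + 1) ∉ P.1.crosses := fun hc => by
      have := P.2.1 _ hc
      simp only at this
      omega
    have hs : (Multiset.range (d + 1)).map (P.1.south i)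
        = (Multiset.range (d + 1)).map (P.1.north (i + 1)) := by
      refine Multiset.map_congr rfl fun j hj => ?_
      rw [Multiset.mem_range] at hj
      rw [Filling.south, if_pos (by omega), Filling.north]
    have hn : P.1.north i (d + 1) = P.1.west i (d + 1) := by simp [Filling.north, hc]
    rw [Multiset.range_succ, Multiset.map_cons, hn, ← Multiset.singleton_add, add_comm,
      multiset_row, hs, ih (i + 1) (by omega), ← Multiset.range_succ,
      ← Multiset.coe_range, ← Multiset.coe_range,
      List.range_succ_eq_map (n := d + 1)]
    simp only [Multiset.map_coe, List.map_cons, List.map_map]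
    rw [add_zero, ← Multiset.cons_coe, Multiset.singleton_add]
    congr 3
    funext j
    simp only [Function.comp]
    omega

theorem map_north (P : PipeDream) :
    (Multiset.range (P.1.n + 1)).map (P.1.north 0) = Multiset.range (P.1.n + 1) := by
  rw [multiset_north P P.1.n 0 (Nat.zero_add _)]
  simp

theorem north_zero (P : PipeDream) : P.1.north 0 0 = 0 := by
  simp [Filling.north, P.2.2.1, Filling.west]

theorem north_le (P : PipeDream) (j : ℕ) (hj : j ≤ P.1.n) : P.1.north 0 j ≤ P.1.n := by
  have h : P.1.north 0 j ∈ (Multiset.range (P.1.n + 1)).map (P.1.north 0) :=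
    Multiset.mem_map_of_mem _ (Multiset.mem_range.2 (by omega))
  rw [map_north, Multiset.mem_range] at h
  omega

theorem north_inj (P : PipeDream) (i j : ℕ) (hi : i ≤ P.1.n) (hj : j ≤ P.1.n)
    (h : P.1.north 0 i = P.1.north 0 j) : i = j := by
  have hnd : ((Multiset.range (P.1.n + 1)).map (P.1.north 0)).Nodup := by
    rw [map_north]
    exact Multiset.nodup_range _
  exact Multiset.inj_on_of_nodup_map hnd i (Multiset.mem_range.2 (by omega)) j
    (Multiset.mem_range.2 (by omega)) h

theorem north_pos (P : PipeDream) (j : ℕ) (hj : j < P.1.n) : 0 < P.1.north 0 (j + 1) := by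
  rcases Nat.eq_zero_or_pos (P.1.north 0 (j + 1)) with h | h
  · have := north_inj P (j + 1) 0 hj (Nat.zero_le _) (h.trans (north_zero P).symm)
    omega
  · exact h

/-- The labels of the nonzero pipes in the order of their exits, as a map of `Fin n`
(so that pipe `i + 1` and column `j + 1` are written `i` and `j`). -/
def exitFun (P : PipeDream) (j : Fin P.1.n) : Fin P.1.n :=
  ⟨P.1.north 0 (j + 1) - 1, by
    have := north_le P (j + 1) j.2
    have := north_pos P j j.2
    omega⟩

theorem exitFun_injective (P : PipeDream) : Function.Injective P.exitFun := fun i j h => by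
  have h1 : P.1.north 0 (i + 1) - 1 = P.1.north 0 (j + 1) - 1 := congrArg Fin.val h
  have := north_pos P i i.2
  have := north_pos P j j.2
  have := north_inj P (i + 1) (j + 1) i.2 j.2 (by omega)
  exact Fin.ext (by omega)

/-- The exiting permutation: the order of the exit points of the nonzero pipes, from left to
right. -/
noncomputable def omega (P : PipeDream) : Permutation :=
  ⟨P.1.n, Equiv.ofBijective P.exitFun (Finite.injective_iff_bijective.1 P.exitFun_injective)⟩

/-- The pipe dream of size `0`, a single elbow. -/
def elbow : PipeDream := ⟨⟨0, ∅⟩, by decide⟩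

/-- A word `s` with `P.1.n` letters `p = true` and `Q.1.n` letters `q = false` is a `P`/`Q`-shuffle
if each block of letters `q` appears at a global descent of the exiting permutation of `P`
and each block of letters `p` appears at a global descent of that of `Q`. -/
def IsShuffle (P Q : PipeDream) (s : List Bool) : Prop :=
  s.count true = P.1.n ∧ s.count false = Q.1.n ∧
    (∀ u v, s = u ++ false :: v → u.count true ∈ P.omega.globalDescents) ∧
    (∀ u v, s = u ++ true :: v → u.count false ∈ Q.omega.globalDescents)

open Classical in
/-- The set of all `P`/`Q`-shuffles. -/
noncomputable def shuffles (P Q : PipeDream) : Finset (List Bool) :=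
  (List.replicate P.1.n true ++ List.replicate Q.1.n false).permutations.toFinset.filter
    (IsShuffle P Q)

end PipeDream

/-- The vector space with basis the pipe dreams. -/
abbrev HP (k : Type u) [Field k] : Type u := PipeDream →₀ k

namespace HP

variable (k : Type u) [Field k]

/-- The basis element attached to a pipe dream. -/
noncomputable def basis (P : PipeDream) : HP k := Finsupp.single P 1

/-- The basis element attached to a filling that is a pipe dream (and `0` for other fillings;
this case does not occur in the product and the coproduct below, which is part of the theorem). -/
noncomputable def ofFilling (X : Filling) : HP k :=
  if h : X.IsPipeDream then basis k ⟨X, h⟩ else 0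

/-- The product is the sum over all shuffles of the tangled pipe dreams, and the coproduct is the
sum over all global descents of the untangled pipe dreams. -/
noncomputable def hopfData : HopfData k (HP k) where
  mul := Finsupp.lift (HP k →ₗ[k] HP k) k PipeDream fun P =>
    Finsupp.lift (HP k) k PipeDream fun Q =>
      ∑ s ∈ PipeDream.shuffles P Q, ofFilling k (Filling.tangle P.1 Q.1 s)
  one := basis k PipeDream.elbow
  comul := Finsupp.lift (HP k ⊗[k] HP k) k PipeDream fun P =>
    ∑ γ ∈ P.omega.globalDescents,
      ofFilling k (Filling.vPack γ P.1) ⊗ₜ[k] ofFilling k (Filling.hPack (P.1.n - γ) P.1)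
  counit := Finsupp.lift k k PipeDream fun P => if P = PipeDream.elbow then 1 else 0

/-- The span of the pipe dreams of size `n`. -/
noncomputable def grading (n : ℕ) : Submodule k (HP k) :=
  Submodule.span k (basis k '' {P | P.1.n = n})

/-- The linear extension of the map sending a pipe dream to its exiting permutation. -/
noncomputable def omega : HP k →ₗ[k] HS k := Finsupp.lmapDomain k k PipeDream.omega

end HP

/-!
Permutations and pipe dreams carry the same combinatorial structure, formalized here as a
`CutSystem`. An object has a word of atoms: the atomic factors of a permutation, or of the exiting
permutation of a pipe dream. It can be cut at each gap between atoms into a left part and a right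
part, and another object can be inserted at each gap. All that matters is how cuts and insertions
commute. Two objects `x` and `y` can be tangled along each word `w` whose letters say whether the
next atom comes from `x` or from `y`: the blocks of `y` given by `w` are inserted in `x`.

The product is the sum of all tanglings and the coproduct is the sum of all cuts, and this is a
graded connected Hopf algebra for every cut system (`CutSystem.IsSize.isGradedConnectedHopf`).
Both ways to multiply three factors give the sum of the tanglings along all words in three letters
(`CutSystem.tangle_assoc`). A cut of a tangled object after `j` letters tangles the left parts
along the first `j` letters and the right parts along the other letters (`CutSystem.left_tangle`,
`CutSystem.right_tangle`), and the pairs of a word and a splitting of it are the pairs of words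
(`sum_twoWords_split`); thus the coproduct is multiplicative. As the only object without atoms is
the unit, a left and a right antipode are defined by recursion on the number of atoms; they agree,
because both are inverses of the identity for the convolution.

For permutations, the factorization into atoms is unique
(`Permutation.IsFactorization.eq_of_listProd_eq`), so that a permutation is the same as its word,
and all axioms hold in the free monoid. For pipe dreams, the axioms are identities between
fillings. Labels on lattice paths show that a filling is reduced if and only if at each cross the
pipe coming from the left has the smaller label (`Filling.isPipeDream_iff`). By induction on the
rows from the bottom, packings and insertions change the labels in the expected way
(`Filling.InTriangle.north_hPack`, `Filling.insert_upper`). Since a pipe dream is determined by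
the rows in which its pipes cross (`Filling.eq_of_crosses_iff`), the packing of an insertion can
be computed from crossing pairs (`Filling.crosses_insert`, `Filling.IsPipeDream.hPack_insert`).
That a horizontal and a vertical packing at global descents commute
(`Filling.IsPipeDream.hPack_vPack`) comes from counting the pipes that enter and leave a rectangle
(`Filling.count_rectangle`). Statements about vertical packings follow by reflection. Finally,
shuffles of pipes that respect the global descents are words of atoms with each atom replaced by a
block of its size (`PipeDream.shuffles_eq`), so that the product and the coproduct of pipe dreams
are those of the cut system (`HP.hopfData_eq`).

The exiting permutation preserves words by definition, and a permutation is determined by its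
word, so it commutes with cuts and tanglings (`CutSystem.mapDomain_mul`,
`CutSystem.mapDomain_comul`) and hence with the antipodes (`BialgHom.map_antipode`). For the same
reason the product of permutations is commutative (`CutSystem.mul_comm`): exchanging the letters
of a word exchanges the factors. The morphism is surjective because each permutation is the
exiting permutation of a pipe dream whose crosses are left-justified in each row, with row lengths
given by the inversions (`PipeDream.omega_surjective`).
-/

namespace Filling

/-! ### Labels of the pipes in a filling -/

/-- No cross on the boundary `i + j = n` or outside of the triangle. -/
def InTriangle (X : Filling) : Prop := ∀ c ∈ X.crosses, c.1 + c.2 < X.n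

@[simp] theorem west_zero (X : Filling) (i : ℕ) : X.west i 0 = i := by simp [west]

theorem west_succ (X : Filling) (i j : ℕ) :
    X.west i (j + 1) = if (i, j) ∈ X.crosses then X.west i j else X.south i j := by
  rw [west]

theorem south_eq_north {X : Filling} {i j : ℕ} (h : i + j < X.n) :
    X.south i j = X.north (i + 1) j := by
  rw [south, if_pos h, north]

theorem InTriangle.notMem {X : Filling} (hX : X.InTriangle) {i j : ℕ} (h : X.n ≤ i + j) :
    (i, j) ∉ X.crosses := fun hc => by
  have := hX _ hc
  simp only at this
  omega

/-- The boxes of the triangle, row by row from the bottom and from left to right in each row. -/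
theorem box_induction {n : ℕ} {motive : ℕ → ℕ → Prop} (zero : motive n 0)
    (row : ∀ i, i < n → motive (i + 1) (n - (i + 1)) → motive i 0)
    (col : ∀ i j, i + j < n → motive i j → motive i (j + 1)) :
    ∀ i j, i + j ≤ n → motive i j := by
  have key : ∀ d i, i + d = n → motive i 0 → ∀ j, i + j ≤ n → motive i j := by
    intro d i _ h0 j
    induction j with
    | zero => exact fun _ => h0
    | succ j ih => exact fun h => col i j (by omega) (ih (by omega))
  have main : ∀ d i, i + d = n → motive i 0 := by
    intro d
    induction d with
    | zero => rintro i rfl; exact zero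
    | succ d ih =>
      intro i hi
      refine row i (by omega) ?_
      exact key d (i + 1) (by omega) (ih (i + 1) (by omega)) _ (by omega)
  exact fun i j h => key (n - i) i (by omega) (main (n - i) i (by omega)) j h

/-- The labels met by the lattice path that runs along the top of the boxes of row `i` in the
columns before `j`, goes down the left side of the box `(i, j)`, and then runs along the bottom
of row `i`. -/
def state (X : Filling) (i j p : ℕ) : ℕ :=
  if p < j then X.north i p else if p = j then X.west i j else X.south i (p - 1)

theorem state_self (X : Filling) (i j : ℕ) : X.state i j j = X.west i j := by simp [state]

theorem state_lt (X : Filling) {i j p : ℕ} (h : p < j) : X.state i j p = X.north i p := by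
  simp [state, h]

theorem state_gt (X : Filling) {i j p : ℕ} (h : j ≤ p) : X.state i j (p + 1) = X.south i p := by
  simp [state, show ¬ p + 1 < j by omega, show p + 1 ≠ j by omega]

/-- Moving the path across a box replaces two of its steps: a cross swaps their labels, an elbow
keeps them. -/
theorem state_succ (X : Filling) (i j p : ℕ) :
    X.state i (j + 1) p =
      X.state i j (if (i, j) ∈ X.crosses then Equiv.swap j (j + 1) p else p) := by
  rcases lt_trichotomy p j with h | rfl | h
  · have hs : Equiv.swap j (j + 1) p = p := Equiv.swap_apply_of_ne_of_ne (by omega) (by omega)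
    rw [hs, ite_self, state_lt _ h, state_lt _ (by omega)]
  · rw [state_lt _ (Nat.lt_succ_self p), Equiv.swap_apply_left, north]
    split_ifs
    · rw [state_gt _ le_rfl]
    · rw [state_self]
  · rcases Nat.lt_or_ge (j + 1) p with h' | h'
    · have hs : Equiv.swap j (j + 1) p = p := Equiv.swap_apply_of_ne_of_ne (by omega) (by omega)
      obtain ⟨q, rfl⟩ : ∃ q, p = q + 1 := ⟨p - 1, by omega⟩
      rw [hs, ite_self, state_gt _ (by omega), state_gt _ (by omega)]
    · obtain rfl : p = j + 1 := by omega
      rw [state_self, Equiv.swap_apply_right, west_succ]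
      split_ifs
      · rw [state_self]
      · rw [state_gt _ le_rfl]

/-- The path below row `i` is the path above row `i + 1`, extended by the pipe entering in row
`i`. -/
theorem InTriangle.state_zero_succ {X : Filling} (hX : X.InTriangle) {i p : ℕ}
    (h : i + p < X.n) : X.state i 0 (p + 1) = X.state (i + 1) (X.n - (i + 1)) p := by
  rw [state_gt _ (Nat.zero_le p), south_eq_north h]
  rcases Nat.lt_or_ge p (X.n - (i + 1)) with h' | h'
  · rw [state_lt _ h']
  · obtain rfl : p = X.n - (i + 1) := by omega
    rw [state_self, north, if_neg (hX.notMem (by omega))]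

theorem swap_le {j p n : ℕ} (hj : j < n) (hp : p ≤ n) : Equiv.swap j (j + 1) p ≤ n := by
  rw [Equiv.swap_apply_def]
  split_ifs <;> omega

/-- The labels on each lattice path are distinct, and lie between `i` and `X.n`. -/
theorem InTriangle.state_spec {X : Filling} (hX : X.InTriangle) :
    ∀ i j, i + j ≤ X.n → (∀ p, i + p ≤ X.n → i ≤ X.state i j p ∧ X.state i j p ≤ X.n) ∧
      (∀ p q, i + p ≤ X.n → i + q ≤ X.n → X.state i j p = X.state i j q → p = q) := by
  refine box_induction ?_ ?_ ?_
  · refine ⟨fun p hp => ?_, fun p q hp hq _ => by omega⟩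
    obtain rfl : p = 0 := by omega
    simp [state_self]
  · rintro i hi ⟨h1, h2⟩
    constructor
    · rintro (_ | p) hp
      · simp [state_self]; omega
      · rw [hX.state_zero_succ (by omega)]
        have := h1 p (by omega)
        omega
    · rintro (_ | p) (_ | q) hp hq h
      · rfl
      · rw [hX.state_zero_succ (by omega), state_self, west_zero] at h
        have := h1 q (by omega)
        omega
      · rw [hX.state_zero_succ (by omega), state_self, west_zero] at h
        have := h1 p (by omega)
        omega
      · rw [hX.state_zero_succ (by omega), hX.state_zero_succ (by omega)] at h
        rw [h2 p q (by omega) (by omega) h]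
  · rintro i j hij ⟨h1, h2⟩
    have hs : ∀ p, i + p ≤ X.n → i + Equiv.swap j (j + 1) p ≤ X.n := fun p hp => by
      have := swap_le (j := j) (p := p) (n := X.n - i) (by omega) (by omega)
      omega
    constructor
    · intro p hp
      rw [state_succ]
      split_ifs
      · exact h1 _ (hs p hp)
      · exact h1 p hp
    · intro p q hp hq h
      rw [state_succ, state_succ] at h
      split_ifs at h
      · exact (Equiv.swap j (j + 1)).injective (h2 _ _ (hs p hp) (hs q hq) h)
      · exact h2 p q hp hq h

theorem InTriangle.west_le {X : Filling} (hX : X.InTriangle) {i j : ℕ} (h : i + j ≤ X.n) :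
    i ≤ X.west i j ∧ X.west i j ≤ X.n := by
  have := (hX.state_spec i j h).1 j h
  rwa [state_self] at this

theorem InTriangle.north_le {X : Filling} (hX : X.InTriangle) {i j : ℕ} (h : i + j ≤ X.n) :
    i ≤ X.north i j ∧ X.north i j ≤ X.n := by
  rw [north]
  split_ifs with hc
  · have h' := hX _ hc
    have := (hX.state_spec i j h).1 (j + 1) h'
    rwa [state_gt _ le_rfl] at this
  · exact hX.west_le h

theorem InTriangle.south_le {X : Filling} (hX : X.InTriangle) {i j : ℕ} (h : i + j < X.n) :
    i < X.south i j ∧ X.south i j ≤ X.n := by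
  rw [south_eq_north h]
  have := hX.north_le (i := i + 1) (j := j) (by omega)
  omega

theorem InTriangle.north_inj {X : Filling} (hX : X.InTriangle) {i j j' : ℕ} (h : i + j ≤ X.n)
    (h' : i + j' ≤ X.n) (e : X.north i j = X.north i j') : j = j' := by
  have key : ∀ j, i + j ≤ X.n → X.north i j = X.state i (X.n - i) j := fun j h => by
    rcases Nat.lt_or_ge j (X.n - i) with h' | h'
    · rw [state_lt _ h']
    · obtain rfl : j = X.n - i := by omega
      rw [state_self, north, if_neg (hX.notMem (by omega))]
  rw [key j h, key j' h'] at e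
  exact (hX.state_spec i (X.n - i) (by omega)).2 j j' h h' e

/-- All crosses between two pipes are in the order in which the pipes enter: at a cross, the pipe
coming from the left has the smaller label. -/
def IsReduced (X : Filling) : Prop := ∀ c ∈ X.crosses, X.west c.1 c.2 < X.south c.1 c.2

/-- Two labels that are out of order on a lattice path have crossed before it. -/
theorem InTriangle.crossed_of_inversion {X : Filling} (hX : X.InTriangle) :
    ∀ i j, i + j ≤ X.n → ∀ p q, p < q → i + q ≤ X.n → X.state i j q < X.state i j p →
      ∃ c ∈ X.crosses, (i < c.1 ∨ i = c.1 ∧ c.2 < j) ∧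
        s(X.west c.1 c.2, X.south c.1 c.2) = s(X.state i j p, X.state i j q) := by
  refine box_induction ?_ ?_ ?_
  · intro p q h1 h2
    omega
  · rintro i hi ih (_ | p) (_ | q) hpq hq h
    · omega
    · rw [state_self, west_zero] at h
      have := ((hX.state_spec i 0 (by omega)).1 (q + 1) hq).1
      omega
    · omega
    · rw [hX.state_zero_succ (by omega), hX.state_zero_succ (by omega)] at h ⊢
      obtain ⟨c, hc, ho, e⟩ := ih p q (by omega) (by omega) h
      exact ⟨c, hc, by omega, e⟩
  · intro i j hij ih p q hpq hq h
    rw [state_succ, state_succ] at h ⊢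
    by_cases hc : (i, j) ∈ X.crosses
    · rw [if_pos hc, if_pos hc] at h ⊢
      by_cases hp : p = j ∧ q = j + 1
      · obtain ⟨rfl, rfl⟩ := hp
        refine ⟨_, hc, Or.inr ⟨rfl, Nat.lt_succ_self _⟩, ?_⟩
        rw [Equiv.swap_apply_left, Equiv.swap_apply_right, state_self, state_gt _ le_rfl,
          Sym2.eq_swap]
      · have h1 : Equiv.swap j (j + 1) p < Equiv.swap j (j + 1) q := by
          simp only [Equiv.swap_apply_def]
          split_ifs <;> omega
        have h2 := swap_le (j := j) (p := q) (n := X.n - i) (by omega) (by omega)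
        obtain ⟨c, hc, ho, e⟩ := ih _ _ h1 (by omega) h
        exact ⟨c, hc, by omega, e⟩
    · rw [if_neg hc, if_neg hc] at h ⊢
      obtain ⟨c, hc, ho, e⟩ := ih p q hpq hq h
      exact ⟨c, hc, by omega, e⟩

/-- In a reduced filling, two labels that have crossed before a lattice path are out of order on
it. -/
theorem IsReduced.inversion_of_crossed {X : Filling} (hr : X.IsReduced) (hX : X.InTriangle)
    {c : ℕ × ℕ} (hc : c ∈ X.crosses) :
    ∀ i j, i + j ≤ X.n → (i < c.1 ∨ i = c.1 ∧ c.2 < j) → ∃ p q, p < q ∧ i + q ≤ X.n ∧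
      X.state i j p = X.south c.1 c.2 ∧ X.state i j q = X.west c.1 c.2 := by
  have hcn := hX c hc
  refine box_induction ?_ ?_ ?_
  · intro h
    omega
  · intro i hi ih h
    obtain ⟨p, q, hpq, hq, e1, e2⟩ := ih (by omega)
    exact ⟨p + 1, q + 1, by omega, by omega, by rw [hX.state_zero_succ (by omega), e1],
      by rw [hX.state_zero_succ (by omega), e2]⟩
  · intro i j hij ih h
    by_cases hj : i = c.1 ∧ c.2 = j
    · obtain ⟨rfl, rfl⟩ := hj
      refine ⟨c.2, c.2 + 1, by omega, by omega, ?_, ?_⟩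
      · rw [state_succ, if_pos hc, Equiv.swap_apply_left, state_gt _ le_rfl]
      · rw [state_succ, if_pos hc, Equiv.swap_apply_right, state_self]
    · obtain ⟨p, q, hpq, hq, e1, e2⟩ := ih (by omega)
      by_cases hd : (i, j) ∈ X.crosses
      · have hne : ¬ (p = j ∧ q = j + 1) := by
          rintro ⟨rfl, rfl⟩
          rw [state_self] at e1
          rw [state_gt _ le_rfl] at e2
          have h1 := hr _ hd
          have h2 := hr _ hc
          simp only at h1
          omega
        have h2 := swap_le (j := j) (p := q) (n := X.n - i) (by omega) (by omega)
        refine ⟨Equiv.swap j (j + 1) p, Equiv.swap j (j + 1) q, ?_, by omega, ?_, ?_⟩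
        · simp only [Equiv.swap_apply_def]
          split_ifs <;> omega
        · rw [state_succ, if_pos hd, Equiv.swap_apply_self, e1]
        · rw [state_succ, if_pos hd, Equiv.swap_apply_self, e2]
      · exact ⟨p, q, hpq, hq, by rw [state_succ, if_neg hd, e1], by rw [state_succ, if_neg hd, e2]⟩

/-- Without repeated crosses, the pairs that have crossed before a lattice path are the inversions
of its labels. Hence the pipes cross at most once if and only if no cross removes an inversion,
which is a condition on each cross separately. -/
theorem isPipeDream_iff {X : Filling} :
    X.IsPipeDream ↔ X.InTriangle ∧ (0, 0) ∉ X.crosses ∧ X.IsReduced := by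
  refine and_congr_right fun hX => and_congr_right fun _ => ⟨fun h c hc => ?_, fun hr => ?_⟩
  · have hX : X.InTriangle := hX
    have hcn := hX c hc
    by_contra hlt
    have hne : X.west c.1 c.2 ≠ X.south c.1 c.2 := fun e => by
      have := (hX.state_spec c.1 c.2 (by omega)).2 c.2 (c.2 + 1) (by omega) (by omega)
      rw [state_self, state_gt _ le_rfl] at this
      exact absurd (this e) (by omega)
    -- a cross removing an inversion is the second cross of its two pipes
    obtain ⟨d, hd, ho, e⟩ := hX.crossed_of_inversion c.1 c.2 (by omega) c.2 (c.2 + 1)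
      (by omega) (by omega) (by rw [state_self, state_gt _ le_rfl]; omega)
    rw [state_self, state_gt _ le_rfl] at e
    rw [h d hd c hc e] at ho
    omega
  · have hX : X.InTriangle := hX
    have key : ∀ c ∈ X.crosses, ∀ d ∈ X.crosses, (c.1 < d.1 ∨ c.1 = d.1 ∧ d.2 < c.2) →
        s(X.west c.1 c.2, X.south c.1 c.2) ≠ s(X.west d.1 d.2, X.south d.1 d.2) := by
      intro c hc d hd ho e
      have hcn := hX c hc
      -- the cross `d` creates an inversion that persists until `c`, where it would be removed
      obtain ⟨p, q, hpq, hq, e1, e2⟩ := hr.inversion_of_crossed hX hd c.1 c.2 (by omega) ho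
      have h1 := hr c hc
      have h2 := hr d hd
      rw [Sym2.eq_iff] at e
      have hw : X.west c.1 c.2 = X.west d.1 d.2 ∧ X.south c.1 c.2 = X.south d.1 d.2 := by omega
      rw [← hw.2, ← state_gt X (le_refl c.2)] at e1
      rw [← hw.1, ← state_self] at e2
      have h3 := (hX.state_spec c.1 c.2 (by omega)).2 _ _ (by omega) (by omega) e1
      have h4 := (hX.state_spec c.1 c.2 (by omega)).2 _ _ (by omega) (by omega) e2
      omega
    intro c hc d hd e
    rcases lt_trichotomy c.1 d.1 with h | h | h
    · exact absurd e (key c hc d hd (Or.inl h))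
    · rcases lt_trichotomy c.2 d.2 with h' | h' | h'
      · exact absurd e.symm (key d hd c hc (Or.inr ⟨h.symm, h'⟩))
      · exact Prod.ext h h'
      · exact absurd e (key c hc d hd (Or.inr ⟨h, h'⟩))
    · exact absurd e.symm (key d hd c hc (Or.inl h))

theorem IsPipeDream.inTriangle {X : Filling} (hX : X.IsPipeDream) : X.InTriangle := hX.1

theorem IsPipeDream.isReduced {X : Filling} (hX : X.IsPipeDream) : X.IsReduced :=
  (isPipeDream_iff.1 hX).2.2

/-! ### Conservation of pipes -/

/-- The pipes entering the first `c` boxes of row `i` are those leaving them. -/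
theorem count_row (X : Filling) (p : ℕ → Prop) [DecidablePred p] (i c : ℕ) :
    Nat.count (fun j => p (X.north i j)) c + (if p (X.west i c) then 1 else 0) =
      (if p i then 1 else 0) + Nat.count (fun j => p (X.south i j)) c := by
  induction c with
  | zero => simp
  | succ c ih =>
    rw [Nat.count_succ, Nat.count_succ, west_succ, north]
    split_ifs at * <;> omega

theorem count_south {X : Filling} (p : ℕ → Prop) [DecidablePred p] {i c : ℕ}
    (h : i + c ≤ X.n) :
    Nat.count (fun j => p (X.south i j)) c = Nat.count (fun j => p (X.north (i + 1) j)) c := by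
  induction c with
  | zero => simp
  | succ c ih => rw [Nat.count_succ, Nat.count_succ, ih (by omega), south_eq_north (by omega)]

/-- The pipes entering the rectangle formed by the first `r` rows and the first `c` columns are
those leaving it. -/
theorem count_rectangle {X : Filling} (p : ℕ → Prop) [DecidablePred p] {r c : ℕ}
    (h : r + c ≤ X.n + 1) :
    Nat.count (fun j => p (X.north r j)) c + Nat.count p r =
      Nat.count (fun j => p (X.north 0 j)) c + Nat.count (fun i => p (X.west i c)) r := by
  induction r with
  | zero => simp
  | succ r ih =>
    have h1 := ih (by omega)
    have h2 := X.count_row p r c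
    rw [count_south p (by omega)] at h2
    rw [Nat.count_succ, Nat.count_succ]
    omega

/-- The number of labels in a row that satisfy `p`. -/
theorem InTriangle.count_north {X : Filling} (hX : X.InTriangle) (p : ℕ → Prop)
    [DecidablePred p] {i d : ℕ} (h : i + d = X.n + 1) :
    Nat.count (fun j => p (X.north i j)) d + Nat.count p i = Nat.count p (X.n + 1) := by
  induction d generalizing i with
  | zero =>
    obtain rfl : i = X.n + 1 := by omega
    simp
  | succ d ih =>
    have h1 := ih (i := i + 1) (by omega)
    have h2 := X.count_row p i d
    rw [count_south p (by omega)] at h2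
    rw [Nat.count_succ] at h1 ⊢
    rw [show X.north i d = X.west i d by rw [north, if_neg (hX.notMem (by omega))]]
    omega

/-! ### Reflection -/

@[simp] theorem transpose_n (X : Filling) : X.transpose.n = X.n := rfl

@[simp] theorem mem_transpose {X : Filling} {i j : ℕ} :
    (i, j) ∈ X.transpose.crosses ↔ (j, i) ∈ X.crosses := by
  simp [transpose]

@[simp] theorem transpose_transpose (X : Filling) : X.transpose.transpose = X := by
  refine Filling.ext rfl (Finset.ext fun ⟨i, j⟩ => ?_)
  rw [mem_transpose, mem_transpose]

theorem InTriangle.transpose {X : Filling} (hX : X.InTriangle) : X.transpose.InTriangle := by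
  rintro ⟨i, j⟩ hc
  have := hX _ (mem_transpose.1 hc)
  simp only [transpose_n] at this ⊢
  omega

/-- In the reflected filling the pipes run backwards, and are labelled by the columns where they
leave `X`. -/
theorem InTriangle.north_west_transpose {X : Filling} (hX : X.InTriangle) (i : ℕ) :
    (∀ j, i + j ≤ X.n → X.north 0 (X.transpose.west j i) = X.north i j) ∧
      ∀ j, i + j < X.n → X.north 0 (X.transpose.south j i) = X.west i (j + 1) := by
  have key : ∀ i, (∀ j, i + j ≤ X.n → X.north 0 (X.transpose.west j i) = X.north i j) →
      ∀ j, i + j < X.n → X.north 0 (X.transpose.south j i) = X.west i (j + 1) := by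
    intro i h j hj
    obtain ⟨d, hd⟩ : ∃ d, i + j + d + 1 = X.n := ⟨X.n - (i + j + 1), by omega⟩
    induction d generalizing j with
    | zero =>
      rw [south, if_pos (by rw [transpose_n]; omega), if_neg (hX.transpose.notMem
        (by rw [transpose_n]; omega)), h _ (by omega), north, if_neg (hX.notMem (by omega))]
    | succ d ih =>
      rw [south, if_pos (by rw [transpose_n]; omega)]
      simp only [mem_transpose]
      split_ifs with hc
      · rw [ih (j + 1) (by omega) (by omega), west_succ, if_pos hc]
      · rw [h _ (by omega), north, if_neg hc]
  have main : ∀ j, i + j ≤ X.n → X.north 0 (X.transpose.west j i) = X.north i j := by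
    induction i with
    | zero => intro j _; rw [west_zero]
    | succ i ih =>
      intro j hj
      rw [west_succ]
      simp only [mem_transpose]
      split_ifs with hc
      · rw [ih j (by omega), north, if_pos hc, south_eq_north (by omega)]
      · rw [key i ih j (by omega), west_succ, if_neg hc, south_eq_north (by omega)]
  exact ⟨main, key i main⟩

theorem InTriangle.north_west {X : Filling} (hX : X.InTriangle) {i j : ℕ} (h : i + j ≤ X.n) :
    X.north 0 (X.transpose.west j i) = X.north i j := (hX.north_west_transpose i).1 j h

theorem InTriangle.north_south {X : Filling} (hX : X.InTriangle) {i j : ℕ} (h : i + j < X.n) :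
    X.north 0 (X.transpose.south j i) = X.west i (j + 1) := (hX.north_west_transpose i).2 j h

theorem InTriangle.north_north {X : Filling} (hX : X.InTriangle) {i j : ℕ} (h : i + j ≤ X.n) :
    X.north 0 (X.transpose.north j i) = X.west i j := by
  rw [north.eq_def X.transpose]
  simp only [mem_transpose]
  split_ifs with hc
  · rw [hX.north_south (hX _ hc), west_succ, if_pos hc]
  · rw [hX.north_west h, north, if_neg hc]

theorem IsPipeDream.transpose {X : Filling} (hX : X.IsPipeDream) : X.transpose.IsPipeDream := by
  have hT := hX.inTriangle
  refine ⟨hT.transpose, by rw [mem_transpose]; exact hX.2.1, ?_⟩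
  have key : ∀ i j, (i, j) ∈ X.crosses →
      Sym2.map (X.north 0) s(X.transpose.west j i, X.transpose.south j i) =
        s(X.west i j, X.south i j) := by
    intro i j hc
    have hn := hT _ hc
    rw [Sym2.map_mk, hT.north_west (le_of_lt hn), hT.north_south hn, west_succ, if_pos hc,
      north, if_pos hc, Sym2.eq_swap]
  rintro ⟨i, j⟩ hc ⟨i', j'⟩ hd e
  rw [mem_transpose] at hc hd
  have h := congrArg (Sym2.map (X.north 0)) e
  rw [key _ _ hc, key _ _ hd] at h
  have := hX.2.2 _ hc _ hd h
  simp only [Prod.mk.injEq] at this ⊢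
  exact ⟨this.2, this.1⟩

end Filling

namespace Filling

/-! ### Horizontal packing -/

theorem count_le_eq (k m : ℕ) : Nat.count (fun l => l ≤ k) m = min m (k + 1) := by
  induction m with
  | zero => simp
  | succ m ih =>
    rw [Nat.count_succ, ih]
    split_ifs <;> omega

/-- The number of pipes with label at most `k` passing to the left of the box `(i, j)`: the column
to which a cross in this box is moved by horizontal packing. -/
def packCol (X : Filling) (k i j : ℕ) : ℕ := Nat.count (fun c => X.north i c ≤ k) j

@[simp] theorem hPack_n (k : ℕ) (X : Filling) : (hPack k X).n = k := rfl

theorem mem_hPack {k : ℕ} {X : Filling} {i c : ℕ} :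
    (i, c) ∈ (hPack k X).crosses ↔ ∃ j, (i, j) ∈ X.crosses ∧
      (X.west i j ≤ k ∧ X.south i j ≤ k) ∧ X.packCol k i j = c := by
  simp only [hPack, Finset.mem_image, Finset.mem_filter, packCol, Nat.count_eq_card_filter_range,
    Prod.mk.injEq]
  constructor
  · rintro ⟨⟨i', j⟩, ⟨h1, h2⟩, rfl, h3⟩
    exact ⟨j, h1, h2, h3⟩
  · rintro ⟨j, h1, h2, h3⟩
    exact ⟨(i, j), ⟨h1, h2⟩, rfl, h3⟩

theorem north_of_mem {X : Filling} {i j : ℕ} (h : (i, j) ∈ X.crosses) :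
    X.north i j = X.south i j := by rw [north, if_pos h]

theorem north_of_notMem {X : Filling} {i j : ℕ} (h : (i, j) ∉ X.crosses) :
    X.north i j = X.west i j := by rw [north, if_neg h]

theorem west_succ_of_mem {X : Filling} {i j : ℕ} (h : (i, j) ∈ X.crosses) :
    X.west i (j + 1) = X.west i j := by rw [west_succ, if_pos h]

theorem west_succ_of_notMem {X : Filling} {i j : ℕ} (h : (i, j) ∉ X.crosses) :
    X.west i (j + 1) = X.south i j := by rw [west_succ, if_neg h]

theorem mem_hPack_packCol {k : ℕ} {X : Filling} {i j : ℕ} (h : X.north i j ≤ k) :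
    (i, X.packCol k i j) ∈ (hPack k X).crosses ↔
      (i, j) ∈ X.crosses ∧ X.west i j ≤ k ∧ X.south i j ≤ k := by
  rw [mem_hPack]
  constructor
  · rintro ⟨j', h1, h2, h3⟩
    have h4 : X.north i j' ≤ k := by rw [north_of_mem h1]; exact h2.2
    obtain rfl : j' = j := Nat.count_injective h4 h h3
    exact ⟨h1, h2⟩
  · rintro ⟨h1, h2⟩
    exact ⟨j, h1, h2, rfl⟩

theorem packCol_succ (X : Filling) (k i j : ℕ) :
    X.packCol k i (j + 1) = X.packCol k i j + if X.north i j ≤ k then 1 else 0 :=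
  Nat.count_succ _ _

/-- Conservation of the pipes with label at most `k` along the first `j` boxes of row `i`, where
the pipe entering in this row is one of them. -/
theorem packCol_add {X : Filling} {k i j : ℕ} (hik : i ≤ k) (h : i + j ≤ X.n) :
    X.packCol k i j + (if X.west i j ≤ k then 1 else 0) = 1 + X.packCol k (i + 1) j := by
  have := X.count_row (· ≤ k) i j
  rw [count_south (· ≤ k) h, if_pos hik] at this
  exact this

/-- The columns to which pipes are moved lie in the triangle of size `k`. -/
theorem InTriangle.packCol_add_lt {X : Filling} (hX : X.InTriangle) {k i j : ℕ} (hk : k ≤ X.n)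
    (h : i + j ≤ X.n) (hj : X.north i j ≤ k) : i + X.packCol k i j ≤ k := by
  have h1 := hX.count_north (· ≤ k) (i := i) (d := X.n + 1 - i) (by omega)
  rw [count_le_eq, count_le_eq] at h1
  have h2 : X.packCol k i (j + 1) ≤ X.packCol k i (X.n + 1 - i) :=
    Nat.count_monotone _ (by omega)
  rw [packCol_succ, if_pos hj] at h2
  have h3 : X.packCol k i (X.n + 1 - i) + min i (k + 1) = min (X.n + 1) (k + 1) := h1
  have := (hX.north_le h).1
  omega

/-- One row of `north_hPack`: if the labels entering row `i` from below are kept, so are those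
within the row. Where a removed pipe comes from the left, the preceding box of the packed row is an
elbow. -/
theorem InTriangle.hPack_row {X : Filling} (hX : X.InTriangle) {k i : ℕ} (hk : k ≤ X.n)
    (hik : i ≤ k)
    (hn : ∀ j, i + 1 + j ≤ X.n → X.north (i + 1) j ≤ k →
      (hPack k X).north (i + 1) (X.packCol k (i + 1) j) = X.north (i + 1) j)
    (j : ℕ) (hj : i + j ≤ X.n) :
    (X.west i j ≤ k → (hPack k X).west i (X.packCol k i j) = X.west i j) ∧
    (k < X.west i j → ∃ c, X.packCol k i j = c + 1 ∧ (i, c) ∉ (hPack k X).crosses) ∧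
    (i + j < X.n → X.south i j ≤ k →
      (hPack k X).south i (X.packCol k (i + 1) j) = X.south i j) := by
  have hs : ∀ j, i + j < X.n → X.south i j ≤ k →
      (hPack k X).south i (X.packCol k (i + 1) j) = X.south i j := fun j hj h => by
    rw [south_eq_north hj] at h ⊢
    have := hX.packCol_add_lt hk (i := i + 1) (j := j) (by omega) h
    rw [south_eq_north (by rw [hPack_n]; omega), hn j (by omega) h]
  induction j with
  | zero =>
    refine ⟨fun _ => ?_, fun h => ?_, hs 0⟩
    · rw [packCol, Nat.count_zero, west_zero, west_zero]
    · rw [west_zero] at h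
      omega
  | succ j ih =>
    obtain ⟨ih1, ih2, -⟩ := ih (by omega)
    have hp := X.packCol_add (k := k) hik (j := j) (by omega)
    have hsj := hs j (by omega)
    refine ⟨fun h => ?_, fun h => ?_, hs _⟩
    · by_cases hc : (i, j) ∈ X.crosses
      · rw [west_succ_of_mem hc] at h ⊢
        rw [packCol_succ, north_of_mem hc]
        split_ifs with hb
        · rw [west_succ_of_mem ((mem_hPack_packCol (by rwa [north_of_mem hc])).2 ⟨hc, h, hb⟩),
            ih1 h]
        · exact ih1 h
      · rw [west_succ_of_notMem hc] at h ⊢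
        rw [packCol_succ, north_of_notMem hc]
        split_ifs with ha
        · rw [west_succ_of_notMem fun h' =>
            hc ((mem_hPack_packCol (by rwa [north_of_notMem hc])).1 h').1, ← hsj h]
          rw [if_pos ha] at hp
          congr 1
          omega
        · obtain ⟨c, h1, h2⟩ := ih2 (by omega)
          rw [if_neg ha] at hp
          rw [add_zero, h1, west_succ_of_notMem h2, ← hsj h]
          congr 1
          omega
    · by_cases hc : (i, j) ∈ X.crosses
      · rw [west_succ_of_mem hc] at h
        obtain ⟨c, h1, h2⟩ := ih2 h
        rw [packCol_succ, north_of_mem hc]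
        split_ifs with hb
        · refine ⟨_, rfl, fun h' => ?_⟩
          have := (mem_hPack_packCol (by rwa [north_of_mem hc])).1 h'
          omega
        · exact ⟨c, h1, h2⟩
      · rw [west_succ_of_notMem hc] at h
        rw [packCol_succ, north_of_notMem hc]
        split_ifs with ha
        · exact ⟨_, rfl, fun h' =>
            hc ((mem_hPack_packCol (by rwa [north_of_notMem hc])).1 h').1⟩
        · exact ih2 (by omega)

/-- Horizontal packing keeps the labels of the pipes with label at most `k`. -/
theorem InTriangle.north_hPack {X : Filling} (hX : X.InTriangle) {k i j : ℕ} (hk : k ≤ X.n)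
    (hj : i + j ≤ X.n) (h : X.north i j ≤ k) :
    (hPack k X).north i (X.packCol k i j) = X.north i j := by
  obtain ⟨d, hd⟩ : ∃ d, i + d = k + 1 := ⟨k + 1 - i, by have := hX.north_le hj; omega⟩
  induction d generalizing i j with
  | zero =>
    have := (hX.north_le hj).1
    omega
  | succ d ih =>
    obtain ⟨h1, h2, h3⟩ := hX.hPack_row hk (by omega : i ≤ k)
      (fun j hj h => ih hj h (by omega)) j hj
    have hp := X.packCol_add (k := k) (i := i) (by omega) hj
    by_cases hc : (i, j) ∈ X.crosses
    · have hlt := hX _ hc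
      have h3' := h3 hlt
      rw [north_of_mem hc] at h ⊢
      by_cases ha : X.west i j ≤ k
      · rw [north_of_mem ((mem_hPack_packCol (by rwa [north_of_mem hc])).2 ⟨hc, ha, h⟩), ← h3' h]
        rw [if_pos ha] at hp
        congr 1
        omega
      · rw [north_of_notMem fun h' => ha ((mem_hPack_packCol (by rwa [north_of_mem hc])).1 h').2.1]
        obtain ⟨c, h1, h2⟩ := h2 (by omega)
        rw [if_neg ha] at hp
        rw [h1, west_succ_of_notMem h2, ← h3' h]
        congr 1
        omega
    · rw [north_of_notMem hc] at h ⊢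
      rw [north_of_notMem fun h' => hc ((mem_hPack_packCol (by rwa [north_of_notMem hc])).1 h').1,
        h1 h]

theorem InTriangle.west_hPack {X : Filling} (hX : X.InTriangle) {k i j : ℕ} (hk : k ≤ X.n)
    (hj : i + j ≤ X.n) (h : X.west i j ≤ k) :
    (hPack k X).west i (X.packCol k i j) = X.west i j :=
  (hX.hPack_row hk (by have := hX.west_le hj; omega)
    (fun _ hj h => hX.north_hPack hk hj h) j hj).1 h

theorem InTriangle.south_hPack {X : Filling} (hX : X.InTriangle) {k i j : ℕ} (hk : k ≤ X.n)
    (hj : i + j < X.n) (ha : X.west i j ≤ k) (h : X.south i j ≤ k) :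
    (hPack k X).south i (X.packCol k i j) = X.south i j := by
  have hik : i ≤ k := by
    have := hX.west_le (le_of_lt hj)
    omega
  have hp := X.packCol_add hik (j := j) (by omega)
  rw [if_pos ha] at hp
  rw [show X.packCol k i j = X.packCol k (i + 1) j by omega]
  exact (hX.hPack_row hk hik (fun _ hj h => hX.north_hPack hk hj h) j (by omega)).2.2 hj h

theorem IsPipeDream.hPack {X : Filling} (hX : X.IsPipeDream) {k : ℕ} (hk : k ≤ X.n) :
    (hPack k X).IsPipeDream := by
  have hT := hX.inTriangle
  refine isPipeDream_iff.2 ⟨?_, ?_, ?_⟩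
  · rintro ⟨i, c⟩ hc
    obtain ⟨j, h1, ⟨h2, h3⟩, rfl⟩ := mem_hPack.1 hc
    have hlt : i + j < X.n := hT _ h1
    have hik : i + 1 ≤ k := by have := (hT.south_le hlt).1; omega
    have hw := hT.west_le (i := i) (j := j + 1) (by omega)
    have hp := X.packCol_add (k := k) (i := i) (by omega) (j := j + 1) (by omega)
    rw [west_succ_of_mem h1, if_pos h2, packCol_succ, if_pos (by rwa [north_of_mem h1])] at hp
    have h4 := hT.count_north (· ≤ k) (i := i + 1) (d := X.n - i) (by omega)
    rw [count_le_eq, count_le_eq] at h4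
    have h5 : X.packCol k (i + 1) (j + 1) ≤ X.packCol k (i + 1) (X.n - i) :=
      Nat.count_monotone _ (by omega)
    have h6 : X.packCol k (i + 1) (X.n - i) + min (i + 1) (k + 1) = min (X.n + 1) (k + 1) := h4
    change i + X.packCol k i j < k
    omega
  · intro hc
    obtain ⟨j, h1, ⟨h2, h3⟩, h4⟩ := mem_hPack.1 hc
    have h0 : X.north 0 0 = 0 := by rw [north_of_notMem hX.2.1, west_zero]
    have hj : j ≠ 0 := by rintro rfl; exact hX.2.1 h1
    have h5 : X.packCol k 0 1 ≤ X.packCol k 0 j := Nat.count_monotone _ (by omega)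
    rw [packCol_succ, h0, if_pos (Nat.zero_le k)] at h5
    omega
  · rintro ⟨i, c⟩ hc
    obtain ⟨j, h1, ⟨h2, h3⟩, rfl⟩ := mem_hPack.1 hc
    have hlt : i + j < X.n := hT _ h1
    have := hX.isReduced _ h1
    simp only
    rw [hT.west_hPack hk (by omega) h2, hT.south_hPack hk hlt h2 h3]
    exact this

@[simp] theorem vPack_n (k : ℕ) (X : Filling) : (vPack k X).n = k := rfl

theorem IsPipeDream.vPack {X : Filling} (hX : X.IsPipeDream) {k : ℕ} (hk : k ≤ X.n) :
    (vPack k X).IsPipeDream := (hX.transpose.hPack hk).transpose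

/-! ### Crossing pairs -/

/-- The pipes with labels `a` and `b` cross in row `i`, where `a` comes from the left. -/
def Crosses (X : Filling) (a b i : ℕ) : Prop :=
  ∃ j, (i, j) ∈ X.crosses ∧ X.west i j = a ∧ X.south i j = b

theorem InTriangle.south_inj {X : Filling} (hX : X.InTriangle) {i j j' : ℕ} (h : i + j < X.n)
    (h' : i + j' < X.n) (e : X.south i j = X.south i j') : j = j' := by
  rw [south_eq_north h, south_eq_north h'] at e
  exact hX.north_inj (by omega) (by omega) e

/-- A pipe dream is determined by the rows in which its pipes cross: the labels entering a row from
below tell in which box a given pipe is crossed. -/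
theorem eq_of_crosses_iff {X Y : Filling} (hX : X.InTriangle) (hY : Y.InTriangle)
    (hn : X.n = Y.n) (h : ∀ a b i, X.Crosses a b i ↔ Y.Crosses a b i) : X = Y := by
  have row : ∀ i, (∀ j, i + j < X.n → X.south i j = Y.south i j) →
      ∀ j, i + j ≤ X.n → X.west i j = Y.west i j ∧
        (i + j < X.n → ((i, j) ∈ X.crosses ↔ (i, j) ∈ Y.crosses)) := by
    intro i hs
    have hcr : ∀ j, X.west i j = Y.west i j → i + j < X.n →
        ((i, j) ∈ X.crosses ↔ (i, j) ∈ Y.crosses) := by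
      intro j hw hlt
      constructor
      · intro hc
        obtain ⟨j', h1, h2, h3⟩ := (h _ _ _).1 ⟨j, hc, rfl, rfl⟩
        have hlt' : i + j' < Y.n := hY _ h1
        rw [hs j hlt] at h3
        rwa [hY.south_inj hlt' (by omega) h3] at h1
      · intro hc
        obtain ⟨j', h1, h2, h3⟩ := (h _ _ _).2 ⟨j, hc, rfl, rfl⟩
        have hlt' : i + j' < X.n := hX _ h1
        rw [← hs j hlt] at h3
        rwa [hX.south_inj hlt' hlt h3] at h1
    intro j hj
    induction j with
    | zero => exact ⟨by rw [west_zero, west_zero], hcr 0 (by rw [west_zero, west_zero])⟩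
    | succ j ih =>
      obtain ⟨h1, h2⟩ := ih (by omega)
      have hw : X.west i (j + 1) = Y.west i (j + 1) := by
        by_cases hc : (i, j) ∈ X.crosses
        · rw [west_succ_of_mem hc, west_succ_of_mem ((h2 (by omega)).1 hc), h1]
        · rw [west_succ_of_notMem hc,
            west_succ_of_notMem fun h' => hc ((h2 (by omega)).2 h'), hs j (by omega)]
      exact ⟨hw, hcr _ hw⟩
  have south : ∀ d i, i + d = X.n → ∀ j, i + j < X.n → X.south i j = Y.south i j := by
    intro d
    induction d with
    | zero => intro i hi j hj; omega
    | succ d ih =>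
      intro i hi j hj
      obtain ⟨h1, h2⟩ := row (i + 1) (ih (i + 1) (by omega)) j (by omega)
      rw [south_eq_north hj, south_eq_north (by omega)]
      by_cases hc : (i + 1, j) ∈ X.crosses
      · have hlt : i + 1 + j < X.n := hX _ hc
        rw [north_of_mem hc, north_of_mem ((h2 hlt).1 hc), ih (i + 1) (by omega) j hlt]
      · have hc' : (i + 1, j) ∉ Y.crosses := fun h' => by
          have hlt : i + 1 + j < Y.n := hY _ h'
          exact hc ((h2 (by omega)).2 h')
        rw [north_of_notMem hc, north_of_notMem hc', h1]
  refine Filling.ext hn (Finset.ext fun ⟨i, j⟩ => ?_)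
  rcases Nat.lt_or_ge (i + j) X.n with hlt | hge
  · exact (row i (south (X.n - i) i (by omega)) j (by omega)).2 hlt
  · exact iff_of_false (hX.notMem hge) (hY.notMem (by omega))

/-- Horizontal packing keeps the crosses between the pipes with label at most `k`, in their
rows. -/
theorem InTriangle.crosses_hPack {X : Filling} (hX : X.InTriangle) {k : ℕ} (hk : k ≤ X.n)
    {a b i : ℕ} : (Filling.hPack k X).Crosses a b i ↔ X.Crosses a b i ∧ a ≤ k ∧ b ≤ k := by
  constructor
  · rintro ⟨c, hc, rfl, rfl⟩
    obtain ⟨j, h1, ⟨h2, h3⟩, rfl⟩ := mem_hPack.1 hc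
    have hlt : i + j < X.n := hX _ h1
    rw [hX.west_hPack hk (by omega) h2, hX.south_hPack hk hlt h2 h3]
    exact ⟨⟨j, h1, rfl, rfl⟩, h2, h3⟩
  · rintro ⟨⟨j, hc, rfl, rfl⟩, h2, h3⟩
    have hlt : i + j < X.n := hX _ hc
    exact ⟨_, mem_hPack.2 ⟨j, hc, ⟨h2, h3⟩, rfl⟩, hX.west_hPack hk (by omega) h2,
      hX.south_hPack hk hlt h2 h3⟩

theorem InTriangle.crosses_le {X : Filling} (hX : X.InTriangle) {a b i : ℕ}
    (h : X.Crosses a b i) : a ≤ X.n ∧ b ≤ X.n := by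
  obtain ⟨j, hc, rfl, rfl⟩ := h
  have hlt : i + j < X.n := hX _ hc
  exact ⟨(hX.west_le (le_of_lt hlt)).2, (hX.south_le hlt).2⟩

theorem IsPipeDream.hPack_hPack {X : Filling} (hX : X.IsPipeDream) {k l : ℕ} (hkl : k ≤ l)
    (hl : l ≤ X.n) : Filling.hPack k (Filling.hPack l X) = Filling.hPack k X := by
  have h1 := (hX.hPack hl).inTriangle
  refine eq_of_crosses_iff ((hX.hPack hl).hPack hkl).inTriangle
    (hX.hPack (hkl.trans hl)).inTriangle rfl fun a b i => ?_
  rw [h1.crosses_hPack hkl, hX.inTriangle.crosses_hPack hl,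
    hX.inTriangle.crosses_hPack (hkl.trans hl)]
  constructor
  · tauto
  · rintro ⟨h, ha, hb⟩
    exact ⟨⟨h, by omega, by omega⟩, ha, hb⟩

theorem IsPipeDream.hPack_self {X : Filling} (hX : X.IsPipeDream) :
    Filling.hPack X.n X = X := by
  refine eq_of_crosses_iff (hX.hPack le_rfl).inTriangle hX.inTriangle rfl fun a b i => ?_
  rw [hX.inTriangle.crosses_hPack le_rfl]
  exact ⟨fun h => h.1, fun h => ⟨h, hX.inTriangle.crosses_le h⟩⟩

theorem IsPipeDream.vPack_vPack {X : Filling} (hX : X.IsPipeDream) {k l : ℕ} (hkl : k ≤ l)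
    (hl : l ≤ X.n) : Filling.vPack k (Filling.vPack l X) = Filling.vPack k X := by
  rw [Filling.vPack, Filling.vPack, Filling.vPack, transpose_transpose,
    hX.transpose.hPack_hPack hkl hl]

theorem IsPipeDream.vPack_self {X : Filling} (hX : X.IsPipeDream) :
    Filling.vPack X.n X = X := by
  have := hX.transpose.hPack_self
  rw [transpose_n] at this
  rw [Filling.vPack, this, transpose_transpose]

/-! ### Global descents -/

/-- The gap `γ` is a global descent of the exiting permutation: the nonzero pipes leaving through
the columns `1, …, γ` are those with the `γ` largest labels. -/
def IsCut (X : Filling) (γ : ℕ) : Prop :=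
  γ ≤ X.n ∧ ∀ j, 1 ≤ j → j ≤ X.n → (j ≤ γ ↔ X.n - γ < X.north 0 j)

theorem IsPipeDream.north_zero {X : Filling} (hX : X.IsPipeDream) : X.north 0 0 = 0 := by
  rw [north_of_notMem hX.2.1, west_zero]

theorem IsPipeDream.north_pos {X : Filling} (hX : X.IsPipeDream) {j : ℕ} (h : 1 ≤ j)
    (hj : j ≤ X.n) : 1 ≤ X.north 0 j := by
  rw [Nat.one_le_iff_ne_zero]
  intro h'
  have := hX.inTriangle.north_inj (i := 0) (j := j) (j' := 0) (by omega) (by omega)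
    (by rw [h', hX.north_zero])
  omega

/-- Reflection reverses the roles of labels and exits, and maps the gap `γ` to `X.n - γ`. -/
theorem IsPipeDream.isCut_transpose {X : Filling} (hX : X.IsPipeDream) {γ : ℕ}
    (h : X.IsCut γ) : X.transpose.IsCut (X.n - γ) := by
  have hT := hX.inTriangle
  obtain ⟨h1, h2⟩ := h
  refine ⟨Nat.sub_le _ _, fun l hl1 hl2 => ?_⟩
  rw [transpose_n] at hl2 ⊢
  have h3 := hT.north_north (i := l) (j := 0) (by omega)
  have h4 := (hT.transpose.north_le (i := 0) (j := l) (by rw [transpose_n]; omega)).2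
  rw [west_zero] at h3
  rw [transpose_n] at h4
  rcases Nat.eq_zero_or_pos (X.transpose.north 0 l) with h0 | h0
  · rw [h0, hX.north_zero] at h3
    omega
  · have := h2 _ h0 h4
    rw [h3] at this
    omega

/-- At a global descent, the pipes kept by horizontal packing are the pipe `0` and those leaving
after the column `γ`. -/
theorem IsPipeDream.packCol_cut {X : Filling} (hX : X.IsPipeDream) {γ : ℕ} (h : X.IsCut γ)
    {j : ℕ} (hj1 : 1 ≤ j) (hj : j ≤ X.n - γ) : X.packCol (X.n - γ) 0 (j + γ) = j := by
  obtain ⟨h1, h2⟩ := h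
  have h3 : ∀ m, m ≤ γ → X.packCol (X.n - γ) 0 (m + 1) = 1 := by
    intro m hm
    induction m with
    | zero => rw [packCol_succ, hX.north_zero]; simp [packCol]
    | succ m ih =>
      rw [packCol_succ, ih (by omega), if_neg]
      have := h2 (m + 1) (by omega) (by omega)
      omega
  induction j with
  | zero => omega
  | succ j ih =>
    rcases Nat.eq_zero_or_pos j with rfl | hj0
    · rw [zero_add, add_comm, h3 γ le_rfl]
    · rw [show j + 1 + γ = j + γ + 1 by omega, packCol_succ, ih hj0 (by omega), if_pos]
      have := h2 (j + γ) (by omega) (by omega)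
      omega

/-- The second factor of the exiting permutation at a global descent. -/
theorem IsPipeDream.north_hPack_cut {X : Filling} (hX : X.IsPipeDream) {γ : ℕ} (h : X.IsCut γ)
    {j : ℕ} (hj1 : 1 ≤ j) (hj : j ≤ X.n - γ) :
    (Filling.hPack (X.n - γ) X).north 0 j = X.north 0 (j + γ) := by
  have h1 := hX.inTriangle.north_hPack (i := 0) (j := j + γ) (Nat.sub_le X.n γ) (by omega) (by
    have := h.2 (j + γ) (by omega) (by omega)
    omega)
  rwa [hX.packCol_cut h hj1 hj] at h1

/-- The first factor of the exiting permutation at a global descent. -/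
theorem IsPipeDream.north_vPack_cut {X : Filling} (hX : X.IsPipeDream) {γ : ℕ} (h : X.IsCut γ)
    {j : ℕ} (hj1 : 1 ≤ j) (hj : j ≤ γ) :
    (Filling.vPack γ X).north 0 j + (X.n - γ) = X.north 0 j := by
  have hT := hX.inTriangle
  have hγ := h.1
  have h2 := hX.isCut_transpose h
  have h3 := (hT.north_le (i := 0) (j := j) (by omega)).2
  have h4 := (h.2 j hj1 (by omega)).1 hj
  have h5 := hX.transpose.north_hPack_cut h2 (j := X.north 0 j - (X.n - γ)) (by omega)
    (by rw [transpose_n]; omega)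
  rw [transpose_n, Nat.sub_sub_self hγ, Nat.sub_add_cancel (le_of_lt h4)] at h5
  have h6 := hT.transpose.north_north (i := j) (j := 0) (by rw [transpose_n]; omega)
  rw [transpose_transpose, west_zero] at h6
  have h7 := (hX.vPack hγ).inTriangle.north_north (i := X.north 0 j - (X.n - γ)) (j := 0)
    (by rw [vPack_n]; omega)
  rw [west_zero, Filling.vPack, transpose_transpose, h5, h6] at h7
  rw [Filling.vPack, h7]
  omega

/-- Counting kept pipes in a row of the packed filling. -/
theorem InTriangle.count_hPack {X : Filling} (hX : X.InTriangle) {k : ℕ} (hk : k ≤ X.n)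
    {q : ℕ → Prop} [DecidablePred q] (hq : ∀ l, q l → l ≤ k) {i j : ℕ} (h : i + j ≤ X.n) :
    Nat.count (fun c => q ((Filling.hPack k X).north i c)) (X.packCol k i j) =
      Nat.count (fun c => q (X.north i c)) j := by
  induction j with
  | zero => simp [packCol]
  | succ j ih =>
    rw [Nat.count_succ, packCol_succ]
    split_ifs with h1 h2 h2
    · rw [Nat.count_succ, ih (by omega), hX.north_hPack hk (by omega) h1, if_pos h2]
    · rw [Nat.count_succ, ih (by omega), hX.north_hPack hk (by omega) h1, if_neg h2]
    · exact absurd (hq _ h2) h1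
    · exact ih (by omega)

/-- The number of pipes with label in `1, …, X.n - γ` that pass above and to the left of the box
`(i, j)`, counted along the column or along the row of this box. -/
theorem IsPipeDream.packCol_transpose {X : Filling} (hX : X.IsPipeDream) {γ : ℕ}
    (h : X.IsCut γ) {i j : ℕ} (hij : i + j ≤ X.n) (hj : j ≤ γ) :
    X.transpose.packCol γ j i +
      (Nat.count (fun c => 1 ≤ X.north i c ∧ X.north i c ≤ X.n - γ) j +
        Nat.count (fun l => 1 ≤ l ∧ l ≤ X.n - γ) i) = i := by
  have hT := hX.inTriangle
  have h1 := count_rectangle (X := X) (fun l => 1 ≤ l ∧ l ≤ X.n - γ) (r := i) (c := j) (by omega)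
  have h2 : Nat.count (fun c => 1 ≤ X.north 0 c ∧ X.north 0 c ≤ X.n - γ) j = 0 := by
    rw [Nat.count_eq_card_filter_range, Finset.card_eq_zero, Finset.filter_eq_empty_iff]
    intro c hc
    rw [Finset.mem_range] at hc
    rcases Nat.eq_zero_or_pos c with rfl | h0
    · rw [hX.north_zero]; omega
    · have := h.2 c h0 (by omega)
      omega
  -- the pipes crossing the left side of column `j` leave either before or after the gap `γ`
  have h3 : ∀ m, m ≤ i → X.transpose.packCol γ j m +
      Nat.count (fun r => 1 ≤ X.west r j ∧ X.west r j ≤ X.n - γ) m = m := by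
    intro m hm
    induction m with
    | zero => simp [packCol]
    | succ m ih =>
      have h4 := ih (by omega)
      have h5 := hT.north_north (i := m) (j := j) (by omega)
      have h6 := (hT.transpose.north_le (i := j) (j := m) (by rw [transpose_n]; omega)).2
      have h7 : X.transpose.north j m ≤ γ ↔ ¬ (1 ≤ X.west m j ∧ X.west m j ≤ X.n - γ) := by
        rw [← h5]
        rcases Nat.eq_zero_or_pos (X.transpose.north j m) with h0 | h0
        · rw [h0, hX.north_zero]; omega
        · have h8 := h.2 _ h0 h6
          have h9 := hX.north_pos h0 h6
          omega
      rw [packCol_succ, Nat.count_succ]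
      split_ifs <;> omega
  rw [h2] at h1
  have := h3 i le_rfl
  omega

/-- A kept pipe leaves `X` before the gap `γ` if and only if it leaves the packed filling before
the gap `γ - δ`. -/
theorem IsPipeDream.north_eq_iff_cut {X : Filling} (hX : X.IsPipeDream) {δ : ℕ}
    (hδ : X.IsCut δ) {γ : ℕ} (hδγ : δ ≤ γ) {e e' : ℕ} (he : e ≤ X.n)
    (he' : e' ≤ X.n - δ) (h : (Filling.hPack (X.n - δ) X).north 0 e' = X.north 0 e) :
    e' ≤ γ - δ ↔ e ≤ γ := by
  have hT := hX.inTriangle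
  rcases Nat.eq_zero_or_pos e' with rfl | h0
  · rw [(hX.hPack (Nat.sub_le _ _)).north_zero] at h
    have h1 : ¬ 1 ≤ e := fun h1 => by have := hX.north_pos h1 he; omega
    omega
  · rw [hX.north_hPack_cut hδ h0 he'] at h
    have := hT.north_inj (i := 0) (by omega) (by omega) h
    omega

theorem IsPipeDream.isCut_hPack {X : Filling} (hX : X.IsPipeDream) {δ γ : ℕ}
    (hδ : X.IsCut δ) (hγ : X.IsCut γ) (hδγ : δ ≤ γ) :
    (Filling.hPack (X.n - δ) X).IsCut (γ - δ) := by
  have h1 := hγ.1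
  refine ⟨by rw [hPack_n]; omega, fun j hj1 hj => ?_⟩
  rw [hPack_n] at hj ⊢
  rw [hX.north_hPack_cut hδ hj1 hj]
  have := hγ.2 (j + δ) (by omega) (by omega)
  omega

/-- Horizontal packing does not change the row to which vertical packing moves a cross, because
both numbers count the pipes with labels in `1, …, X.n - γ`, and those are kept. -/
theorem IsPipeDream.packCol_transpose_hPack {X : Filling} (hX : X.IsPipeDream) {δ γ : ℕ}
    (hδ : X.IsCut δ) (hγ : X.IsCut γ) (hδγ : δ ≤ γ) {i j : ℕ} (hij : i + j < X.n)
    (hw : X.west i j ≤ X.n - δ) (he : X.transpose.north j i ≤ γ) (hn : X.north i j ≤ X.n - δ) :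
    (Filling.hPack (X.n - δ) X).transpose.packCol (γ - δ) (X.packCol (X.n - δ) i j) i =
      X.transpose.packCol γ j i := by
  have hT := hX.inTriangle
  have hk := Nat.sub_le X.n δ
  have hH := hX.hPack hk
  have hHT := hH.inTriangle
  have hγn := hγ.1
  have hj : j ≤ γ :=
    (hT.transpose.north_le (i := j) (j := i) (by rw [transpose_n]; omega)).1.trans he
  have hij' := hT.packCol_add_lt hk (le_of_lt hij) hn
  have hj' : X.packCol (X.n - δ) i j ≤ γ - δ := by
    have h1 := hHT.transpose.north_le (i := X.packCol (X.n - δ) i j) (j := i)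
      (by rw [transpose_n, hPack_n]; omega)
    have h2 := hHT.north_north (i := i) (j := X.packCol (X.n - δ) i j) (by rw [hPack_n]; omega)
    rw [hT.west_hPack hk (le_of_lt hij) hw, ← hT.north_north (le_of_lt hij)] at h2
    have h3 := (hT.transpose.north_le (i := j) (j := i) (by rw [transpose_n]; omega)).2
    rw [transpose_n] at h1 h3
    have := (hX.north_eq_iff_cut hδ hδγ h3 h1.2 h2).2 he
    omega
  have h1 := hX.packCol_transpose hγ (le_of_lt hij) hj
  have h2 := hH.packCol_transpose (hX.isCut_hPack hδ hγ hδγ) (i := i)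
    (j := X.packCol (X.n - δ) i j) (by rw [hPack_n]; omega) hj'
  rw [hPack_n, show X.n - δ - (γ - δ) = X.n - γ by omega,
    hT.count_hPack hk (q := fun l => 1 ≤ l ∧ l ≤ X.n - γ) (fun l hl => by omega)
      (le_of_lt hij)] at h2
  omega

/-- Horizontal and vertical packings at global descents commute. -/
theorem IsPipeDream.hPack_vPack {X : Filling} (hX : X.IsPipeDream) {δ γ : ℕ}
    (hδ : X.IsCut δ) (hγ : X.IsCut γ) (hδγ : δ ≤ γ) :
    Filling.hPack (γ - δ) (Filling.vPack γ X) =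
      Filling.vPack (γ - δ) (Filling.hPack (X.n - δ) X) := by
  have hT := hX.inTriangle
  have hk := Nat.sub_le X.n δ
  have hH := hX.hPack hk
  have hV := hX.vPack hγ.1
  have hγn := hγ.1
  have hcV : ∀ e, e ≤ γ → ((Filling.vPack γ X).north 0 e ≤ γ - δ ↔ X.north 0 e ≤ X.n - δ) := by
    intro e he
    rcases Nat.eq_zero_or_pos e with rfl | h0
    · rw [hV.north_zero, hX.north_zero]; omega
    · have := hX.north_vPack_cut hγ h0 he
      omega
  have hVt : (Filling.vPack γ X).transpose = Filling.hPack γ X.transpose := by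
    rw [Filling.vPack, transpose_transpose]
  -- the crosses of both sides come from the same crosses of `X`, which move to the same boxes
  have hbox : ∀ i j, (i, j) ∈ X.crosses → X.west i j ≤ X.n - δ → X.south i j ≤ X.n - δ →
      X.transpose.west j i ≤ γ → X.transpose.south j i ≤ γ →
      (Filling.hPack (X.n - δ) X).transpose.packCol (γ - δ) (X.packCol (X.n - δ) i j) i =
        X.transpose.packCol γ j i ∧
      (Filling.vPack γ X).packCol (γ - δ) (X.transpose.packCol γ j i) j =
        X.packCol (X.n - δ) i j := by
    intro i j hc h1 h2 h3 h4
    have hlt : i + j < X.n := hT _ hc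
    have h5 : X.transpose.north j i ≤ γ := by rwa [north_of_mem (mem_transpose.2 hc)]
    have h6 : X.north i j ≤ X.n - δ := by rwa [north_of_mem hc]
    refine ⟨hX.packCol_transpose_hPack hδ hγ hδγ hlt h1 h5 h6, ?_⟩
    have h7 := hX.transpose.packCol_transpose_hPack (δ := X.n - γ) (γ := X.n - δ)
      (hX.isCut_transpose hγ) (hX.isCut_transpose hδ) (by omega) (i := j) (j := i)
      (by rw [transpose_n]; omega)
    rw [transpose_n, transpose_transpose, Nat.sub_sub_self hγn,
      show X.n - δ - (X.n - γ) = γ - δ by omega] at h7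
    exact h7 h3 h6 h5
  -- a pipe of the vertical packing is kept afterwards if and only if its label is small in `X`
  have hleft : ∀ r c, (r, c) ∈ (Filling.hPack (γ - δ) (Filling.vPack γ X)).crosses ↔
      ∃ i j, (i, j) ∈ X.crosses ∧ (X.west i j ≤ X.n - δ ∧ X.south i j ≤ X.n - δ) ∧
        (X.transpose.west j i ≤ γ ∧ X.transpose.south j i ≤ γ) ∧
        X.transpose.packCol γ j i = r ∧
        (Filling.vPack γ X).packCol (γ - δ) (X.transpose.packCol γ j i) j = c := by
    intro r c
    have hlab : ∀ i j, (i, j) ∈ X.crosses → X.transpose.west j i ≤ γ →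
        X.transpose.south j i ≤ γ → (X.transpose.packCol γ j i, j) ∈ (Filling.vPack γ X).crosses →
        ((Filling.vPack γ X).west (X.transpose.packCol γ j i) j ≤ γ - δ ↔
            X.west i j ≤ X.n - δ) ∧
          ((Filling.vPack γ X).south (X.transpose.packCol γ j i) j ≤ γ - δ ↔
            X.south i j ≤ X.n - δ) := by
      intro i j hc h4 h5 hcV'
      have hlt : X.transpose.packCol γ j i + j < γ := hV.inTriangle _ hcV'
      have hlt' : i + j < X.n := hT _ hc
      have hw := hV.inTriangle.north_north (i := X.transpose.packCol γ j i) (j := j)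
        (by rw [vPack_n]; omega)
      have hn := hV.inTriangle.north_west (i := X.transpose.packCol γ j i) (j := j)
        (by rw [vPack_n]; omega)
      have h6 : X.transpose.north j i ≤ γ := by rwa [north_of_mem (mem_transpose.2 hc)]
      rw [hVt, hT.transpose.north_hPack hγn (by rw [transpose_n]; omega) h6] at hw
      rw [north_of_mem hcV', hVt, hT.transpose.west_hPack hγn (by rw [transpose_n]; omega) h4]
        at hn
      rw [← hw, ← hn, hcV _ h6, hcV _ h4, hT.north_north (le_of_lt hlt'),
        hT.north_west (le_of_lt hlt'), north_of_mem hc]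
      exact ⟨Iff.rfl, Iff.rfl⟩
    rw [mem_hPack]
    constructor
    · rintro ⟨j, hc, h1, h3⟩
      have hc0 := hc
      rw [Filling.vPack, mem_transpose, mem_hPack] at hc
      obtain ⟨i, hc, ⟨h4, h5⟩, rfl⟩ := hc
      have hl := hlab i j (mem_transpose.1 hc) h4 h5 hc0
      exact ⟨i, j, mem_transpose.1 hc, ⟨hl.1.1 h1.1, hl.2.1 h1.2⟩, ⟨h4, h5⟩, rfl, h3⟩
    · rintro ⟨i, j, hc, h1, ⟨h4, h5⟩, rfl, h3⟩
      have hc0 : (X.transpose.packCol γ j i, j) ∈ (Filling.vPack γ X).crosses := by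
        rw [Filling.vPack, mem_transpose, mem_hPack]
        exact ⟨i, mem_transpose.2 hc, ⟨h4, h5⟩, rfl⟩
      have hl := hlab i j hc h4 h5 hc0
      exact ⟨j, hc0, ⟨hl.1.2 h1.1, hl.2.2 h1.2⟩, h3⟩
  -- likewise for the horizontal packing and the exits
  have hright : ∀ r c, (r, c) ∈ (Filling.vPack (γ - δ) (Filling.hPack (X.n - δ) X)).crosses ↔
      ∃ i j, (i, j) ∈ X.crosses ∧ (X.west i j ≤ X.n - δ ∧ X.south i j ≤ X.n - δ) ∧
        (X.transpose.west j i ≤ γ ∧ X.transpose.south j i ≤ γ) ∧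
        (Filling.hPack (X.n - δ) X).transpose.packCol (γ - δ) (X.packCol (X.n - δ) i j) i = r ∧
        X.packCol (X.n - δ) i j = c := by
    intro r c
    have hlab : ∀ i j, (i, j) ∈ X.crosses → X.west i j ≤ X.n - δ →
        X.south i j ≤ X.n - δ →
        (i, X.packCol (X.n - δ) i j) ∈ (Filling.hPack (X.n - δ) X).crosses →
        ((Filling.hPack (X.n - δ) X).transpose.west (X.packCol (X.n - δ) i j) i ≤ γ - δ ↔
            X.transpose.west j i ≤ γ) ∧
          ((Filling.hPack (X.n - δ) X).transpose.south (X.packCol (X.n - δ) i j) i ≤ γ - δ ↔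
            X.transpose.south j i ≤ γ) := by
      intro i j hc h1 h2 hcH
      have hlt : i + X.packCol (X.n - δ) i j < X.n - δ := hH.inTriangle _ hcH
      have hlt' : i + j < X.n := hT _ hc
      have hw := hH.inTriangle.north_north (i := i) (j := X.packCol (X.n - δ) i j)
        (by rw [hPack_n]; omega)
      have hn := hH.inTriangle.north_west (i := i) (j := X.packCol (X.n - δ) i j)
        (by rw [hPack_n]; omega)
      have h6 : X.north i j ≤ X.n - δ := by rwa [north_of_mem hc]
      rw [hT.west_hPack hk (le_of_lt hlt') h1, ← hT.north_north (le_of_lt hlt')] at hw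
      rw [hT.north_hPack hk (le_of_lt hlt') h6, ← hT.north_west (le_of_lt hlt')] at hn
      have hb := hH.inTriangle.transpose
      have hd := hT.transpose
      have e1 := (hb.north_le (i := X.packCol (X.n - δ) i j) (j := i)
        (by rw [transpose_n, hPack_n]; omega)).2
      have e2 := (hb.west_le (i := X.packCol (X.n - δ) i j) (j := i)
        (by rw [transpose_n, hPack_n]; omega)).2
      have e3 := (hd.north_le (i := j) (j := i) (by rw [transpose_n]; omega)).2
      have e4 := (hd.west_le (i := j) (j := i) (by rw [transpose_n]; omega)).2
      have e5 := hX.north_eq_iff_cut hδ hδγ e3 e1 hw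
      rw [north_of_mem (mem_transpose.2 hc), north_of_mem (mem_transpose.2 hcH)] at e5
      exact ⟨hX.north_eq_iff_cut hδ hδγ e4 e2 hn, e5⟩
    rw [Filling.vPack, mem_transpose, mem_hPack]
    constructor
    · rintro ⟨i, hc, h1, h3⟩
      have hc0 := mem_transpose.1 hc
      obtain ⟨j, hc', ⟨h4, h5⟩, rfl⟩ := mem_hPack.1 hc0
      have hl := hlab i j hc' h4 h5 hc0
      exact ⟨i, j, hc', ⟨h4, h5⟩, ⟨hl.1.1 h1.1, hl.2.1 h1.2⟩, h3, rfl⟩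
    · rintro ⟨i, j, hc, ⟨h4, h5⟩, h1, h3, rfl⟩
      have hc0 : (i, X.packCol (X.n - δ) i j) ∈ (Filling.hPack (X.n - δ) X).crosses :=
        mem_hPack.2 ⟨j, hc, ⟨h4, h5⟩, rfl⟩
      have hl := hlab i j hc h4 h5 hc0
      exact ⟨i, mem_transpose.2 hc0, ⟨hl.1.2 h1.1, hl.2.2 h1.2⟩, h3⟩
  refine Filling.ext rfl (Finset.ext fun ⟨r, c⟩ => ?_)
  rw [hleft, hright]
  refine exists_congr fun i => exists_congr fun j => and_congr_right fun hc =>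
    and_congr_right fun h1 => and_congr_right fun h2 => ?_
  obtain ⟨h3, h4⟩ := hbox i j hc h1.1 h1.2 h2.1 h2.2
  rw [h3, h4]

end Filling

namespace Filling

/-! ### Insertion -/

@[simp] theorem insert_n (X : Filling) (γ : ℕ) (Y : Filling) :
    (X.insert γ Y).n = X.n + Y.n := rfl

/-- The map making room for `n` new values after the value `t`. -/
def shift (t n l : ℕ) : ℕ := if l ≤ t then l else l + n

theorem mem_insert {X Y : Filling} {γ r c : ℕ} : (r, c) ∈ (X.insert γ Y).crosses ↔
    (∃ i j, (i, j) ∈ X.crosses ∧ shift (X.n - γ) Y.n i = r ∧ shift γ Y.n j = c) ∨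
    (∃ i j, (i, j) ∈ Y.crosses ∧ X.n - γ + i = r ∧ γ + j = c) ∨
    (r < X.n - γ ∧ γ < c ∧ c ≤ γ + Y.n) ∨
    (X.n - γ < r ∧ r ≤ X.n - γ + Y.n ∧ c < γ) := by
  simp only [insert, Finset.mem_union, Finset.mem_image, Finset.mem_product, Finset.mem_range,
    Finset.mem_Ioc, Prod.exists, Prod.mk.injEq, or_assoc, shift, and_assoc]

/-- If a stretch of a row of `R` has the same crosses as a stretch of a row of `X`, and the pipes
entering it carry the labels of those of `X` renamed by `f`, then so do the pipes within it and
those leaving it. -/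
theorem row_transfer {X R : Filling} {i i' c c' L : ℕ} (f : ℕ → ℕ)
    (hw : R.west i' c' = f (X.west i c))
    (hs : ∀ t < L, R.south i' (c' + t) = f (X.south i (c + t)))
    (hc : ∀ t < L, (i', c' + t) ∈ R.crosses ↔ (i, c + t) ∈ X.crosses) :
    ∀ t ≤ L, R.west i' (c' + t) = f (X.west i (c + t)) ∧
      (t < L → R.north i' (c' + t) = f (X.north i (c + t))) := by
  have hn : ∀ t, R.west i' (c' + t) = f (X.west i (c + t)) → t < L →
      R.north i' (c' + t) = f (X.north i (c + t)) := by
    intro t h1 h2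
    by_cases h : (i, c + t) ∈ X.crosses
    · rw [north_of_mem h, north_of_mem ((hc t h2).2 h), hs t h2]
    · rw [north_of_notMem h, north_of_notMem fun h' => h ((hc t h2).1 h'), h1]
  intro t ht
  induction t with
  | zero => exact ⟨hw, hn 0 hw⟩
  | succ t ih =>
    have h1 : R.west i' (c' + t + 1) = f (X.west i (c + t + 1)) := by
      by_cases h : (i, c + t) ∈ X.crosses
      · rw [west_succ_of_mem h, west_succ_of_mem ((hc t ht).2 h), (ih (by omega)).1]
      · rw [west_succ_of_notMem h, west_succ_of_notMem fun h' => h ((hc t ht).1 h'), hs t ht]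
    exact ⟨h1, hn _ h1⟩

section insert

variable {X Y : Filling} {γ : ℕ} (hX : X.InTriangle) (hY : Y.IsPipeDream) (hγ : γ ≤ X.n)
include hX hY hγ

theorem insert_inTriangle : (X.insert γ Y).InTriangle := by
  rintro ⟨r, c⟩ h
  have hYT := hY.inTriangle
  change r + c < X.n + Y.n
  rcases mem_insert.1 h with ⟨i, j, h1, rfl, rfl⟩ | ⟨i, j, h1, rfl, rfl⟩ | h1 | h1
  · have : i + j < X.n := hX _ h1
    unfold shift
    split_ifs <;> omega
  · have : i + j < Y.n := hYT _ h1
    omega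
  · omega
  · omega

theorem mem_insert_lower_left {i j : ℕ} (hi : X.n - γ < i) :
    (i + Y.n, j) ∈ (X.insert γ Y).crosses ↔ (i, j) ∈ X.crosses := by
  rw [mem_insert]
  unfold shift
  constructor
  · rintro (⟨a, b, h, h1, h2⟩ | ⟨a, b, h, h1, h2⟩ | h | h)
    · have : a + b < X.n := hX _ h
      have e : a = i ∧ b = j := by split_ifs at h1 h2 <;> omega
      rwa [e.1, e.2] at h
    · have : a + b < Y.n := hY.inTriangle _ h
      omega
    · omega
    · omega
  · intro h
    have : i + j < X.n := hX _ h
    exact Or.inl ⟨i, j, h, by rw [if_neg (by omega)], by rw [if_pos (by omega)]⟩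

theorem mem_insert_upper_left {i j : ℕ} (hi : i ≤ X.n - γ) (hj : j ≤ γ) :
    (i, j) ∈ (X.insert γ Y).crosses ↔ (i, j) ∈ X.crosses := by
  rw [mem_insert]
  unfold shift
  constructor
  · rintro (⟨a, b, h, h1, h2⟩ | ⟨a, b, h, h1, h2⟩ | h | h)
    · have : a + b < X.n := hX _ h
      have e : a = i ∧ b = j := by split_ifs at h1 h2 <;> omega
      rwa [e.1, e.2] at h
    · have e : a = 0 ∧ b = 0 := by omega
      rw [e.1, e.2] at h
      exact absurd h hY.2.1
    · omega
    · omega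
  · intro h
    exact Or.inl ⟨i, j, h, by rw [if_pos (by omega)], by rw [if_pos (by omega)]⟩

theorem mem_insert_upper_right {i j : ℕ} (hi : i ≤ X.n - γ) (hj : γ < j) :
    (i, j + Y.n) ∈ (X.insert γ Y).crosses ↔ (i, j) ∈ X.crosses := by
  rw [mem_insert]
  unfold shift
  constructor
  · rintro (⟨a, b, h, h1, h2⟩ | ⟨a, b, h, h1, h2⟩ | h | h)
    · have : a + b < X.n := hX _ h
      have e : a = i ∧ b = j := by split_ifs at h1 h2 <;> omega
      rwa [e.1, e.2] at h
    · have : a + b < Y.n := hY.inTriangle _ h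
      omega
    · omega
    · omega
  · intro h
    exact Or.inl ⟨i, j, h, by rw [if_pos (by omega)], by rw [if_neg (by omega)]⟩

theorem mem_insert_center {i j : ℕ} (hij : i + j ≤ Y.n) :
    (X.n - γ + i, γ + j) ∈ (X.insert γ Y).crosses ↔ (i, j) ∈ Y.crosses := by
  rw [mem_insert]
  unfold shift
  constructor
  · rintro (⟨a, b, h, h1, h2⟩ | ⟨a, b, h, h1, h2⟩ | h | h)
    · have : a + b < X.n := hX _ h
      split_ifs at h1 h2 <;> omega
    · have e : a = i ∧ b = j := by omega
      rwa [e.1, e.2] at h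
    · omega
    · omega
  · intro h
    exact Or.inr (Or.inl ⟨i, j, h, rfl, rfl⟩)

/-- The rows of `X` below the inserted rows. -/
theorem insert_lower_left {i j : ℕ} (hi : X.n - γ < i) (hij : i + j ≤ X.n) :
    (X.insert γ Y).west (i + Y.n) j = shift (X.n - γ) Y.n (X.west i j) ∧
      (X.insert γ Y).north (i + Y.n) j = shift (X.n - γ) Y.n (X.north i j) := by
  obtain ⟨d, hd⟩ : ∃ d, i + d = X.n := ⟨X.n - i, by omega⟩
  induction d generalizing i j with
  | zero =>
    obtain rfl : j = 0 := by omega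
    rw [north_of_notMem (hX.notMem (by omega)),
      north_of_notMem ((insert_inTriangle hX hY hγ).notMem (by rw [insert_n]; omega))]
    simp only [west_zero]
    rw [shift, if_neg (by omega)]
    exact ⟨rfl, rfl⟩
  | succ d ih =>
    have h := row_transfer (X := X) (R := X.insert γ Y) (i := i) (i' := i + Y.n) (c := 0)
      (c' := 0) (L := d + 1) (shift (X.n - γ) Y.n)
      (by rw [west_zero, west_zero, shift, if_neg (by omega)])
      (fun t ht => by
        rw [zero_add, south_eq_north (by rw [insert_n]; omega), south_eq_north (by omega),
          add_right_comm, (ih (by omega) (by omega) (by omega)).2])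
      (fun t _ => by rw [zero_add, mem_insert_lower_left hX hY hγ hi])
    obtain ⟨h1, h2⟩ := h j (by omega)
    rw [zero_add] at h1 h2
    refine ⟨h1, ?_⟩
    rcases Nat.lt_or_ge j (d + 1) with hj | hj
    · exact h2 hj
    · rw [north_of_notMem (hX.notMem (by omega)), h1.symm,
        north_of_notMem ((insert_inTriangle hX hY hγ).notMem (by rw [insert_n]; omega))]

/-- The part of the inserted rows to the left of the inserted triangle. -/
theorem insert_south_left {i j : ℕ} (hi : i ≤ Y.n) (hj : j < γ) :
    (X.insert γ Y).south (X.n - γ + i) j = shift (X.n - γ) Y.n (X.south (X.n - γ) j) := by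
  obtain ⟨d, hd⟩ : ∃ d, i + d = Y.n := ⟨Y.n - i, by omega⟩
  induction d generalizing i with
  | zero =>
    rw [south_eq_north (by rw [insert_n]; omega), south_eq_north (by omega),
      show X.n - γ + i + 1 = X.n - γ + 1 + Y.n by omega,
      (insert_lower_left hX hY hγ (by omega) (by omega)).2]
  | succ d ih =>
    rw [south_eq_north (by rw [insert_n]; omega), north_of_mem, add_assoc, ih (by omega) (by omega)]
    exact mem_insert.2 (Or.inr (Or.inr (Or.inr ⟨by omega, by omega, hj⟩)))

theorem insert_west_left {i j : ℕ} (hi0 : 1 ≤ i) (hi : i ≤ Y.n) (hj : j ≤ γ) :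
    (X.insert γ Y).west (X.n - γ + i) j = X.n - γ + i := by
  induction j with
  | zero => rw [west_zero]
  | succ j ih =>
    rw [west_succ_of_mem, ih (by omega)]
    exact mem_insert.2 (Or.inr (Or.inr (Or.inr ⟨by omega, by omega, by omega⟩)))

/-- The inserted triangle, except for its top row. -/
theorem insert_center_pos {i j : ℕ} (hi : 1 ≤ i) (hij : i + j ≤ Y.n) :
    (X.insert γ Y).west (X.n - γ + i) (γ + j) = X.n - γ + Y.west i j ∧
      (X.insert γ Y).north (X.n - γ + i) (γ + j) = X.n - γ + Y.north i j := by
  have hYT := hY.inTriangle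
  obtain ⟨d, hd⟩ : ∃ d, i + d = Y.n := ⟨Y.n - i, by omega⟩
  induction d generalizing i j with
  | zero =>
    obtain rfl : j = 0 := by omega
    rw [north_of_notMem (hYT.notMem (by omega)),
      north_of_notMem ((insert_inTriangle hX hY hγ).notMem (by rw [insert_n]; omega)),
      add_zero, insert_west_left hX hY hγ hi (by omega) le_rfl, west_zero]
    exact ⟨rfl, rfl⟩
  | succ d ih =>
    have h := row_transfer (X := Y) (R := X.insert γ Y) (i := i) (i' := X.n - γ + i) (c := 0)
      (c' := γ) (L := d + 1) (X.n - γ + ·)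
      (by simp only [west_zero]; rw [insert_west_left hX hY hγ hi (by omega) le_rfl])
      (fun t ht => by
        simp only [zero_add]
        rw [south_eq_north (by rw [insert_n]; omega), south_eq_north (by omega), add_assoc,
          (ih (by omega) (by omega) (by omega)).2])
      (fun t _ => by rw [zero_add, mem_insert_center hX hY hγ (by omega)])
    obtain ⟨h1, h2⟩ := h j (by omega)
    simp only [zero_add] at h1 h2
    refine ⟨h1, ?_⟩
    rcases Nat.lt_or_ge j (d + 1) with hj | hj
    · exact h2 hj
    · rw [north_of_notMem (hYT.notMem (by omega)), h1.symm,
        north_of_notMem ((insert_inTriangle hX hY hγ).notMem (by rw [insert_n]; omega))]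

theorem insert_south_center {i j : ℕ} (hij : i + j < Y.n) :
    (X.insert γ Y).south (X.n - γ + i) (γ + j) = X.n - γ + Y.south i j := by
  rw [south_eq_north (by rw [insert_n]; omega), south_eq_north hij, add_assoc,
    (insert_center_pos hX hY hγ (by omega) (by omega)).2]

/-- The top row of the inserted triangle. The pipe `0` of `Y` only uses the corner box and is
replaced by pipes of `X`, so that the transfer starts to the right of this box. -/
theorem insert_center_zero {j : ℕ} (hj0 : 1 ≤ j) (hj : j ≤ Y.n) :
    (X.insert γ Y).west (X.n - γ) (γ + j) = X.n - γ + Y.west 0 j ∧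
      (X.insert γ Y).north (X.n - γ) (γ + j) = X.n - γ + Y.north 0 j := by
  have hYT := hY.inTriangle
  have h := row_transfer (X := Y) (R := X.insert γ Y) (i := 0) (i' := X.n - γ) (c := 1)
      (c' := γ + 1) (L := Y.n - 1) (X.n - γ + ·)
      (by
        rw [west_succ_of_notMem, west_succ_of_notMem hY.2.1]
        · exact insert_south_center hX hY hγ (i := 0) (j := 0) (by omega)
        · have := mem_insert_center hX hY hγ (i := 0) (j := 0) (by omega)
          rw [add_zero, add_zero] at this
          rw [this]
          exact hY.2.1)
      (fun t ht => by
        have := insert_south_center hX hY hγ (i := 0) (j := 1 + t) (by omega)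
        rw [add_zero, ← add_assoc] at this
        exact this)
      (fun t ht => by
        have := mem_insert_center hX hY hγ (i := 0) (j := 1 + t) (by omega)
        rw [add_zero, ← add_assoc] at this
        exact this)
  obtain ⟨t, rfl⟩ : ∃ t, j = 1 + t := ⟨j - 1, by omega⟩
  obtain ⟨h1, h2⟩ := h t (by omega)
  rw [add_assoc] at h1 h2
  refine ⟨h1, ?_⟩
  rcases Nat.lt_or_ge t (Y.n - 1) with hj | hj
  · exact h2 hj
  · rw [north_of_notMem (hYT.notMem (by omega)), h1.symm,
      north_of_notMem ((insert_inTriangle hX hY hγ).notMem (by rw [insert_n]; omega))]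

theorem insert_west_center {i j : ℕ} (h0 : 1 ≤ i + j) (hij : i + j ≤ Y.n) :
    (X.insert γ Y).west (X.n - γ + i) (γ + j) = X.n - γ + Y.west i j := by
  rcases Nat.eq_zero_or_pos i with rfl | hi
  · rw [add_zero, (insert_center_zero hX hY hγ (by omega) (by omega)).1]
  · exact (insert_center_pos hX hY hγ hi hij).1

/-- The rows of `X` above the inserted rows. -/
theorem insert_upper {i : ℕ} (hi : i ≤ X.n - γ) :
    (∀ j, j ≤ γ → (X.insert γ Y).west i j = shift (X.n - γ) Y.n (X.west i j) ∧
      (X.insert γ Y).north i j = shift (X.n - γ) Y.n (X.north i j) ∧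
      (i + j < X.n → (X.insert γ Y).south i j = shift (X.n - γ) Y.n (X.south i j))) ∧
    (∀ j, 1 ≤ j → j ≤ Y.n → (X.insert γ Y).north i (γ + j) = X.n - γ + Y.north 0 j ∧
      (i < X.n - γ →
        (X.insert γ Y).west i (γ + j) = shift (X.n - γ) Y.n (X.west i (γ + 1)) ∧
        (X.insert γ Y).south i (γ + j) = X.n - γ + Y.north 0 j)) ∧
    (∀ j, γ < j → i + j ≤ X.n →
      (X.insert γ Y).west i (j + Y.n) = shift (X.n - γ) Y.n (X.west i j) ∧
      (X.insert γ Y).north i (j + Y.n) = shift (X.n - γ) Y.n (X.north i j) ∧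
      (i + j < X.n →
        (X.insert γ Y).south i (j + Y.n) = shift (X.n - γ) Y.n (X.south i j))) := by
  have hR := insert_inTriangle hX hY hγ
  have left : ∀ i, i ≤ X.n - γ →
      (∀ j, j ≤ γ → i + j < X.n →
        (X.insert γ Y).south i j = shift (X.n - γ) Y.n (X.south i j)) →
      ∀ j, j ≤ γ → (X.insert γ Y).west i j = shift (X.n - γ) Y.n (X.west i j) ∧
        (X.insert γ Y).north i j = shift (X.n - γ) Y.n (X.north i j) := by
    intro i hi hs j hj
    have h := row_transfer (X := X) (R := X.insert γ Y) (i := i) (i' := i) (c := 0) (c' := 0)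
      (L := γ) (shift (X.n - γ) Y.n)
      (by rw [west_zero, west_zero, shift, if_pos hi])
      (fun t ht => by rw [zero_add]; exact hs t (by omega) (by omega))
      (fun t ht => by rw [zero_add, mem_insert_upper_left hX hY hγ hi (by omega)])
    obtain ⟨h1, h2⟩ := h j hj
    rw [zero_add] at h1
    refine ⟨h1, ?_⟩
    have hc := mem_insert_upper_left hX hY hγ hi hj
    by_cases hx : (i, j) ∈ X.crosses
    · rw [north_of_mem hx, north_of_mem (hc.2 hx), hs j hj (hX _ hx)]
    · rw [north_of_notMem hx, north_of_notMem fun h => hx (hc.1 h), h1]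
  obtain ⟨d, hd⟩ : ∃ d, i + d = X.n - γ := ⟨X.n - γ - i, by omega⟩
  induction d generalizing i with
  | zero =>
    obtain rfl : i = X.n - γ := hd
    have hs : ∀ j, j ≤ γ → X.n - γ + j < X.n →
        (X.insert γ Y).south (X.n - γ) j = shift (X.n - γ) Y.n (X.south (X.n - γ) j) :=
      fun j _ h => insert_south_left hX hY hγ (i := 0) (by omega) (by omega)
    refine ⟨fun j hj => ?_, fun j hj0 hj => ⟨(insert_center_zero hX hY hγ hj0 hj).2,
      fun h => absurd h (lt_irrefl _)⟩, fun j h1 h2 => by omega⟩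
    obtain ⟨h1, h2⟩ := left _ hi hs j hj
    exact ⟨h1, h2, hs j hj⟩
  | succ d ih =>
    obtain ⟨ih1, ih2, ih3⟩ := ih (i := i + 1) (by omega) (by omega)
    have hs1 : ∀ j, j ≤ γ → i + j < X.n →
        (X.insert γ Y).south i j = shift (X.n - γ) Y.n (X.south i j) := fun j hj h => by
      rw [south_eq_north (by rw [insert_n]; omega), south_eq_north h, (ih1 j hj).2.1]
    have hs2 : ∀ j, 1 ≤ j → j ≤ Y.n →
        (X.insert γ Y).south i (γ + j) = X.n - γ + Y.north 0 j := fun j h1 h2 => by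
      rw [south_eq_north (by rw [insert_n]; omega), (ih2 j h1 h2).1]
    have hs3 : ∀ j, γ < j → i + j < X.n →
        (X.insert γ Y).south i (j + Y.n) = shift (X.n - γ) Y.n (X.south i j) := fun j hj h => by
      rw [south_eq_north (by rw [insert_n]; omega), south_eq_north h,
        (ih3 j hj (by omega)).2.1]
    have hl := left i hi hs1
    have hc2 : ∀ j, 1 ≤ j → j ≤ Y.n → (i, γ + j) ∈ (X.insert γ Y).crosses := fun j h1 h2 =>
      mem_insert.2 (Or.inr (Or.inr (Or.inl ⟨by omega, by omega, by omega⟩)))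
    have hw2 : ∀ j, j ≤ Y.n →
        (X.insert γ Y).west i (γ + j + 1) = shift (X.n - γ) Y.n (X.west i (γ + 1)) := by
      intro j hj
      induction j with
      | zero =>
        have hc := mem_insert_upper_left hX hY hγ hi (le_refl γ)
        rw [add_zero]
        by_cases hx : (i, γ) ∈ X.crosses
        · rw [west_succ_of_mem hx, west_succ_of_mem (hc.2 hx), (hl γ le_rfl).1]
        · rw [west_succ_of_notMem hx, west_succ_of_notMem fun h => hx (hc.1 h),
            hs1 γ le_rfl (by omega)]
      | succ j ihj => rw [west_succ_of_mem (hc2 _ (by omega) hj), ← add_assoc, ihj (by omega)]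
    refine ⟨fun j hj => ⟨(hl j hj).1, (hl j hj).2, hs1 j hj⟩, fun j hj0 hj => ?_,
      fun j hj h => ?_⟩
    · refine ⟨by rw [north_of_mem (hc2 j hj0 hj), hs2 j hj0 hj], fun _ => ⟨?_, hs2 j hj0 hj⟩⟩
      obtain ⟨j, rfl⟩ : ∃ t, j = t + 1 := ⟨j - 1, by omega⟩
      exact hw2 j (by omega)
    · have h3 := row_transfer (X := X) (R := X.insert γ Y) (i := i) (i' := i) (c := γ + 1)
        (c' := γ + 1 + Y.n) (L := X.n - i - (γ + 1)) (shift (X.n - γ) Y.n)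
        (by rw [← hw2 Y.n le_rfl, add_right_comm])
        (fun t ht => by rw [add_right_comm]; exact hs3 _ (by omega) (by omega))
        (fun t ht => by rw [add_right_comm, mem_insert_upper_right hX hY hγ hi (by omega)])
      obtain ⟨h4, h5⟩ := h3 (j - (γ + 1)) (by omega)
      rw [add_right_comm, show γ + 1 + (j - (γ + 1)) = j by omega] at h4 h5
      refine ⟨h4, ?_, hs3 j hj⟩
      rcases Nat.lt_or_ge (i + j) X.n with hlt | hge
      · exact h5 (by omega)
      · rw [north_of_notMem (hX.notMem hge), ← h4,
          north_of_notMem (hR.notMem (by rw [insert_n]; omega))]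

end insert

end Filling

namespace Filling

/-! ### Crossing pairs, packings and iterations of insertions -/

theorem InTriangle.exists_north {X : Filling} (hX : X.InTriangle) {i l : ℕ} (hl : i ≤ l)
    (hl' : l ≤ X.n) : ∃ j, i + j ≤ X.n ∧ X.north i j = l := by
  by_contra! hno
  have h1 := hX.count_north (· = l) (i := i) (d := X.n + 1 - i) (by omega)
  have h2 : Nat.count (fun j => X.north i j = l) (X.n + 1 - i) = 0 := by
    rw [Nat.count_eq_card_filter_range, Finset.card_eq_zero, Finset.filter_eq_empty_iff]
    intro c hc
    rw [Finset.mem_range] at hc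
    exact hno c (by omega)
  have h3 : Nat.count (· = l) i = 0 := by
    rw [Nat.count_eq_card_filter_range, Finset.card_eq_zero, Finset.filter_eq_empty_iff]
    intro c hc
    rw [Finset.mem_range] at hc
    omega
  have h4 : Nat.count (· = l) (X.n + 1) ≠ 0 := by
    rw [Nat.count_eq_card_filter_range, Ne, Finset.card_eq_zero, Finset.filter_eq_empty_iff]
    exact fun h => h (Finset.mem_range.2 (by omega)) rfl
  omega

/-- The pairs of pipes that cross after an insertion. Besides the crosses of `X` and of `Y`, each
pipe of `X` running from column `γ` to column `γ + 1` crosses all pipes of `Y` in the row where it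
does so, and each pipe of `Y` crosses all the pipes of `X` entering below it in the row where it
enters. -/
theorem crosses_insert {X Y : Filling} {γ : ℕ} (hX : X.InTriangle) (hY : Y.IsPipeDream)
    (hγ : γ ≤ X.n) {u v i : ℕ} : (X.insert γ Y).Crosses u v i ↔
      (∃ a b r, X.Crosses a b r ∧ shift (X.n - γ) Y.n a = u ∧ shift (X.n - γ) Y.n b = v ∧
        shift (X.n - γ) Y.n r = i) ∨
      (∃ a b r, Y.Crosses a b r ∧ X.n - γ + a = u ∧ X.n - γ + b = v ∧ X.n - γ + r = i) ∨
      (i < X.n - γ ∧ shift (X.n - γ) Y.n (X.west i (γ + 1)) = u ∧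
        X.n - γ < v ∧ v ≤ X.n - γ + Y.n) ∨
      (X.n - γ < u ∧ u ≤ X.n - γ + Y.n ∧ i = u ∧ X.n - γ + Y.n < v ∧ v ≤ X.n + Y.n) := by
  have hYT := hY.inTriangle
  have labX : ∀ r j, (r, j) ∈ X.crosses →
      (X.insert γ Y).west (shift (X.n - γ) Y.n r) (shift γ Y.n j) =
        shift (X.n - γ) Y.n (X.west r j) ∧
      (X.insert γ Y).south (shift (X.n - γ) Y.n r) (shift γ Y.n j) =
        shift (X.n - γ) Y.n (X.south r j) := by
    intro r j hc
    have hlt : r + j < X.n := hX _ hc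
    by_cases hr : r ≤ X.n - γ
    · rw [shift, if_pos hr]
      obtain ⟨h1, -, h3⟩ := insert_upper hX hY hγ hr
      by_cases hj : j ≤ γ
      · rw [shift, if_pos hj]
        exact ⟨(h1 j hj).1, (h1 j hj).2.2 hlt⟩
      · rw [shift, if_neg hj]
        have := h3 j (by omega) (by omega)
        exact ⟨this.1, this.2.2 hlt⟩
    · rw [shift, if_neg hr, shift, if_pos (by omega)]
      have h1 := (insert_lower_left hX hY hγ (i := r) (j := j) (by omega) (by omega)).1
      have h2 := (insert_lower_left hX hY hγ (i := r + 1) (j := j) (by omega) (by omega)).2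
      refine ⟨h1, ?_⟩
      rw [south_eq_north (by rw [insert_n]; omega), south_eq_north hlt, add_right_comm, h2]
  have labY : ∀ r j, (r, j) ∈ Y.crosses →
      (X.insert γ Y).west (X.n - γ + r) (γ + j) = X.n - γ + Y.west r j ∧
      (X.insert γ Y).south (X.n - γ + r) (γ + j) = X.n - γ + Y.south r j := by
    intro r j hc
    have hlt : r + j < Y.n := hYT _ hc
    refine ⟨insert_west_center hX hY hγ ?_ (by omega), insert_south_center hX hY hγ hlt⟩
    rw [Nat.one_le_iff_ne_zero]
    intro h0
    obtain ⟨rfl, rfl⟩ : r = 0 ∧ j = 0 := by omega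
    exact hY.2.1 hc
  have labL : ∀ a j, 1 ≤ a → a ≤ Y.n → j < γ →
      (X.insert γ Y).west (X.n - γ + a) j = X.n - γ + a ∧
      (X.insert γ Y).south (X.n - γ + a) j = shift (X.n - γ) Y.n (X.south (X.n - γ) j) :=
    fun a j h1 h2 h3 => ⟨insert_west_left hX hY hγ h1 h2 (by omega),
      insert_south_left hX hY hγ h2 h3⟩
  constructor
  · rintro ⟨c, hc, rfl, rfl⟩
    rcases mem_insert.1 hc with ⟨r, j, h, rfl, rfl⟩ | ⟨r, j, h, rfl, rfl⟩ | h | h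
    · exact Or.inl ⟨_, _, r, ⟨j, h, rfl, rfl⟩, (labX r j h).1.symm, (labX r j h).2.symm, rfl⟩
    · exact Or.inr (Or.inl ⟨_, _, r, ⟨j, h, rfl, rfl⟩, (labY r j h).1.symm, (labY r j h).2.symm,
        rfl⟩)
    · obtain ⟨t, rfl⟩ : ∃ t, c = γ + t := ⟨c - γ, by omega⟩
      obtain ⟨h1, h2⟩ := ((insert_upper hX hY hγ h.1.le).2.1 t (by omega) (by omega)).2 h.1
      have h3 := hY.north_pos (j := t) (by omega) (by omega)
      have h4 := (hYT.north_le (i := 0) (j := t) (by omega)).2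
      refine Or.inr (Or.inr (Or.inl ⟨h.1, h1.symm, ?_, ?_⟩)) <;> omega
    · obtain ⟨a, rfl⟩ : ∃ a, i = X.n - γ + a := ⟨i - (X.n - γ), by omega⟩
      obtain ⟨h1, h2⟩ := labL a c (by omega) (by omega) h.2.2
      have h3 := hX.south_le (i := X.n - γ) (j := c) (by omega)
      rw [shift, if_neg (by omega)] at h2
      refine Or.inr (Or.inr (Or.inr ?_))
      omega
  · rintro (⟨a, b, r, ⟨j, h, rfl, rfl⟩, rfl, rfl, rfl⟩ |
      ⟨a, b, r, ⟨j, h, rfl, rfl⟩, rfl, rfl, rfl⟩ | ⟨h1, rfl, h2, h3⟩ | ⟨h1, h2, rfl, h3, h4⟩)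
    · exact ⟨_, mem_insert.2 (Or.inl ⟨r, j, h, rfl, rfl⟩), labX r j h⟩
    · exact ⟨_, mem_insert.2 (Or.inr (Or.inl ⟨r, j, h, rfl, rfl⟩)), labY r j h⟩
    · obtain ⟨t, ht, e⟩ := hYT.exists_north (i := 0) (l := v - (X.n - γ)) (Nat.zero_le _)
        (by omega)
      have ht0 : 1 ≤ t := by
        rw [Nat.one_le_iff_ne_zero]
        rintro rfl
        rw [hY.north_zero] at e
        omega
      obtain ⟨h4, h5⟩ := ((insert_upper hX hY hγ h1.le).2.1 t ht0 (by omega)).2 h1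
      exact ⟨γ + t, mem_insert.2 (Or.inr (Or.inr (Or.inl ⟨h1, by omega, by omega⟩))), h4,
        by omega⟩
    · obtain ⟨t, ht, e⟩ := hX.exists_north (i := X.n - γ + 1) (l := v - Y.n) (by omega)
        (by omega)
      obtain ⟨a, rfl⟩ : ∃ a, i = X.n - γ + a := ⟨i - (X.n - γ), by omega⟩
      obtain ⟨h5, h6⟩ := labL a t (by omega) (by omega) (by omega)
      rw [south_eq_north (X := X) (by omega), e, shift, if_neg (by omega)] at h6
      exact ⟨t, mem_insert.2 (Or.inr (Or.inr (Or.inr ⟨h1, h2, by omega⟩))), h5, by omega⟩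

/-- At a global descent, the pipes with large label do not reach the columns after `γ`. -/
theorem IsPipeDream.west_cut {X : Filling} (hX : X.IsPipeDream) {γ : ℕ} (h : X.IsCut γ) {i : ℕ}
    (hi : i < X.n - γ) : X.west i (γ + 1) ≤ X.n - γ := by
  have hT := hX.inTriangle
  by_contra hlt
  have hw := (hT.west_le (i := i) (j := γ + 1) (by omega)).2
  set l := X.west i (γ + 1) with hl
  -- a pipe with large label leaves at the top before column `γ + 1`, so it cannot leave the
  -- rectangle above and to the left of the gap through its right side as well
  have h1 := count_rectangle (X := X) (· = l) (r := X.n - γ) (c := γ + 1) (by omega)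
  have h2 := hT.count_north (· = l) (i := X.n - γ) (d := γ + 1) (by omega)
  have h3 := hT.count_north (· = l) (i := 0) (d := X.n + 1) (by omega)
  have h4 : Nat.count (fun j => X.north 0 j = l) (X.n + 1) =
      Nat.count (fun j => X.north 0 j = l) (γ + 1) := by
    obtain ⟨d, hd⟩ : ∃ d, X.n = γ + d := ⟨X.n - γ, by omega⟩
    have : ∀ e ≤ d, Nat.count (fun j => X.north 0 j = l) (γ + e + 1) =
      Nat.count (fun j => X.north 0 j = l) (γ + 1) := by
      intro e he
      induction e with
      | zero => rfl
      | succ e ih =>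
        rw [Nat.count_succ, ← add_assoc, ih (by omega), if_neg, add_zero]
        have := h.2 (γ + e + 1) (by omega) (by omega)
        omega
    rw [← this d le_rfl, ← hd]
  have h5 : Nat.count (fun r => X.west r (γ + 1) = l) (X.n - γ) ≠ 0 := by
    rw [Nat.count_eq_card_filter_range, Ne, Finset.card_eq_zero, Finset.filter_eq_empty_iff]
    exact fun h => h (Finset.mem_range.2 hi) rfl
  rw [Nat.count_zero] at h3
  omega

theorem IsPipeDream.insert {X Y : Filling} (hX : X.IsPipeDream) (hY : Y.IsPipeDream) {γ : ℕ}
    (h : X.IsCut γ) : (X.insert γ Y).IsPipeDream := by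
  have hT := hX.inTriangle
  have hγ := h.1
  refine isPipeDream_iff.2 ⟨insert_inTriangle hT hY hγ, ?_, ?_⟩
  · rw [mem_insert_upper_left hT hY hγ (Nat.zero_le _) (Nat.zero_le _)]
    exact hX.2.1
  · rintro ⟨i, c⟩ hc
    change (X.insert γ Y).west i c < (X.insert γ Y).south i c
    rcases (crosses_insert hT hY hγ).1 ⟨c, hc, rfl, rfl⟩ with
      ⟨a, b, r, ⟨j, h, rfl, rfl⟩, h1, h2, -⟩ |
      ⟨a, b, r, ⟨j, h, rfl, rfl⟩, h1, h2, -⟩ | ⟨h1, h2, h3, -⟩ | ⟨h1, h2, -, h3, -⟩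
    · have := hX.isReduced _ h
      simp only at this
      rw [← h1, ← h2]
      unfold shift
      split_ifs <;> omega
    · have := hY.isReduced _ h
      simp only at this
      omega
    · have := hX.west_cut h h1
      rw [shift, if_pos this] at h2
      omega
    · omega

/-- Along a row above the inserted rows, packing at a label `k ≥ X.n - γ` removes only pipes that
pass before the column `γ + 1`. -/
theorem IsPipeDream.west_hPack_cut {X : Filling} (hX : X.IsPipeDream) {γ k : ℕ} (h : X.IsCut γ)
    (hk : k ≤ X.n) (hkγ : X.n - γ ≤ k) {i : ℕ} (hi : i < X.n - γ) :
    (Filling.hPack k X).west i (γ - (X.n - k) + 1) = X.west i (γ + 1) := by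
  have hT := hX.inTriangle
  have hγ := h.1
  have h1 := hX.west_cut h hi
  have h2 := hT.west_hPack hk (i := i) (j := γ + 1) (by omega) (by omega)
  rw [← h2]
  congr 1
  have h3 := X.count_row (k < ·) i (γ + 1)
  -- all removed pipes pass row `i` in the columns up to `γ`
  have h4 : ∀ d i, i + d = X.n - γ →
      Nat.count (fun j => k < X.north i j) (γ + 1) = X.n - k := by
    intro d
    induction d with
    | zero =>
      intro i hi
      have h5 := hT.count_north (k < ·) (i := i) (d := γ + 1) (by omega)
      have h6 : ∀ m, Nat.count (k < ·) m = m - (k + 1) := by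
        intro m
        induction m with
        | zero => simp
        | succ m ih => rw [Nat.count_succ, ih]; split_ifs <;> omega
      rw [h6, h6] at h5
      omega
    | succ d ih =>
      intro i hi
      have h5 := X.count_row (k < ·) i (γ + 1)
      have h6 := hX.west_cut h (i := i) (by omega)
      rw [count_south (k < ·) (by omega), ih (i + 1) (by omega), if_neg (by omega),
        if_neg (by omega)] at h5
      omega
  have h5 := h4 _ i (Nat.add_sub_cancel' hi.le)
  have h6 : ∀ m, X.packCol k i m + Nat.count (fun j => k < X.north i j) m = m := by
    intro m
    induction m with
    | zero => simp [packCol]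
    | succ m ih =>
      rw [packCol_succ, Nat.count_succ]
      split_ifs <;> omega
  have := h6 (γ + 1)
  omega

/-- The horizontal packing of an insertion keeps `k` pipes of `X` and `l` pipes of `Y`. The pipes of
`Y` enter between the rows `X.n - γ` and `X.n - γ + 1` of `X`, so either all of them are removed, or
all of them are kept, or `k = X.n - γ`. -/
theorem IsPipeDream.hPack_insert {X Y : Filling} (hX : X.IsPipeDream) (hY : Y.IsPipeDream)
    {γ k l : ℕ} (h : X.IsCut γ) (hk : k ≤ X.n) (hl : l ≤ Y.n)
    (h1 : k < X.n - γ → l = 0) (h2 : X.n - γ < k → l = Y.n)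
    (hcut : (Filling.hPack k X).IsCut (γ - (X.n - k))) :
    Filling.hPack (k + l) (X.insert γ Y) =
      (Filling.hPack k X).insert (γ - (X.n - k)) (Filling.hPack l Y) := by
  have hT := hX.inTriangle
  have hγ := h.1
  have hR := hX.insert hY h
  have hkl : k + l ≤ (X.insert γ Y).n := by rw [insert_n]; omega
  have hXk := hX.hPack hk
  have hYl := hY.hPack hl
  refine eq_of_crosses_iff (hR.hPack hkl).inTriangle (hXk.insert hYl hcut).inTriangle rfl
    fun u v i => ?_
  rw [hR.inTriangle.crosses_hPack hkl, crosses_insert hT hY hγ,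
    crosses_insert hXk.inTriangle hYl (by rw [hPack_n]; omega), hPack_n, hPack_n]
  simp only [hT.crosses_hPack hk, hY.inTriangle.crosses_hPack hl]
  have hrowX : ∀ a b r, X.Crosses a b r → r ≤ a ∧ r ≤ b := by
    rintro a b r ⟨j, hc, rfl, rfl⟩
    have hlt : r + j < X.n := hT _ hc
    exact ⟨(hT.west_le hlt.le).1, (hT.south_le hlt).1.le⟩
  -- if `k < X.n - γ`, the pipes of `Y` and all pipes of `X` entering below them are removed
  rcases Nat.lt_or_ge k (X.n - γ) with hkγ | hkγ
  · obtain rfl := h1 hkγ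
    rw [show γ - (X.n - k) = 0 by omega, Nat.sub_zero]
    unfold shift
    constructor
    · rintro ⟨⟨a, b, r, hc, e1, e2, e3⟩ | ⟨a, b, r, hc, e1, e2, e3⟩ | h | h, hu, hv⟩
      · have := hrowX _ _ _ hc
        refine Or.inl ⟨a, b, r, ⟨hc, ?_, ?_⟩, ?_, ?_, ?_⟩ <;> split_ifs at * <;> omega
      · omega
      · omega
      · omega
    · rintro (⟨a, b, r, ⟨hc, ha, hb⟩, e1, e2, e3⟩ |
        ⟨a, b, r, ⟨⟨j, hc, h3, h4⟩, ha, hb⟩, e1, e2, e3⟩ |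
        h | h)
      · have := hrowX _ _ _ hc
        refine ⟨Or.inl ⟨a, b, r, hc, ?_, ?_, ?_⟩, ?_, ?_⟩ <;> split_ifs at * <;> omega
      · have := hY.isReduced _ hc
        simp only at this
        omega
      · omega
      · omega
  · have hwest := fun i => hX.west_hPack_cut h hk hkγ (i := i)
    rw [show k - (γ - (X.n - k)) = X.n - γ by omega]
    have hsh : ∀ a, shift (X.n - γ) Y.n a ≤ k + l ↔ a ≤ k := by
      intro a
      unfold shift
      split_ifs
      · omega
      · rcases Nat.lt_or_ge (X.n - γ) k with h3 | h3
        · rw [h2 h3]; omega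
        · omega
    have hsh' : ∀ a, a ≤ k → shift (X.n - γ) Y.n a = shift (X.n - γ) l a := by
      intro a ha
      unfold shift
      split_ifs
      · rfl
      · rw [h2 (by omega)]
    have hw : i < X.n - γ → X.west i (γ + 1) ≤ k := fun hi => (hX.west_cut h hi).trans hkγ
    constructor
    · rintro ⟨⟨a, b, r, hc, rfl, rfl, rfl⟩ | ⟨a, b, r, hc, rfl, rfl, rfl⟩ | ⟨h3, rfl, h4, h5⟩ |
        ⟨h3, h4, rfl, h5, h6⟩, hu, hv⟩
      · rw [hsh] at hu hv
        have := hrowX _ _ _ hc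
        exact Or.inl ⟨a, b, r, ⟨hc, hu, hv⟩, (hsh' _ hu).symm, (hsh' _ hv).symm,
          (hsh' _ (by omega)).symm⟩
      · have := hY.inTriangle.crosses_le hc
        refine Or.inr (Or.inl ⟨a, b, r, ⟨hc, ?_, ?_⟩, rfl, rfl, rfl⟩) <;> omega
      · refine Or.inr (Or.inr (Or.inl ⟨h3, ?_, h4, by omega⟩))
        rw [hwest i h3, hsh' _ (hw h3)]
      · exact Or.inr (Or.inr (Or.inr ⟨h3, by omega, rfl, by omega, hv⟩))
    · rintro (⟨a, b, r, ⟨hc, ha, hb⟩, rfl, rfl, rfl⟩ | ⟨a, b, r, ⟨hc, ha, hb⟩, rfl, rfl, rfl⟩ |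
        ⟨h3, rfl, h4, h5⟩ | ⟨h3, h4, rfl, h5, h6⟩)
      · have := hrowX _ _ _ hc
        rw [← hsh' _ ha, ← hsh' _ hb, ← hsh' r (by omega), hsh, hsh]
        exact ⟨Or.inl ⟨a, b, r, hc, rfl, rfl, rfl⟩, ha, hb⟩
      · exact ⟨Or.inr (Or.inl ⟨a, b, r, hc, rfl, rfl, rfl⟩), by omega, by omega⟩
      · rw [hwest i h3, ← hsh' _ (hw h3), hsh]
        exact ⟨Or.inr (Or.inr (Or.inl ⟨h3, rfl, h4, by omega⟩)), hw h3, by omega⟩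
      · have h7 := h2 (by omega)
        exact ⟨Or.inr (Or.inr (Or.inr ⟨h3, by omega, rfl, by omega, by omega⟩)), by omega,
          by omega⟩

/-- Reflection exchanges the inserted rows and columns. -/
theorem transpose_insert (X : Filling) {γ : ℕ} (hγ : γ ≤ X.n) (Y : Filling) :
    (X.insert γ Y).transpose = X.transpose.insert (X.n - γ) Y.transpose := by
  refine Filling.ext rfl (Finset.ext fun ⟨r, c⟩ => ?_)
  simp only [mem_transpose, mem_insert, transpose_n, Nat.sub_sub_self hγ]
  constructor
  · rintro (⟨i, j, h, h1, h2⟩ | ⟨i, j, h, h1, h2⟩ | h | h)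
    · exact Or.inl ⟨j, i, h, h2, h1⟩
    · exact Or.inr (Or.inl ⟨j, i, h, h2, h1⟩)
    · exact Or.inr (Or.inr (Or.inr ⟨h.2.1, h.2.2, h.1⟩))
    · exact Or.inr (Or.inr (Or.inl ⟨h.2.2, h.1, h.2.1⟩))
  · rintro (⟨i, j, h, h1, h2⟩ | ⟨i, j, h, h1, h2⟩ | h | h)
    · exact Or.inl ⟨j, i, h, h2, h1⟩
    · exact Or.inr (Or.inl ⟨j, i, h, h2, h1⟩)
    · exact Or.inr (Or.inr (Or.inr ⟨h.2.1, h.2.2, h.1⟩))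
    · exact Or.inr (Or.inr (Or.inl ⟨h.2.2, h.1, h.2.1⟩))

/-- The vertical packing of an insertion keeps `k` columns of `X` and `l` columns of `Y`. -/
theorem IsPipeDream.vPack_insert {X Y : Filling} (hX : X.IsPipeDream) (hY : Y.IsPipeDream)
    {γ k l : ℕ} (h : X.IsCut γ) (hk : k ≤ X.n) (hl : l ≤ Y.n)
    (h1 : k < γ → l = 0) (h2 : γ < k → l = Y.n)
    (hcut : (Filling.vPack k X).IsCut (min γ k)) :
    Filling.vPack (k + l) (X.insert γ Y) =
      (Filling.vPack k X).insert (min γ k) (Filling.vPack l Y) := by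
  have hγ := h.1
  have h3 := hX.isCut_transpose h
  have h4 := (hX.vPack hk).isCut_transpose hcut
  rw [vPack_n, Filling.vPack, transpose_transpose,
    show k - min γ k = X.n - γ - (X.transpose.n - k) by rw [transpose_n]; omega] at h4
  have h6 := hX.transpose.hPack_insert hY.transpose h3 hk hl
    (by rw [transpose_n]; omega) (by rw [transpose_n, transpose_n]; omega) h4
  rw [Filling.vPack, transpose_insert X hγ, h6, transpose_insert _ (by
    rw [hPack_n, transpose_n]; omega), ← Filling.vPack, ← Filling.vPack, hPack_n, transpose_n]
  congr 1
  omega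

theorem insert_eq_self (X : Filling) (γ : ℕ) : X.insert γ ⟨0, ∅⟩ = X := by
  refine Filling.ext rfl (Finset.ext fun ⟨r, c⟩ => ?_)
  rw [mem_insert]
  dsimp only
  constructor
  · rintro (⟨i, j, h, h1, h2⟩ | ⟨i, j, h, h1, h2⟩ | h | h)
    · simp only [shift, add_zero, ite_self] at h1 h2
      rwa [← h1, ← h2]
    · exact absurd h (Finset.notMem_empty _)
    · omega
    · omega
  · intro h
    exact Or.inl ⟨r, c, h, by simp [shift], by simp [shift]⟩

theorem elbow_insert (Y : Filling) : insert ⟨0, ∅⟩ 0 Y = Y := by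
  refine Filling.ext (Nat.zero_add _) (Finset.ext fun ⟨r, c⟩ => ?_)
  rw [mem_insert]
  dsimp only
  constructor
  · rintro (⟨i, j, h, h1, h2⟩ | ⟨i, j, h, h1, h2⟩ | h | h)
    · exact absurd h (Finset.notMem_empty _)
    · simp only [Nat.zero_sub, zero_add] at h1 h2
      rwa [← h1, ← h2]
    · omega
    · omega
  · intro h
    exact Or.inr (Or.inl ⟨r, c, h, by simp, by simp⟩)

/-- Insertion into the inserted part. -/
theorem insert_insert_nested {X Y : Filling} {γ δ : ℕ} (hX : X.InTriangle) (hY : Y.InTriangle)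
    (hγ : γ ≤ X.n) (hδ : δ ≤ Y.n) (Z : Filling) :
    (X.insert γ Y).insert (γ + δ) Z = X.insert γ (Y.insert δ Z) := by
  refine Filling.ext (Nat.add_assoc _ _ _) (Finset.ext fun ⟨r, c⟩ => ?_)
  simp only [mem_insert, insert_n]
  unfold shift
  constructor
  · rintro (⟨_, _, ⟨i, j, h, rfl, rfl⟩ | ⟨i, j, h, rfl, rfl⟩ | h | h, h3, h4⟩ |
      ⟨i, j, h, h3, h4⟩ | h | h)
    · have : i + j < X.n := hX _ h
      refine Or.inl ⟨i, j, h, ?_, ?_⟩ <;> split_ifs at * <;> omega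
    · have : i + j < Y.n := hY _ h
      refine Or.inr (Or.inl ⟨_, _, Or.inl ⟨i, j, h, rfl, rfl⟩, ?_, ?_⟩) <;>
        split_ifs at * <;> omega
    · refine Or.inr (Or.inr (Or.inl ?_))
      split_ifs at * <;> omega
    · refine Or.inr (Or.inr (Or.inr ?_))
      split_ifs at * <;> omega
    · exact Or.inr (Or.inl ⟨_, _, Or.inr (Or.inl ⟨i, j, h, rfl, rfl⟩), by omega, by omega⟩)
    · by_cases hr : r < X.n - γ
      · exact Or.inr (Or.inr (Or.inl (by omega)))
      · exact Or.inr (Or.inl ⟨r - (X.n - γ), c - γ, Or.inr (Or.inr (Or.inl (by omega))),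
          by omega, by omega⟩)
    · by_cases hc : c < γ
      · exact Or.inr (Or.inr (Or.inr (by omega)))
      · exact Or.inr (Or.inl ⟨r - (X.n - γ), c - γ, Or.inr (Or.inr (Or.inr (by omega))),
          by omega, by omega⟩)
  · rintro (⟨i, j, h, h1, h2⟩ | ⟨_, _, ⟨i, j, h, rfl, rfl⟩ | ⟨i, j, h, rfl, rfl⟩ | h | h, h3, h4⟩ |
      h | h)
    · have : i + j < X.n := hX _ h
      refine Or.inl ⟨_, _, Or.inl ⟨i, j, h, rfl, rfl⟩, ?_, ?_⟩ <;> split_ifs at * <;> omega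
    · have : i + j < Y.n := hY _ h
      refine Or.inl ⟨_, _, Or.inr (Or.inl ⟨i, j, h, rfl, rfl⟩), ?_, ?_⟩ <;>
        split_ifs at * <;> omega
    · exact Or.inr (Or.inl ⟨i, j, h, by omega, by omega⟩)
    · exact Or.inr (Or.inr (Or.inl (by omega)))
    · exact Or.inr (Or.inr (Or.inr (by omega)))
    · by_cases h1 : c ≤ γ + δ
      · exact Or.inl ⟨r, c, Or.inr (Or.inr (Or.inl (by omega))), if_pos (by omega), if_pos h1⟩
      · by_cases h2 : c ≤ γ + δ + Z.n
        · exact Or.inr (Or.inr (Or.inl (by omega)))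
        · exact Or.inl ⟨r, c - Z.n, Or.inr (Or.inr (Or.inl (by omega))), if_pos (by omega),
            by rw [if_neg (by omega)]; omega⟩
    · by_cases h1 : r ≤ X.n + Y.n - (γ + δ)
      · exact Or.inl ⟨r, c, Or.inr (Or.inr (Or.inr (by omega))), if_pos h1, if_pos (by omega)⟩
      · by_cases h2 : r ≤ X.n + Y.n - (γ + δ) + Z.n
        · exact Or.inr (Or.inr (Or.inr (by omega)))
        · exact Or.inl ⟨r - Z.n, c, Or.inr (Or.inr (Or.inr (by omega))),
            by rw [if_neg (by omega)]; omega, if_pos (by omega)⟩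

/-- Insertions at different gaps commute. -/
theorem insert_insert_parallel {X Y Z : Filling} {γ δ : ℕ} (hX : X.InTriangle)
    (hY : Y.InTriangle) (hZ : Z.InTriangle) (hγ : γ < δ) (hδ : δ ≤ X.n) :
    (X.insert γ Y).insert (δ + Y.n) Z = (X.insert δ Z).insert γ Y := by
  refine Filling.ext (Nat.add_right_comm _ _ _) (Finset.ext fun ⟨r, c⟩ => ?_)
  simp only [mem_insert, insert_n]
  unfold shift
  constructor
  · rintro (⟨_, _, ⟨i, j, h, rfl, rfl⟩ | ⟨i, j, h, rfl, rfl⟩ | h | h, h3, h4⟩ |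
      ⟨i, j, h, h3, h4⟩ | h | h)
    · have : i + j < X.n := hX _ h
      refine Or.inl ⟨_, _, Or.inl ⟨i, j, h, rfl, rfl⟩, ?_, ?_⟩ <;> split_ifs at * <;> omega
    · have : i + j < Y.n := hY _ h
      refine Or.inr (Or.inl ⟨i, j, h, ?_, ?_⟩) <;> split_ifs at * <;> omega
    · refine Or.inr (Or.inr (Or.inl ?_))
      split_ifs at * <;> omega
    · refine Or.inr (Or.inr (Or.inr ?_))
      split_ifs at * <;> omega
    · have : i + j < Z.n := hZ _ h
      refine Or.inl ⟨_, _, Or.inr (Or.inl ⟨i, j, h, rfl, rfl⟩), ?_, ?_⟩ <;>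
        split_ifs at * <;> omega
    · refine Or.inl ⟨r, c - Y.n, Or.inr (Or.inr (Or.inl (by omega))), ?_, ?_⟩ <;>
        split_ifs at * <;> omega
    · by_cases h1 : c ≤ γ
      · refine Or.inl ⟨r, c, Or.inr (Or.inr (Or.inr (by omega))), ?_, ?_⟩ <;>
        split_ifs at * <;> omega
      · by_cases h2 : c ≤ γ + Y.n
        · exact Or.inr (Or.inr (Or.inl (by omega)))
        · refine Or.inl ⟨r, c - Y.n, Or.inr (Or.inr (Or.inr (by omega))), ?_, ?_⟩ <;>
            split_ifs at * <;> omega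
  · rintro (⟨_, _, ⟨i, j, h, rfl, rfl⟩ | ⟨i, j, h, rfl, rfl⟩ | h | h, h3, h4⟩ |
      ⟨i, j, h, h3, h4⟩ | h | h)
    · have : i + j < X.n := hX _ h
      refine Or.inl ⟨_, _, Or.inl ⟨i, j, h, rfl, rfl⟩, ?_, ?_⟩ <;> split_ifs at * <;> omega
    · have : i + j < Z.n := hZ _ h
      refine Or.inr (Or.inl ⟨i, j, h, ?_, ?_⟩) <;> split_ifs at * <;> omega
    · refine Or.inr (Or.inr (Or.inl ?_))
      split_ifs at * <;> omega
    · refine Or.inr (Or.inr (Or.inr ?_))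
      split_ifs at * <;> omega
    · have : i + j < Y.n := hY _ h
      refine Or.inl ⟨_, _, Or.inr (Or.inl ⟨i, j, h, rfl, rfl⟩), ?_, ?_⟩ <;>
        split_ifs at * <;> omega
    · by_cases h1 : r ≤ X.n - δ
      · refine Or.inl ⟨r, c, Or.inr (Or.inr (Or.inl (by omega))), ?_, ?_⟩ <;>
        split_ifs at * <;> omega
      · by_cases h2 : r ≤ X.n - δ + Z.n
        · exact Or.inr (Or.inr (Or.inr (by omega)))
        · refine Or.inl ⟨r - Z.n, c, Or.inr (Or.inr (Or.inl (by omega))), ?_, ?_⟩ <;>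
            split_ifs at * <;> omega
    · refine Or.inl ⟨r - Z.n, c, Or.inr (Or.inr (Or.inr (by omega))), ?_, ?_⟩ <;>
        split_ifs at * <;> omega

end Filling

/-! ### Cut systems -/

/-- The combinatorial core shared by permutations and pipe dreams. An object `x` has a word
`word x` of atoms. It can be cut at each gap `i ≤ (word x).length` into a left part `left x i` and
a right part `right x i`, and another object can be inserted at each gap. The axioms describe the
effect of these operations on the words and the ways in which they commute. -/
structure CutSystem (P : Type*) (α : Type*) where
  word : P → List α
  left : P → ℕ → P
  right : P → ℕ → P
  ins : P → ℕ → P → P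
  one : P
  word_left : ∀ x i, word (left x i) = (word x).take i
  word_right : ∀ x i, word (right x i) = (word x).drop i
  word_ins : ∀ x i y, i ≤ (word x).length →
    word (ins x i y) = (word x).take i ++ word y ++ (word x).drop i
  word_eq_nil : ∀ x, word x = [] ↔ x = one
  left_length : ∀ x, left x (word x).length = x
  right_zero : ∀ x, right x 0 = x
  left_left : ∀ x i j, i ≤ j → j ≤ (word x).length → left (left x j) i = left x i
  right_right : ∀ x i j, i + j ≤ (word x).length → right (right x i) j = right x (i + j)
  right_left : ∀ x i j, i + j ≤ (word x).length → right (left x (i + j)) i = left (right x i) j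
  ins_one : ∀ x i, i ≤ (word x).length → ins x i one = x
  one_ins : ∀ x, ins one 0 x = x
  left_ins_le : ∀ x i j y, j ≤ i → i ≤ (word x).length → left (ins x i y) j = left x j
  left_ins_mid : ∀ x i j y, i ≤ (word x).length → j ≤ (word y).length →
    left (ins x i y) (i + j) = ins (left x i) i (left y j)
  left_ins_ge : ∀ x i j y, i + j ≤ (word x).length →
    left (ins x i y) (i + (word y).length + j) = ins (left x (i + j)) i y
  right_ins_le : ∀ x i j y, i + j ≤ (word x).length →
    right (ins x (i + j) y) i = ins (right x i) j y
  right_ins_mid : ∀ x i j y, i ≤ (word x).length → j ≤ (word y).length →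
    right (ins x i y) (i + j) = ins (right x i) 0 (right y j)
  right_ins_ge : ∀ x i j y, i + j ≤ (word x).length →
    right (ins x i y) (i + (word y).length + j) = right x (i + j)
  ins_ins_nested : ∀ x i j y z, i ≤ (word x).length → j ≤ (word y).length →
    ins (ins x i y) (i + j) z = ins x i (ins y j z)
  ins_ins_parallel : ∀ x i j y z, i < j → j ≤ (word x).length →
    ins (ins x i y) (j + (word y).length) z = ins (ins x j z) i y

namespace CutSystem

variable {P α : Type*} (S : CutSystem P α)

/-- The number of atoms. -/
def len (x : P) : ℕ := (S.word x).length

@[simp] theorem len_one : S.len S.one = 0 := by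
  rw [len, (S.word_eq_nil _).2 rfl, List.length_nil]

theorem eq_one {x : P} (h : S.len x = 0) : x = S.one :=
  (S.word_eq_nil x).1 (List.length_eq_zero_iff.1 h)

theorem len_left {x : P} {i : ℕ} (h : i ≤ S.len x) : S.len (S.left x i) = i := by
  rw [len, S.word_left, List.length_take]
  exact min_eq_left h

theorem len_right (x : P) (i : ℕ) : S.len (S.right x i) = S.len x - i := by
  rw [len, S.word_right, List.length_drop, len]

theorem len_ins {x y : P} {i : ℕ} (h : i ≤ S.len x) :
    S.len (S.ins x i y) = S.len x + S.len y := by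
  rw [len, S.word_ins _ _ _ h]
  simp only [List.length_append, List.length_take, List.length_drop, len] at *
  omega

@[simp] theorem left_zero (x : P) : S.left x 0 = S.one :=
  S.eq_one (S.len_left (Nat.zero_le _))

@[simp] theorem right_len (x : P) : S.right x (S.len x) = S.one :=
  S.eq_one (by rw [S.len_right, Nat.sub_self])

/-- Tangling of `x` and `y` along a word in the letters `true` (an atom of `x`) and `false` (an
atom of `y`), from the gap `i` of `x` on. A block of `b` atoms of `y` is waiting to be inserted at
this gap. -/
def tangleFrom : P → P → ℕ → ℕ → List Bool → P
  | x, y, i, b, [] => S.ins x i (S.left y b)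
  | x, y, i, b, false :: w => tangleFrom x y i (b + 1) w
  | x, y, i, b, true :: w => S.ins (tangleFrom x (S.right y b) (i + 1) 0 w) i (S.left y b)

/-- Tangling of `x` and `y` along a word. -/
def tangle (x y : P) (w : List Bool) : P := S.tangleFrom x y 0 0 w

variable {S}

theorem len_tangleFrom {x y : P} {i b : ℕ} {w : List Bool} (hx : i + w.count true = S.len x)
    (hy : b + w.count false = S.len y) : S.len (S.tangleFrom x y i b w) = S.len x + S.len y := by
  induction w generalizing y i b with
  | nil =>
    simp only [List.count_nil, add_zero] at hx hy
    rw [tangleFrom, S.len_ins hx.le, S.len_left hy.le, hy]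
  | cons a w ih =>
    cases a
    · simp at hx hy
      exact ih hx (by omega)
    · simp at hx hy
      have h := ih (i := i + 1) (b := 0) (y := S.right y b) (by omega) (by rw [S.len_right]; omega)
      rw [S.len_right] at h
      rw [tangleFrom, S.len_ins (by omega), S.len_left (by omega)]
      omega

/-- The left part at a gap `j` of `x` that lies before the pending block. -/
theorem left_tangleFrom_le {x y : P} {i b j : ℕ} {w : List Bool}
    (hx : i + w.count true = S.len x) (hy : b + w.count false = S.len y) (hj : j ≤ i) :
    S.left (S.tangleFrom x y i b w) j = S.left x j := by
  induction w generalizing y i b with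
  | nil =>
    simp only [List.count_nil, add_zero] at hx hy
    exact S.left_ins_le _ _ _ _ hj hx.le
  | cons a w ih =>
    cases a
    · simp at hx hy
      exact ih hx (by omega) hj
    · simp at hx hy
      have hy' : 0 + w.count false = S.len (S.right y b) := by rw [S.len_right]; omega
      have hx' : i + 1 + w.count true = S.len x := by omega
      have hl := len_tangleFrom hx' hy'
      rw [tangleFrom, S.left_ins_le _ _ _ _ hj (show i ≤ S.len _ by omega),
        ih hx' hy' (by omega)]

/-- The left part at a gap within the pending block. -/
theorem left_tangleFrom_mid {x y : P} {i b c : ℕ} {w : List Bool}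
    (hx : i + w.count true = S.len x) (hy : b + w.count false = S.len y) (hc : c ≤ b) :
    S.left (S.tangleFrom x y i b w) (i + c) = S.ins (S.left x i) i (S.left y c) := by
  induction w generalizing y i b with
  | nil =>
    simp only [List.count_nil, add_zero] at hx hy
    rw [tangleFrom, S.left_ins_mid _ _ _ _ hx.le (show c ≤ S.len _ by rwa [S.len_left hy.le]),
      S.left_left _ _ _ hc hy.le]
  | cons a w ih =>
    cases a
    · simp at hx hy
      exact ih hx (by omega) (by omega)
    · simp at hx hy
      have hy' : 0 + w.count false = S.len (S.right y b) := by rw [S.len_right]; omega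
      have hx' : i + 1 + w.count true = S.len x := by omega
      have hl := len_tangleFrom hx' hy'
      have hb : b ≤ S.len y := by omega
      rw [tangleFrom, S.left_ins_mid _ _ _ _ (show i ≤ S.len _ by omega)
        (show c ≤ S.len _ by rwa [S.len_left hb]), S.left_left _ _ _ hc hb,
        left_tangleFrom_le hx' hy' (by omega)]

/-- The left part of a tangled object, with the gap after the first `j` letters. -/
theorem left_tangleFrom {x y : P} {i b j : ℕ} {w : List Bool}
    (hx : i + w.count true = S.len x) (hy : b + w.count false = S.len y) (hj : j ≤ w.length) :
    S.left (S.tangleFrom x y i b w) (i + b + j) =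
      S.tangleFrom (S.left x (i + (w.take j).count true))
        (S.left y (b + (w.take j).count false)) i b (w.take j) := by
  induction w generalizing y i b j with
  | nil =>
    obtain rfl : j = 0 := Nat.le_zero.1 hj
    simp only [List.count_nil, add_zero] at hx hy
    simp only [List.take_nil, List.count_nil, add_zero, tangleFrom]
    rw [S.left_left _ _ _ le_rfl hy.le, S.left_ins_mid _ _ _ _ hx.le
      (show b ≤ S.len _ by rw [S.len_left hy.le]), S.left_left _ _ _ le_rfl hy.le]
  | cons a w ih =>
    rcases j with _ | j
    · have hb : b ≤ S.len y := by omega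
      rw [add_zero, left_tangleFrom_mid hx hy le_rfl]
      simp only [List.take_zero, List.count_nil, add_zero, tangleFrom]
      rw [S.left_left _ _ _ le_rfl hb]
    · have hj' : j ≤ w.length := by simpa using hj
      have h1 := List.count_append (a := true) (l₁ := w.take j) (l₂ := w.drop j)
      have h2 := List.count_append (a := false) (l₁ := w.take j) (l₂ := w.drop j)
      rw [List.take_append_drop] at h1 h2
      cases a
      · simp at hx hy
        have := ih (y := y) (i := i) (b := b + 1) hx (by omega) hj'
        simp only [List.take_succ_cons, tangleFrom, List.count_cons]
        rw [show i + b + (j + 1) = i + (b + 1) + j by omega, this]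
        simp
        congr 2
        omega
      · simp at hx hy
        have hy' : 0 + w.count false = S.len (S.right y b) := by rw [S.len_right]; omega
        have hx' : i + 1 + w.count true = S.len x := by omega
        have hl := len_tangleFrom hx' hy'
        have hb : b ≤ S.len y := by omega
        have hlb := S.len_left hb
        have := ih hx' hy' hj'
        have h3 := S.left_ins_ge (S.tangleFrom x (S.right y b) (i + 1) 0 w) i (1 + j) (S.left y b)
          (show _ ≤ S.len _ by rw [hl, S.len_right]; have := w.count_true_add_count_false; omega)
        rw [show (S.word (S.left y b)).length = b from hlb] at h3
        simp only [List.take_succ_cons, tangleFrom, List.count_cons]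
        rw [show i + b + (j + 1) = i + b + (1 + j) by omega, h3,
          show i + (1 + j) = i + 1 + 0 + j by omega, this]
        simp
        rw [S.left_left _ _ _ (by omega) (show _ ≤ S.len _ by omega),
          S.right_left _ _ _ (show _ ≤ S.len _ by omega), add_right_comm, add_assoc i]

/-- The right part at a gap `i` of `x` that lies before the pending block. -/
theorem right_tangleFrom_le {x y : P} {i k b : ℕ} {w : List Bool}
    (hx : i + k + w.count true = S.len x) (hy : b + w.count false = S.len y) :
    S.right (S.tangleFrom x y (i + k) b w) i = S.tangleFrom (S.right x i) y k b w := by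
  induction w generalizing y k b with
  | nil =>
    simp only [List.count_nil, add_zero] at hx hy
    exact S.right_ins_le _ _ _ _ hx.le
  | cons a w ih =>
    cases a
    · simp at hx hy
      exact ih hx (by omega)
    · simp at hx hy
      have hy' : 0 + w.count false = S.len (S.right y b) := by rw [S.len_right]; omega
      have hx' : i + (k + 1) + w.count true = S.len x := by omega
      have hl := len_tangleFrom hx' hy'
      rw [tangleFrom, tangleFrom, add_assoc, S.right_ins_le _ _ _ _ (show i + k ≤ S.len _ by omega),
        ih hx' hy']

/-- The right part at a gap within the pending block. -/
theorem right_tangleFrom_mid {x y : P} {i c d : ℕ} {w : List Bool}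
    (hx : i + w.count true = S.len x) (hy : c + d + w.count false = S.len y) :
    S.right (S.tangleFrom x y i (c + d) w) (i + c) =
      S.tangleFrom (S.right x i) (S.right y c) 0 d w := by
  induction w generalizing y i d with
  | nil =>
    simp only [List.count_nil, add_zero] at hx hy
    rw [tangleFrom, tangleFrom, S.right_ins_mid _ _ _ _ hx.le
      (show c ≤ S.len _ by rw [S.len_left hy.le]; omega), S.right_left _ _ _ hy.le]
  | cons a w ih =>
    cases a
    · simp at hx hy
      exact ih (y := y) (d := d + 1) hx (by omega)
    · simp at hx hy
      have hy' : 0 + w.count false = S.len (S.right y (c + d)) := by rw [S.len_right]; omega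
      have hx' : i + 1 + w.count true = S.len x := by omega
      have hl := len_tangleFrom hx' hy'
      have hb : c + d ≤ S.len y := by omega
      rw [tangleFrom, tangleFrom, S.right_ins_mid _ _ _ _ (show i ≤ S.len _ by omega)
        (show c ≤ S.len _ by rw [S.len_left hb]; omega), S.right_left _ _ _ hb,
        right_tangleFrom_le hx' hy', S.right_right _ _ _ hb, zero_add]

/-- The right part of a tangled object, with the gap after the first `j` letters. -/
theorem right_tangleFrom {x y : P} {i b j : ℕ} {w : List Bool}
    (hx : i + w.count true = S.len x) (hy : b + w.count false = S.len y) (hj : j ≤ w.length) :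
    S.right (S.tangleFrom x y i b w) (i + b + j) =
      S.tangle (S.right x (i + (w.take j).count true))
        (S.right y (b + (w.take j).count false)) (w.drop j) := by
  induction w generalizing y i b j with
  | nil =>
    obtain rfl : j = 0 := Nat.le_zero.1 hj
    exact right_tangleFrom_mid (d := 0) hx hy
  | cons a w ih =>
    rcases j with _ | j
    · exact right_tangleFrom_mid (d := 0) hx hy
    · have hj' : j ≤ w.length := by simpa using hj
      have h1 := List.count_append (a := true) (l₁ := w.take j) (l₂ := w.drop j)
      have h2 := List.count_append (a := false) (l₁ := w.take j) (l₂ := w.drop j)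
      rw [List.take_append_drop] at h1 h2
      cases a
      · simp at hx hy
        have := ih (y := y) (i := i) (b := b + 1) hx (by omega) hj'
        simp only [List.take_succ_cons, tangleFrom, List.count_cons]
        rw [show i + b + (j + 1) = i + (b + 1) + j by omega, this]
        simp
        congr 2
        omega
      · simp at hx hy
        have hy' : 0 + w.count false = S.len (S.right y b) := by rw [S.len_right]; omega
        have hx' : i + 1 + w.count true = S.len x := by omega
        have hl := len_tangleFrom hx' hy'
        have hb : b ≤ S.len y := by omega
        have hlb := S.len_left hb
        have := ih hx' hy' hj'
        have h3 := S.right_ins_ge (S.tangleFrom x (S.right y b) (i + 1) 0 w) i (1 + j)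
          (S.left y b) (show _ ≤ S.len _ by
            rw [hl, S.len_right]; have := w.count_true_add_count_false; omega)
        rw [show (S.word (S.left y b)).length = b from hlb] at h3
        simp only [List.take_succ_cons, tangleFrom, List.count_cons]
        rw [show i + b + (j + 1) = i + b + (1 + j) by omega, h3,
          show i + (1 + j) = i + 1 + 0 + j by omega, this]
        simp
        rw [S.right_right _ _ _ (show _ ≤ S.len _ by omega), add_right_comm, add_assoc i]

theorem left_tangle {x y : P} {j : ℕ} {w : List Bool} (hx : w.count true = S.len x)
    (hy : w.count false = S.len y) (hj : j ≤ w.length) :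
    S.left (S.tangle x y w) j = S.tangle (S.left x ((w.take j).count true))
        (S.left y ((w.take j).count false)) (w.take j) := by
  have := left_tangleFrom (S := S) (i := 0) (b := 0) (by rwa [zero_add]) (by rwa [zero_add]) hj
  simp only [zero_add] at this
  exact this

theorem right_tangle {x y : P} {j : ℕ} {w : List Bool} (hx : w.count true = S.len x)
    (hy : w.count false = S.len y) (hj : j ≤ w.length) :
    S.right (S.tangle x y w) j = S.tangle (S.right x ((w.take j).count true))
        (S.right y ((w.take j).count false)) (w.drop j) := by
  have := right_tangleFrom (S := S) (i := 0) (b := 0) (by rwa [zero_add]) (by rwa [zero_add]) hj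
  simp only [zero_add] at this
  exact this

theorem len_tangle {x y : P} {w : List Bool} (hx : w.count true = S.len x)
    (hy : w.count false = S.len y) : S.len (S.tangle x y w) = S.len x + S.len y :=
  len_tangleFrom (by rwa [zero_add]) (by rwa [zero_add])

end CutSystem

/-! ### Tangling with an inserted object -/

namespace CutSystem

variable {P α : Type*} {S : CutSystem P α}

/-- An object inserted in `f` before the gap from which `f` is tangled may be inserted at the
end. -/
theorem tangleFrom_ins_parallel {f a z : P} {i k b : ℕ} {t : List Bool} (hik : i < k)
    (hf : k + t.count true = S.len f) (hz : b + t.count false = S.len z) :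
    S.tangleFrom (S.ins f i a) z (k + S.len a) b t = S.ins (S.tangleFrom f z k b t) i a := by
  induction t generalizing z k b with
  | nil =>
    simp only [List.count_nil, add_zero] at hf hz
    exact S.ins_ins_parallel _ _ _ _ _ hik hf.le
  | cons l t ih =>
    cases l
    · simp at hf hz
      exact ih (z := z) (b := b + 1) hik hf (by omega)
    · simp at hf hz
      have hz' : 0 + t.count false = S.len (S.right z b) := by rw [S.len_right]; omega
      have hf' : k + 1 + t.count true = S.len f := by omega
      have hl := len_tangleFrom hf' hz'
      rw [tangleFrom, tangleFrom, add_right_comm, ih (by omega) hf' hz']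
      exact S.ins_ins_parallel _ _ _ _ _ hik (show k ≤ S.len _ by omega)

/-- Tangling with an object obtained by insertion, where the word `u` describes what happens
within the inserted object `a`. -/
theorem tangleFrom_ins_nested {f a z : P} {i k c : ℕ} {u t : List Bool}
    (ha : k + u.count true = S.len a) (hf : i + 1 + t.count true = S.len f)
    (hz : c + u.count false + t.count false = S.len z) :
    S.tangleFrom (S.ins f i a) z (i + k) c (u ++ true :: t) =
      S.ins (S.tangleFrom f (S.right z (c + u.count false)) (i + 1) 0 t) i
        (S.tangleFrom a (S.left z (c + u.count false)) k c u) := by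
  induction u generalizing z k c with
  | nil =>
    simp only [List.count_nil, add_zero] at ha hz
    have hz' : 0 + t.count false = S.len (S.right z c) := by rw [S.len_right]; omega
    have hl := len_tangleFrom hf hz'
    simp only [List.nil_append, tangleFrom, List.count_nil, add_zero]
    rw [ha, add_right_comm, tangleFrom_ins_parallel (show i < i + 1 by omega) hf hz',
      S.left_left _ _ _ le_rfl (show c ≤ S.len _ by omega)]
    exact S.ins_ins_nested _ _ _ _ _ (show i ≤ S.len _ by omega) (le_refl (S.len a))
  | cons l u ih =>
    cases l
    · simp at ha hz
      have := ih (z := z) (k := k) (c := c + 1) ha (by omega)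
      rw [add_right_comm c 1, add_assoc] at this
      simpa [tangleFrom] using this
    · simp at ha hz
      have := ih (z := S.right z c) (k := k + 1) (c := 0) (by omega) (by rw [S.len_right]; omega)
      rw [zero_add, S.right_right _ _ _ (show _ ≤ S.len _ by omega), ← add_assoc] at this
      have hc : c + u.count false ≤ S.len z := by omega
      have hz' : 0 + u.count false = S.len (S.left (S.right z c) (u.count false)) := by
        rw [S.len_left (by rw [S.len_right]; omega)]
        omega
      have ha' : k + 1 + u.count true = S.len a := by omega
      have hl := len_tangleFrom ha' hz'
      have hz'' : 0 + t.count false = S.len (S.right z (c + u.count false)) := by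
        rw [S.len_right]
        omega
      have hl' := len_tangleFrom hf hz''
      simp only [List.cons_append, tangleFrom, List.count_cons]
      simp only [beq_iff_eq, reduceCtorEq, if_false, add_zero]
      rw [this, S.right_left _ _ _ hc, S.left_left _ _ _ (Nat.le_add_right _ _) hc]
      exact S.ins_ins_nested _ _ _ _ _ (show i ≤ S.len _ by omega) (show k ≤ S.len _ by omega)

/-- The case of an insertion at the last gap, where the word ends within the inserted object. -/
theorem tangleFrom_ins_last {f a z : P} {i k c : ℕ} {u : List Bool}
    (ha : k + u.count true = S.len a) (hf : i = S.len f) (hz : c + u.count false = S.len z) :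
    S.tangleFrom (S.ins f i a) z (i + k) c u = S.ins f i (S.tangleFrom a z k c u) := by
  induction u generalizing z k c with
  | nil =>
    simp only [List.count_nil, add_zero] at ha hz
    exact S.ins_ins_nested _ _ _ _ _ hf.le ha.le
  | cons l u ih =>
    cases l
    · simp at ha hz
      exact ih (z := z) (c := c + 1) ha (by omega)
    · simp at ha hz
      have hz' : 0 + u.count false = S.len (S.right z c) := by rw [S.len_right]; omega
      have ha' : k + 1 + u.count true = S.len a := by omega
      have hl := len_tangleFrom ha' hz'
      rw [tangleFrom, tangleFrom, add_assoc, ih ha' hz']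
      exact S.ins_ins_nested _ _ _ _ _ hf.le (show k ≤ S.len _ by omega)

theorem tangleFrom_replicate_append (x y : P) (i b n : ℕ) (w : List Bool) :
    S.tangleFrom x y i b (List.replicate n false ++ w) = S.tangleFrom x y i (b + n) w := by
  induction n generalizing b with
  | zero => rfl
  | succ n ih =>
    rw [List.replicate_succ, List.cons_append, tangleFrom, ih]
    congr 1
    omega

end CutSystem

/-! ### Words in two and three letters -/

/-- The words with `a` letters `true` and `b` letters `false`. -/
def twoWords (a b : ℕ) : Finset (List Bool) :=
  (List.replicate a true ++ List.replicate b false).permutations.toFinset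

theorem mem_twoWords {a b : ℕ} {w : List Bool} :
    w ∈ twoWords a b ↔ w.count true = a ∧ w.count false = b := by
  rw [twoWords, List.mem_toFinset, List.mem_permutations, List.perm_iff_count]
  simp [List.count_append, List.count_replicate]
  tauto

/-- Words in three letters: `none` for the first factor, `some true` for the second factor and
`some false` for the third factor. -/
def threeWords (a b c : ℕ) : Finset (List (Option Bool)) :=
  (List.replicate a none ++ (List.replicate b (some true) ++
    List.replicate c (some false))).permutations.toFinset

theorem mem_threeWords {a b c : ℕ} {w : List (Option Bool)} :
    w ∈ threeWords a b c ↔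
      w.count none = a ∧ w.count (some true) = b ∧ w.count (some false) = c := by
  rw [threeWords, List.mem_toFinset, List.mem_permutations, List.perm_iff_count]
  simp [Option.forall, List.count_append, List.count_replicate]
  tauto

namespace ThreeWord

/-- The word in the first two factors. -/
def fst : List (Option Bool) → List Bool
  | [] => []
  | none :: w => true :: fst w
  | some true :: w => false :: fst w
  | some false :: w => fst w

/-- The word in the last two factors. -/
def snd : List (Option Bool) → List Bool
  | [] => []
  | none :: w => snd w
  | some b :: w => b :: snd w

/-- The word obtained by identifying the first two factors. -/
def fstOut (w : List (Option Bool)) : List Bool := w.map fun l => l.getD true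

/-- The word obtained by identifying the last two factors. -/
def sndOut (w : List (Option Bool)) : List Bool := w.map Option.isNone

theorem count_fst (w : List (Option Bool)) :
    (fst w).count true = w.count none ∧ (fst w).count false = w.count (some true) := by
  induction w with
  | nil => simp [fst]
  | cons l w ih => rcases l with _ | _ | _ <;> simp [fst, ih]

theorem count_snd (w : List (Option Bool)) :
    (snd w).count true = w.count (some true) ∧ (snd w).count false = w.count (some false) := by
  induction w with
  | nil => simp [snd]
  | cons l w ih => rcases l with _ | _ | _ <;> simp [snd, ih]

theorem count_fstOut (w : List (Option Bool)) :
    (fstOut w).count true = w.count none + w.count (some true) ∧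
      (fstOut w).count false = w.count (some false) := by
  unfold fstOut
  induction w with
  | nil => simp
  | cons l w ih =>
    rcases l with _ | _ | _ <;> simp [ih] <;> omega

theorem count_sndOut (w : List (Option Bool)) :
    (sndOut w).count true = w.count none ∧
      (sndOut w).count false = w.count (some true) + w.count (some false) := by
  unfold sndOut
  induction w with
  | nil => simp
  | cons l w ih => rcases l with _ | _ | _ <;> simp [ih] <;> omega

/-- The three-letter word with given `fst` and `fstOut`. -/
def ofFst : List Bool → List Bool → List (Option Bool)
  | s, false :: t => some false :: ofFst s t
  | true :: s, true :: t => none :: ofFst s t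
  | false :: s, true :: t => some true :: ofFst s t
  | [], true :: _ => []
  | _, [] => []

/-- The three-letter word with given `snd` and `sndOut`. -/
def ofSnd : List Bool → List Bool → List (Option Bool)
  | s, true :: t => none :: ofSnd s t
  | b :: s, false :: t => some b :: ofSnd s t
  | [], false :: _ => []
  | _, [] => []

theorem ofFst_fst (w : List (Option Bool)) : ofFst (fst w) (fstOut w) = w := by
  induction w with
  | nil => simp [fst, fstOut, ofFst]
  | cons l w ih =>
    simp only [fstOut] at ih ⊢
    rcases l with _ | _ | _ <;> simp [fst, ofFst, ih]

theorem ofSnd_snd (w : List (Option Bool)) : ofSnd (snd w) (sndOut w) = w := by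
  induction w with
  | nil => simp [snd, sndOut, ofSnd]
  | cons l w ih =>
    simp only [sndOut] at ih ⊢
    rcases l with _ | _ | _ <;> simp [snd, ofSnd, ih]

theorem fst_ofFst {s t : List Bool} (h : s.length = t.count true) :
    fst (ofFst s t) = s ∧ fstOut (ofFst s t) = t := by
  simp only [fstOut]
  induction t generalizing s with
  | nil =>
    obtain rfl := List.length_eq_zero_iff.1 h
    simp [ofFst, fst]
  | cons l t ih =>
    rcases l
    · have := ih (s := s) (by simpa using h)
      simp [ofFst, fst, this]
    · rcases s with _ | ⟨a, s⟩
      · simp at h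
      · have := ih (s := s) (by simpa using h)
        cases a <;> simp [ofFst, fst, this]

theorem snd_ofSnd {s t : List Bool} (h : s.length = t.count false) :
    snd (ofSnd s t) = s ∧ sndOut (ofSnd s t) = t := by
  simp only [sndOut]
  induction t generalizing s with
  | nil =>
    obtain rfl := List.length_eq_zero_iff.1 h
    simp [ofSnd, snd]
  | cons l t ih =>
    rcases l
    · rcases s with _ | ⟨a, s⟩
      · simp at h
      · have := ih (s := s) (by simpa using h)
        simp [ofSnd, snd, this]
    · have := ih (s := s) (by simpa using h)
      simp [ofSnd, snd, this]

/-- A pair of words for tangling the first two factors and then the third is a three-letter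
word. -/
theorem sum_fst {M : Type*} [AddCommMonoid M] (a b c : ℕ) (F : List Bool → List Bool → M) :
    ∑ s ∈ twoWords a b, ∑ t ∈ twoWords (a + b) c, F s t =
      ∑ w ∈ threeWords a b c, F (fst w) (fstOut w) := by
  rw [← Finset.sum_product']
  symm
  refine Finset.sum_nbij' (fun w => (fst w, fstOut w)) (fun p => ofFst p.1 p.2) ?_ ?_
    (fun w _ => ofFst_fst w) ?_ (fun _ _ => rfl)
  · intro w hw
    rw [mem_threeWords] at hw
    have h1 := count_fst w
    have h2 := count_fstOut w
    rw [Finset.mem_product, mem_twoWords, mem_twoWords]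
    simp only
    omega
  · rintro ⟨s, t⟩ hp
    rw [Finset.mem_product, mem_twoWords, mem_twoWords] at hp
    simp only at hp
    have hl := s.count_true_add_count_false
    obtain ⟨h1, h2⟩ := fst_ofFst (s := s) (t := t) (by omega)
    have h3 := count_fst (ofFst s t)
    have h4 := count_fstOut (ofFst s t)
    rw [h1] at h3
    rw [h2] at h4
    rw [mem_threeWords]
    dsimp only
    omega
  · rintro ⟨s, t⟩ hp
    rw [Finset.mem_product, mem_twoWords, mem_twoWords] at hp
    simp only at hp
    have hl := s.count_true_add_count_false
    obtain ⟨h1, h2⟩ := fst_ofFst (s := s) (t := t) (by omega)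
    exact Prod.ext h1 h2

/-- A pair of words for tangling the last two factors and then the first is a three-letter word. -/
theorem sum_snd {M : Type*} [AddCommMonoid M] (a b c : ℕ) (F : List Bool → List Bool → M) :
    ∑ s ∈ twoWords b c, ∑ t ∈ twoWords a (b + c), F s t =
      ∑ w ∈ threeWords a b c, F (snd w) (sndOut w) := by
  rw [← Finset.sum_product']
  symm
  refine Finset.sum_nbij' (fun w => (snd w, sndOut w)) (fun p => ofSnd p.1 p.2) ?_ ?_
    (fun w _ => ofSnd_snd w) ?_ (fun _ _ => rfl)
  · intro w hw
    rw [mem_threeWords] at hw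
    have h1 := count_snd w
    have h2 := count_sndOut w
    rw [Finset.mem_product, mem_twoWords, mem_twoWords]
    simp only
    omega
  · rintro ⟨s, t⟩ hp
    rw [Finset.mem_product, mem_twoWords, mem_twoWords] at hp
    simp only at hp
    have hl := s.count_true_add_count_false
    obtain ⟨h1, h2⟩ := snd_ofSnd (s := s) (t := t) (by omega)
    have h3 := count_snd (ofSnd s t)
    have h4 := count_sndOut (ofSnd s t)
    rw [h1] at h3
    rw [h2] at h4
    rw [mem_threeWords]
    dsimp only
    omega
  · rintro ⟨s, t⟩ hp
    rw [Finset.mem_product, mem_twoWords, mem_twoWords] at hp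
    simp only at hp
    have hl := s.count_true_add_count_false
    obtain ⟨h1, h2⟩ := snd_ofSnd (s := s) (t := t) (by omega)
    exact Prod.ext h1 h2

/-- The letters before the first atom of the first factor. -/
theorem exists_eq_append (w : List (Option Bool)) :
    (∃ u : List Bool, w = u.map some) ∨
      ∃ (u : List Bool) (v : List (Option Bool)), w = u.map some ++ none :: v := by
  induction w with
  | nil => exact Or.inl ⟨[], rfl⟩
  | cons l w ih =>
    rcases l with _ | l
    · exact Or.inr ⟨[], w, rfl⟩
    · rcases ih with ⟨u, rfl⟩ | ⟨u, v, rfl⟩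
      · exact Or.inl ⟨l :: u, rfl⟩
      · exact Or.inr ⟨l :: u, v, rfl⟩

theorem fst_map_some_append (u : List Bool) (v : List (Option Bool)) :
    fst (u.map some ++ v) = List.replicate (u.count true) false ++ fst v := by
  induction u with
  | nil => rfl
  | cons l u ih => cases l <;> simp [fst, ih, List.replicate_succ]

theorem snd_map_some_append (u : List Bool) (v : List (Option Bool)) :
    snd (u.map some ++ v) = u ++ snd v := by
  induction u with
  | nil => rfl
  | cons l u ih => simp [snd, ih]

end ThreeWord

/-- Splitting a word at any position gives a pair of words, and each pair of words with the right
total numbers of letters arises once. -/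
theorem sum_twoWords_split {M : Type*} [AddCommMonoid M] (a b : ℕ)
    (F : List Bool → List Bool → M) :
    ∑ w ∈ twoWords a b, ∑ j ∈ Finset.range (a + b + 1), F (w.take j) (w.drop j) =
      ∑ i ∈ Finset.range (a + 1), ∑ j ∈ Finset.range (b + 1),
        ∑ u ∈ twoWords i j, ∑ v ∈ twoWords (a - i) (b - j), F u v := by
  have h : ∀ i j, ∑ u ∈ twoWords i j, ∑ v ∈ twoWords (a - i) (b - j), F u v =
      ∑ p ∈ twoWords i j ×ˢ twoWords (a - i) (b - j), F p.1 p.2 := fun i j => by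
    rw [← Finset.sum_product']
  simp only [h]
  rw [← Finset.sum_product', ← Finset.sum_product', Finset.sum_sigma']
  refine Finset.sum_nbij'
    (fun p => ⟨((p.1.take p.2).count true, (p.1.take p.2).count false),
      (p.1.take p.2, p.1.drop p.2)⟩)
    (fun q => (q.2.1 ++ q.2.2, q.2.1.length)) ?_ ?_ ?_ ?_ ?_
  · rintro ⟨w, j⟩ hp
    simp only [Finset.mem_product, mem_twoWords, Finset.mem_range, Finset.mem_sigma] at hp ⊢
    have h1 := List.count_append (a := true) (l₁ := w.take j) (l₂ := w.drop j)
    have h2 := List.count_append (a := false) (l₁ := w.take j) (l₂ := w.drop j)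
    rw [List.take_append_drop] at h1 h2
    obtain ⟨⟨rfl, rfl⟩, hj⟩ := hp
    refine ⟨⟨by omega, by omega⟩, ⟨trivial, trivial⟩, by omega, by omega⟩
  · rintro ⟨⟨i, j⟩, ⟨u, v⟩⟩ hq
    simp only [Finset.mem_product, mem_twoWords, Finset.mem_range, Finset.mem_sigma,
      List.count_append] at hq ⊢
    have := u.count_true_add_count_false
    omega
  · rintro ⟨w, j⟩ hp
    simp only [Finset.mem_product, mem_twoWords, Finset.mem_range] at hp
    have := w.count_true_add_count_false
    simp only [List.take_append_drop, List.length_take, Prod.mk.injEq, true_and]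
    omega
  · rintro ⟨⟨i, j⟩, ⟨u, v⟩⟩ hq
    simp only [Finset.mem_product, mem_twoWords, Finset.mem_range, Finset.mem_sigma] at hq
    obtain ⟨-, ⟨rfl, rfl⟩, -⟩ := hq
    simp
  · rintro ⟨w, j⟩ _
    rfl

/-! ### Associativity of tangling -/

namespace CutSystem

variable {P α : Type*} {S : CutSystem P α}

open ThreeWord

/-- The letters before the first atom of `x` describe how parts of `y` and `z` are tangled and then
inserted at the gap `i` of `x`, and the remaining letters give an induction on the length. -/
theorem tangleFrom_assoc (w : List (Option Bool)) {x y z : P} {i : ℕ}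
    (hx : i + w.count none = S.len x) (hy : w.count (some true) = S.len y)
    (hz : w.count (some false) = S.len z) :
    S.tangleFrom (S.tangleFrom x y i 0 (fst w)) z i 0 (fstOut w) =
      S.tangleFrom x (S.tangle y z (snd w)) i 0 (sndOut w) := by
  have hct : ∀ (u : List Bool) (b : Bool), (u.map some).count (some b) = u.count b :=
    fun u b => List.count_map_of_injective _ _ (Option.some_injective _) _
  have hcn : ∀ u : List Bool, (u.map some).count none = 0 := fun u =>
    List.count_eq_zero.2 (by simp)
  have hout : ∀ u : List Bool, fstOut (u.map some) = u ∧
      sndOut (u.map some) = List.replicate u.length false := fun u => by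
    simp only [fstOut, sndOut, List.map_map]
    constructor
    · exact (List.map_congr_left fun _ _ => rfl).trans (List.map_id u)
    · exact List.map_const'
  induction hn : w.length using Nat.strong_induction_on generalizing w x y z i with
  | _ n ih =>
    rcases exists_eq_append w with ⟨u, rfl⟩ | ⟨u, v, rfl⟩
    · rw [hct] at hy hz
      rw [hcn, add_zero] at hx
      have h1 := fst_map_some_append u []
      have h2 := snd_map_some_append u []
      rw [List.append_nil] at h1 h2
      rw [h1, h2, (hout u).1, (hout u).2, tangleFrom_replicate_append]
      have h3 := tangleFrom_replicate_append (S := S) x (S.tangle y z (u ++ snd [])) i 0 u.length []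
      rw [List.append_nil] at h3
      rw [h3]
      have hl := len_tangle hy hz
      have hu := u.count_true_add_count_false
      simp only [fst, snd, tangleFrom, zero_add, List.append_nil]
      rw [hy, show u.length = S.len (S.tangle y z u) by omega, len, S.left_length, len,
        S.left_length]
      exact tangleFrom_ins_last (k := 0) (c := 0) (by rwa [zero_add]) hx (by rwa [zero_add])
    · rw [List.count_append, hct, List.count_cons] at hy hz
      rw [List.count_append, hcn, List.count_cons] at hx
      simp at hx hy hz hn
      have h1 := fst_map_some_append u (none :: v)
      have h2 := snd_map_some_append u (none :: v)
      have h3 : fstOut (u.map some ++ none :: v) = u ++ true :: fstOut v := by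
        have := (hout u).1
        unfold fstOut at this ⊢
        rw [List.map_append, this]
        rfl
      have h4 : sndOut (u.map some ++ none :: v) =
          List.replicate u.length false ++ true :: sndOut v := by
        have := (hout u).2
        unfold sndOut at this ⊢
        rw [List.map_append, this]
        rfl
      rw [h1, h2, h3, h4, tangleFrom_replicate_append, tangleFrom_replicate_append]
      simp only [fst, snd, tangleFrom, zero_add]
      have hu := u.count_true_add_count_false
      have c1 := count_fst v
      have c2 := count_snd v
      have c3 := count_fstOut v
      have c4 := count_sndOut v
      have e1 : (u ++ snd v).count true = S.len y := by rw [List.count_append]; omega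
      have e2 : (u ++ snd v).count false = S.len z := by rw [List.count_append]; omega
      have e3 : u.length ≤ (u ++ snd v).length := by simp
      rw [left_tangle e1 e2 e3, right_tangle e1 e2 e3]
      simp only [List.take_left, List.drop_left]
      rw [← ih v.length (by omega) v (i := i + 1) (by omega) (by rw [S.len_right]; omega)
        (by rw [S.len_right]; omega) rfl]
      have f1 : i + 1 + (fst v).count true = S.len x := by omega
      have f2 : 0 + (fst v).count false = S.len (S.right y (u.count true)) := by
        rw [S.len_right]; omega
      have hl := len_tangleFrom f1 f2
      have := tangleFrom_ins_nested (S := S)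
        (f := S.tangleFrom x (S.right y (u.count true)) (i + 1) 0 (fst v))
        (a := S.left y (u.count true)) (z := z) (i := i) (k := 0) (c := 0) (u := u)
        (t := fstOut v) (by rw [S.len_left (by omega)]; omega)
        (by rw [hl, S.len_right]; omega) (by omega)
      rw [zero_add, add_zero] at this
      exact this

theorem tangle_assoc (w : List (Option Bool)) {x y z : P}
    (hx : w.count none = S.len x) (hy : w.count (some true) = S.len y)
    (hz : w.count (some false) = S.len z) :
    S.tangle (S.tangle x y (fst w)) z (fstOut w) = S.tangle x (S.tangle y z (snd w)) (sndOut w) :=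
  tangleFrom_assoc w (by rwa [zero_add]) hy hz

theorem tangle_one {x : P} : S.tangle x S.one (List.replicate (S.len x) true) = x := by
  have key : ∀ n i, i + n = S.len x →
      S.tangleFrom x S.one i 0 (List.replicate n true) = x := by
    intro n
    induction n with
    | zero =>
      intro i hi
      rw [List.replicate_zero, tangleFrom, left_zero, S.ins_one _ _ (show i ≤ S.len x by omega)]
    | succ n ih =>
      intro i hi
      rw [List.replicate_succ, tangleFrom, left_zero, S.right_zero, ih (i + 1) (by omega),
        S.ins_one _ _ (show i ≤ S.len x by omega)]
  exact key _ 0 (Nat.zero_add _)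

theorem one_tangle {x : P} : S.tangle S.one x (List.replicate (S.len x) false) = x := by
  have := tangleFrom_replicate_append (S := S) S.one x 0 0 (S.len x) []
  rw [List.append_nil, zero_add, tangleFrom, len, S.left_length, S.one_ins] at this
  exact this

end CutSystem

/-! ### The bialgebra of a cut system -/

theorem Finsupp.induction_single_one {P k : Type*} [Semiring k] {p : (P →₀ k) → Prop} (x : P →₀ k)
    (zero : p 0) (add : ∀ x y, p x → p y → p (x + y)) (smul : ∀ (c : k) x, p x → p (c • x))
    (single : ∀ a, p (Finsupp.single a 1)) : p x := by
  induction x using Finsupp.induction_linear with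
  | zero => exact zero
  | add f g hf hg => exact add f g hf hg
  | single a c =>
    rw [← Finsupp.smul_single_one]
    exact smul c _ (single a)

theorem Finsupp.hom_ext_single_one {P k M : Type*} [Semiring k] [AddCommMonoid M] [Module k M]
    {f g : (P →₀ k) →ₗ[k] M} (h : ∀ a, f (Finsupp.single a 1) = g (Finsupp.single a 1)) :
    f = g :=
  Finsupp.lhom_ext' fun a => LinearMap.ext_ring (h a)

theorem twoWords_zero_left (b : ℕ) : twoWords 0 b = {List.replicate b false} := by
  ext w
  rw [mem_twoWords, Finset.mem_singleton]
  constructor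
  · rintro ⟨h1, h2⟩
    have := w.count_true_add_count_false
    rw [List.eq_replicate_iff]
    refine ⟨by omega, fun c hc => ?_⟩
    cases c
    · rfl
    · exact absurd hc (List.count_eq_zero.1 h1)
  · rintro rfl
    simp [List.count_replicate]

theorem twoWords_zero_right (a : ℕ) : twoWords a 0 = {List.replicate a true} := by
  ext w
  rw [mem_twoWords, Finset.mem_singleton]
  constructor
  · rintro ⟨h1, h2⟩
    have := w.count_true_add_count_false
    rw [List.eq_replicate_iff]
    refine ⟨by omega, fun c hc => ?_⟩
    cases c
    · exact absurd hc (List.count_eq_zero.1 h2)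
    · rfl
  · rintro rfl
    simp [List.count_replicate]

namespace CutSystem

section Sums

variable {P α : Type*} {S : CutSystem P α}

/-- Cutting an object into three parts, from the left or from the right. -/
theorem sum_left_left {M : Type*} [AddCommMonoid M] (x : P) (F : P → P → P → M) :
    ∑ j ∈ Finset.range (S.len x + 1), ∑ i ∈ Finset.range (S.len (S.left x j) + 1),
        F (S.left (S.left x j) i) (S.right (S.left x j) i) (S.right x j) =
      ∑ i ∈ Finset.range (S.len x + 1), ∑ d ∈ Finset.range (S.len (S.right x i) + 1),
        F (S.left x i) (S.left (S.right x i) d) (S.right (S.right x i) d) := by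
  trans ∑ j ∈ Finset.range (S.len x + 1), ∑ i ∈ Finset.range (j + 1),
    F (S.left x i) (S.left (S.right x i) (j - i)) (S.right x (i + (j - i)))
  · refine Finset.sum_congr rfl fun j hj => ?_
    have hj' : j ≤ S.len x := Nat.lt_succ_iff.1 (Finset.mem_range.1 hj)
    rw [S.len_left hj']
    refine Finset.sum_congr rfl fun i hi => ?_
    have hi' : i ≤ j := Nat.lt_succ_iff.1 (Finset.mem_range.1 hi)
    obtain ⟨d, rfl⟩ := Nat.exists_eq_add_of_le hi'
    rw [S.left_left _ _ _ hi' hj', S.right_left _ _ _ hj', Nat.add_sub_cancel_left]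
  · rw [Finset.sum_range_diag_flip (S.len x + 1)
      fun i d => F (S.left x i) (S.left (S.right x i) d) (S.right x (i + d))]
    refine Finset.sum_congr rfl fun i hi => ?_
    have hi' : i ≤ S.len x := Nat.lt_succ_iff.1 (Finset.mem_range.1 hi)
    rw [S.len_right, Nat.sub_add_comm hi']
    refine Finset.sum_congr rfl fun d hd => ?_
    have := Finset.mem_range.1 hd
    rw [S.right_right _ _ _ (show _ ≤ S.len x by omega)]

theorem left_eq_one_iff {x : P} {i : ℕ} (hi : i ≤ S.len x) : S.left x i = S.one ↔ i = 0 := by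
  constructor
  · intro h
    rw [← S.len_left hi, h, len_one]
  · rintro rfl
    exact S.left_zero x

theorem right_eq_one_iff {x : P} {i : ℕ} (hi : i ≤ S.len x) :
    S.right x i = S.one ↔ i = S.len x := by
  constructor
  · intro h
    have := S.len_right x i
    rw [h, len_one] at this
    omega
  · rintro rfl
    exact S.right_len x

end Sums

section Hopf

variable {P α : Type} (S : CutSystem P α) [DecidableEq P] (k : Type u) [Field k]

/-- The product is the sum of the tanglings along all words, and the coproduct is the sum of the
cuts at all gaps. -/
noncomputable def hopfData : HopfData k (P →₀ k) where
  mul := Finsupp.lift ((P →₀ k) →ₗ[k] (P →₀ k)) k P fun x =>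
    Finsupp.lift (P →₀ k) k P fun y =>
      ∑ w ∈ twoWords (S.len x) (S.len y), Finsupp.single (S.tangle x y w) 1
  one := Finsupp.single S.one 1
  comul := Finsupp.lift ((P →₀ k) ⊗[k] (P →₀ k)) k P fun x =>
    ∑ i ∈ Finset.range (S.len x + 1),
      Finsupp.single (S.left x i) 1 ⊗ₜ[k] Finsupp.single (S.right x i) 1
  counit := Finsupp.lift k k P fun x => if x = S.one then 1 else 0

theorem mul_single (x y : P) : (S.hopfData k).mul (Finsupp.single x 1) (Finsupp.single y 1) =
    ∑ w ∈ twoWords (S.len x) (S.len y), Finsupp.single (S.tangle x y w) 1 := by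
  simp [hopfData]

theorem comul_single (x : P) : (S.hopfData k).comul (Finsupp.single x 1) =
    ∑ i ∈ Finset.range (S.len x + 1),
      Finsupp.single (S.left x i) 1 ⊗ₜ[k] Finsupp.single (S.right x i) 1 := by
  simp [hopfData]

theorem counit_single (x : P) :
    (S.hopfData k).counit (Finsupp.single x 1) = if x = S.one then 1 else 0 := by
  simp only [hopfData, Finsupp.lift_apply, zero_smul, Finsupp.sum_single_index, one_smul]

theorem one_def : (S.hopfData k).one = Finsupp.single S.one 1 := rfl

variable {S k}

/-- Both sides are the sum over the three-letter words. -/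
theorem mul_assoc (x y z : P →₀ k) : (S.hopfData k).mul ((S.hopfData k).mul x y) z =
    (S.hopfData k).mul x ((S.hopfData k).mul y z) := by
  induction x using Finsupp.induction_single_one with
  | zero => simp
  | add x x' h h' => simp only [map_add, LinearMap.add_apply, h, h']
  | smul c x h => simp only [map_smul, LinearMap.smul_apply, h]
  | single x =>
  induction y using Finsupp.induction_single_one with
  | zero => simp
  | add x x' h h' => simp only [map_add, LinearMap.add_apply, h, h']
  | smul c x h => simp only [map_smul, LinearMap.smul_apply, h]
  | single y =>
  induction z using Finsupp.induction_single_one with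
  | zero => simp
  | add x x' h h' => simp only [map_add, h, h']
  | smul c x h => simp only [map_smul, h]
  | single z =>
  simp only [mul_single, map_sum, LinearMap.sum_apply]
  trans ∑ s ∈ twoWords (S.len x) (S.len y), ∑ t ∈ twoWords (S.len x + S.len y) (S.len z),
    Finsupp.single (S.tangle (S.tangle x y s) z t) 1
  · refine Finset.sum_congr rfl fun s hs => ?_
    rw [mem_twoWords] at hs
    rw [len_tangle hs.1 hs.2]
  trans ∑ s ∈ twoWords (S.len y) (S.len z), ∑ t ∈ twoWords (S.len x) (S.len y + S.len z),
    Finsupp.single (S.tangle x (S.tangle y z s) t) 1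
  · rw [ThreeWord.sum_fst _ _ _ fun s t => Finsupp.single (S.tangle (S.tangle x y s) z t) 1,
      ThreeWord.sum_snd _ _ _ fun s t => Finsupp.single (S.tangle x (S.tangle y z s) t) 1]
    refine Finset.sum_congr rfl fun w hw => ?_
    rw [mem_threeWords] at hw
    rw [tangle_assoc w hw.1 hw.2.1 hw.2.2]
  · refine Finset.sum_congr rfl fun s hs => ?_
    rw [mem_twoWords] at hs
    rw [len_tangle hs.1 hs.2]

theorem one_mul (x : P →₀ k) : (S.hopfData k).mul (S.hopfData k).one x = x := by
  induction x using Finsupp.induction_single_one with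
  | zero => simp
  | add x x' h h' => simp only [map_add, h, h']
  | smul c x h => simp only [map_smul, h]
  | single x => rw [one_def, mul_single, len_one, twoWords_zero_left, Finset.sum_singleton,
      one_tangle]

theorem mul_one (x : P →₀ k) : (S.hopfData k).mul x (S.hopfData k).one = x := by
  induction x using Finsupp.induction_single_one with
  | zero => simp
  | add x x' h h' => simp only [map_add, LinearMap.add_apply, h, h']
  | smul c x h => simp only [map_smul, LinearMap.smul_apply, h]
  | single x => rw [one_def, mul_single, len_one, twoWords_zero_right, Finset.sum_singleton,
      tangle_one]

theorem coassoc : TensorProduct.assoc k (P →₀ k) (P →₀ k) (P →₀ k) ∘ₗ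
      (S.hopfData k).comul.rTensor (P →₀ k) ∘ₗ (S.hopfData k).comul =
    (S.hopfData k).comul.lTensor (P →₀ k) ∘ₗ (S.hopfData k).comul := by
  refine Finsupp.hom_ext_single_one fun x => ?_
  simp only [LinearMap.comp_apply, comul_single, map_sum, LinearMap.rTensor_tmul,
    LinearMap.lTensor_tmul, TensorProduct.sum_tmul, TensorProduct.tmul_sum,
    LinearEquiv.coe_coe, TensorProduct.assoc_tmul]
  exact sum_left_left x fun a b c =>
    Finsupp.single a (1 : k) ⊗ₜ[k] (Finsupp.single b (1 : k) ⊗ₜ[k] Finsupp.single c (1 : k))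

/-- Only the cut with a trivial left part contributes to a sum weighted by the counit. -/
theorem sum_counit_left {M : Type*} [AddCommMonoid M] [Module k M] (x : P) (f : P → M) :
    ∑ i ∈ Finset.range (S.len x + 1),
      (S.hopfData k).counit (Finsupp.single (S.left x i) 1) • f (S.right x i) = f x := by
  rw [Finset.sum_eq_single 0]
  · rw [left_zero, counit_single, if_pos rfl, one_smul, S.right_zero]
  · intro i hi h0
    have hi' : i ≤ S.len x := Nat.lt_succ_iff.1 (Finset.mem_range.1 hi)
    rw [counit_single, if_neg ((left_eq_one_iff hi').not.2 h0), zero_smul]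
  · simp

theorem sum_counit_right {M : Type*} [AddCommMonoid M] [Module k M] (x : P) (f : P → M) :
    ∑ i ∈ Finset.range (S.len x + 1),
      (S.hopfData k).counit (Finsupp.single (S.right x i) 1) • f (S.left x i) = f x := by
  rw [Finset.sum_eq_single (S.len x)]
  · rw [right_len, counit_single, if_pos rfl, one_smul, len, S.left_length]
  · intro i hi h0
    have hi' : i ≤ S.len x := Nat.lt_succ_iff.1 (Finset.mem_range.1 hi)
    rw [counit_single, if_neg ((right_eq_one_iff hi').not.2 h0), zero_smul]
  · simp

theorem counit_comul : (S.hopfData k).counit.rTensor (P →₀ k) ∘ₗ (S.hopfData k).comul =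
    TensorProduct.mk k k (P →₀ k) 1 := by
  refine Finsupp.hom_ext_single_one fun x => ?_
  simp only [LinearMap.comp_apply, comul_single, map_sum, LinearMap.rTensor_tmul]
  rw [← sum_counit_left (S := S) (k := k) x
    fun y => TensorProduct.mk k k (P →₀ k) 1 (Finsupp.single y 1)]
  refine Finset.sum_congr rfl fun i _ => ?_
  rw [TensorProduct.mk_apply, TensorProduct.smul_tmul', smul_eq_mul, _root_.mul_one]

theorem comul_counit : (S.hopfData k).counit.lTensor (P →₀ k) ∘ₗ (S.hopfData k).comul =
    (TensorProduct.mk k (P →₀ k) k).flip 1 := by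
  refine Finsupp.hom_ext_single_one fun x => ?_
  simp only [LinearMap.comp_apply, comul_single, map_sum, LinearMap.lTensor_tmul]
  rw [← sum_counit_right (S := S) (k := k) x
    fun y => (TensorProduct.mk k (P →₀ k) k).flip 1 (Finsupp.single y 1)]
  refine Finset.sum_congr rfl fun i _ => ?_
  rw [LinearMap.flip_apply, TensorProduct.mk_apply, ← TensorProduct.tmul_smul, smul_eq_mul,
    _root_.mul_one]

theorem counit_one : (S.hopfData k).counit (S.hopfData k).one = 1 := by
  rw [one_def, counit_single, if_pos rfl]

theorem counit_mul (x y : P →₀ k) : (S.hopfData k).counit ((S.hopfData k).mul x y) =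
    (S.hopfData k).counit x * (S.hopfData k).counit y := by
  induction x using Finsupp.induction_single_one with
  | zero => simp
  | add x x' h h' => simp only [map_add, LinearMap.add_apply, h, h', add_mul]
  | smul c x h => simp only [map_smul, LinearMap.smul_apply, h, smul_mul_assoc]
  | single x =>
  induction y using Finsupp.induction_single_one with
  | zero => simp
  | add x x' h h' => simp only [map_add, h, h', mul_add]
  | smul c x h => simp only [map_smul, h, mul_smul_comm]
  | single y =>
  by_cases hx : x = S.one
  · subst hx
    rw [← one_def, one_mul, counit_one, _root_.one_mul]
  · rw [counit_single, if_neg hx, zero_mul, mul_single, map_sum]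
    refine Finset.sum_eq_zero fun w hw => ?_
    rw [mem_twoWords] at hw
    rw [counit_single, if_neg]
    intro h
    have := len_tangle hw.1 hw.2
    rw [h, len_one] at this
    exact hx (S.eq_one (by omega))

theorem comul_one : (S.hopfData k).comul (S.hopfData k).one =
    (S.hopfData k).one ⊗ₜ[k] (S.hopfData k).one := by
  rw [one_def, comul_single, len_one, zero_add, Finset.sum_range_one, left_zero, S.right_zero]

/-- A cut of a tangled object tangles the left parts along the beginning of the word and the right
parts along its end. -/
theorem comul_mul (x y : P →₀ k) : (S.hopfData k).comul ((S.hopfData k).mul x y) =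
    TensorProduct.map₂ (S.hopfData k).mul (S.hopfData k).mul
      ((S.hopfData k).comul x) ((S.hopfData k).comul y) := by
  induction x using Finsupp.induction_single_one with
  | zero => simp
  | add x x' h h' => simp only [map_add, LinearMap.add_apply, h, h']
  | smul c x h => simp only [map_smul, LinearMap.smul_apply, h]
  | single x =>
  induction y using Finsupp.induction_single_one with
  | zero => simp
  | add x x' h h' => simp only [map_add, h, h']
  | smul c x h => simp only [map_smul, h]
  | single y =>
  have h1 : (S.hopfData k).comul ((S.hopfData k).mul (Finsupp.single x 1) (Finsupp.single y 1)) =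
      ∑ w ∈ twoWords (S.len x) (S.len y), ∑ j ∈ Finset.range (S.len x + S.len y + 1),
        Finsupp.single (S.tangle (S.left x ((w.take j).count true))
          (S.left y ((w.take j).count false)) (w.take j)) 1 ⊗ₜ[k]
        Finsupp.single (S.tangle (S.right x ((w.take j).count true))
          (S.right y ((w.take j).count false)) (w.drop j)) 1 := by
    rw [mul_single, map_sum]
    refine Finset.sum_congr rfl fun w hw => ?_
    rw [mem_twoWords] at hw
    rw [comul_single, len_tangle hw.1 hw.2]
    refine Finset.sum_congr rfl fun j hj => ?_
    have hj' := Finset.mem_range.1 hj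
    have hw' := w.count_true_add_count_false
    rw [left_tangle hw.1 hw.2 (by omega), right_tangle hw.1 hw.2 (by omega)]
  rw [h1, sum_twoWords_split _ _ fun u v =>
    Finsupp.single (S.tangle (S.left x (u.count true)) (S.left y (u.count false)) u) (1 : k) ⊗ₜ[k]
      Finsupp.single (S.tangle (S.right x (u.count true)) (S.right y (u.count false)) v) (1 : k)]
  simp only [comul_single, map_sum, LinearMap.sum_apply, TensorProduct.map₂_apply_tmul,
    TensorProduct.map_tmul]
  rw [Finset.sum_comm]
  refine Finset.sum_congr rfl fun j hj => Finset.sum_congr rfl fun i hi => ?_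
  have hi' : i ≤ S.len x := Nat.lt_succ_iff.1 (Finset.mem_range.1 hi)
  have hj' : j ≤ S.len y := Nat.lt_succ_iff.1 (Finset.mem_range.1 hj)
  rw [mul_single, mul_single, S.len_left hi', S.len_left hj', S.len_right, S.len_right,
    TensorProduct.sum_tmul]
  refine Finset.sum_congr rfl fun u hu => ?_
  rw [TensorProduct.tmul_sum]
  refine Finset.sum_congr rfl fun v _ => ?_
  rw [mem_twoWords] at hu
  rw [hu.1, hu.2]

end Hopf

end CutSystem

/-! ### Antipode and grading -/

namespace CutSystem

section Antipode

variable {P α : Type} (S : CutSystem P α) [DecidableEq P] (k : Type u) [Field k]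

/-- The left antipode, obtained by solving `∑ i, S (left x i) * right x i = 0` for its last
term. -/
noncomputable def antipodeLeft (x : P) : P →₀ k :=
  if S.len x = 0 then (S.hopfData k).one
  else -∑ i : Fin (S.len x), (S.hopfData k).mul (antipodeLeft (S.left x i))
    (Finsupp.single (S.right x i) 1)
termination_by S.len x
decreasing_by
  rw [S.len_left i.2.le]
  exact i.2

/-- The right antipode, obtained by solving `∑ i, left x i * S (right x i) = 0` for its first
term. -/
noncomputable def antipodeRight (x : P) : P →₀ k :=
  if S.len x = 0 then (S.hopfData k).one
  else -∑ i : Fin (S.len x), (S.hopfData k).mul (Finsupp.single (S.left x (i + 1)) 1)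
    (antipodeRight (S.right x (i + 1)))
termination_by S.len x
decreasing_by
  rw [S.len_right]
  have := i.2
  omega

variable {S k}

theorem sum_antipodeLeft (x : P) :
    ∑ i ∈ Finset.range (S.len x + 1), (S.hopfData k).mul (S.antipodeLeft k (S.left x i))
      (Finsupp.single (S.right x i) 1) =
    (S.hopfData k).counit (Finsupp.single x 1) • (S.hopfData k).one := by
  rw [Finset.sum_range_succ, right_len, ← one_def, mul_one, len, S.left_length, antipodeLeft]
  by_cases h : S.len x = 0
  · rw [if_pos h, show (S.word x).length = 0 from h, Finset.sum_range_zero, zero_add,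
      counit_single, if_pos (S.eq_one h), one_smul]
  · rw [if_neg h, counit_single, if_neg fun h' => h (by rw [h', len_one]), zero_smul,
      Finset.sum_range]
    exact add_neg_cancel _

theorem sum_antipodeRight (x : P) :
    ∑ i ∈ Finset.range (S.len x + 1), (S.hopfData k).mul (Finsupp.single (S.left x i) 1)
      (S.antipodeRight k (S.right x i)) =
    (S.hopfData k).counit (Finsupp.single x 1) • (S.hopfData k).one := by
  rw [Finset.sum_range_succ', left_zero, ← one_def, one_mul, S.right_zero, antipodeRight]
  by_cases h : S.len x = 0
  · rw [if_pos h, h, Finset.sum_range_zero, zero_add, counit_single, if_pos (S.eq_one h),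
      one_smul]
  · rw [if_neg h, counit_single, if_neg fun h' => h (by rw [h', len_one]), zero_smul,
      Finset.sum_range]
    exact add_neg_cancel _

/-- Both antipodes are equal, because a left inverse and a right inverse of the identity for the
convolution are. -/
theorem antipodeLeft_eq_antipodeRight (x : P) : S.antipodeLeft k x = S.antipodeRight k x := by
  have h := S.sum_left_left x fun a b c => (S.hopfData k).mul (S.antipodeLeft k a)
    ((S.hopfData k).mul (Finsupp.single b 1) (S.antipodeRight k c))
  simp only [← map_sum, sum_antipodeRight, map_smul, mul_one] at h
  rw [sum_counit_right (S := S) x (S.antipodeLeft k)] at h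
  simp only [← mul_assoc] at h
  rw [← h, ← sum_counit_left (S := S) (k := k) x (S.antipodeRight k)]
  refine Finset.sum_congr rfl fun j _ => ?_
  have := sum_antipodeLeft (S := S) (k := k) (S.left x j)
  rw [← LinearMap.sum_apply, ← map_sum, this, map_smul, LinearMap.smul_apply, one_mul]

end Antipode

section Grading

variable {P α : Type}

/-- A size that is additive under cutting and insertion, and vanishes only for the trivial
object. -/
structure IsSize (S : CutSystem P α) (size : P → ℕ) : Prop where
  left_add_right : ∀ x i, i ≤ S.len x → size (S.left x i) + size (S.right x i) = size x
  ins : ∀ x i y, i ≤ S.len x → size (S.ins x i y) = size x + size y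
  eq_zero_iff : ∀ x, size x = 0 ↔ x = S.one

variable {S : CutSystem P α} {size : P → ℕ}

theorem IsSize.tangleFrom (h : S.IsSize size) {x y : P} {i b : ℕ} {w : List Bool}
    (hx : i + w.count true = S.len x) (hy : b + w.count false = S.len y) :
    size (S.tangleFrom x y i b w) = size x + size y := by
  induction w generalizing y i b with
  | nil =>
    simp only [List.count_nil, add_zero] at hx hy
    rw [CutSystem.tangleFrom, h.ins _ _ _ hx.le, hy, len, S.left_length]
  | cons a w ih =>
    cases a
    · simp at hx hy
      exact ih hx (by omega)
    · simp at hx hy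
      have hx' : i + 1 + w.count true = S.len x := by omega
      have hy' : 0 + w.count false = S.len (S.right y b) := by rw [S.len_right]; omega
      have hl := len_tangleFrom hx' hy'
      have h1 := h.left_add_right y b (by omega)
      rw [CutSystem.tangleFrom, h.ins _ _ _ (by omega), ih hx' hy']
      omega

variable [DecidableEq P] (k : Type u) [Field k] (size)

/-- The span of the objects of size `n`. -/
noncomputable def grading (n : ℕ) : Submodule k (P →₀ k) :=
  Submodule.span k ((fun x => Finsupp.single x 1) '' {x | size x = n})

variable {k size}

omit [DecidableEq P] in
theorem single_mem_grading (x : P) : Finsupp.single x 1 ∈ grading size k (size x) :=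
  Submodule.subset_span ⟨x, rfl, rfl⟩

omit [DecidableEq P] in
theorem grading_le {n : ℕ} {N : Submodule k (P →₀ k)}
    (h : ∀ x, size x = n → Finsupp.single x 1 ∈ N) : grading size k n ≤ N := by
  refine Submodule.span_le.2 ?_
  rintro _ ⟨x, hx, rfl⟩
  exact h x hx

omit [DecidableEq P] in
theorem grading_eq_supported (n : ℕ) :
    grading size k n = Finsupp.supported k k {x | size x = n} :=
  (Finsupp.supported_eq_span_single k _).symm

omit [DecidableEq P] in
theorem isInternal_grading : DirectSum.IsInternal (grading size k) := by
  classical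
  refine DirectSum.isInternal_submodule_of_iSupIndep_of_iSup_eq_top ?_ ?_
  · intro n
    simp only [grading_eq_supported]
    refine Disjoint.mono_right (iSup₂_le fun m hm => Finsupp.supported_mono
      (t := {x | size x ≠ n}) fun x (hx : size x = m) (h : size x = n) => hm (hx.symm.trans h)) ?_
    exact Finsupp.disjoint_supported_supported (Set.disjoint_left.2 fun x hx hx' => hx' hx)
  · rw [eq_top_iff]
    intro f _
    induction f using Finsupp.induction_single_one with
    | zero => exact zero_mem _
    | add f g hf hg => exact add_mem (hf trivial) (hg trivial)
    | smul c f hf => exact Submodule.smul_mem _ _ (hf trivial)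
    | single x => exact Submodule.mem_iSup_of_mem (size x) (single_mem_grading x)

theorem IsSize.mul_mem (h : S.IsSize size) (m n : ℕ) (x : P →₀ k) (hx : x ∈ grading size k m)
    (y : P →₀ k) (hy : y ∈ grading size k n) :
    (S.hopfData k).mul x y ∈ grading size k (m + n) := by
  have h1 : ∀ a, size a = m → ∀ y ∈ grading size k n,
      (S.hopfData k).mul (Finsupp.single a 1) y ∈ grading size k (m + n) := by
    rintro a rfl y hy
    refine grading_le (N := (grading size k (size a + n)).comap _) ?_ hy
    rintro b rfl
    rw [Submodule.mem_comap, mul_single]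
    refine Submodule.sum_mem _ fun w hw => ?_
    rw [mem_twoWords] at hw
    have := h.tangleFrom (x := a) (y := b) (i := 0) (b := 0) (w := w) (by omega) (by omega)
    rw [← this]
    exact single_mem_grading _
  exact grading_le (N := (grading size k (m + n)).comap ((S.hopfData k).mul.flip y))
    (fun a ha => h1 a ha y hy) hx

theorem IsSize.comul_mem (h : S.IsSize size) (n : ℕ) (x : P →₀ k) (hx : x ∈ grading size k n) :
    (S.hopfData k).comul x ∈ ⨆ p ∈ Finset.HasAntidiagonal.antidiagonal n,
      LinearMap.range (TensorProduct.mapIncl (grading size k p.1) (grading size k p.2)) := by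
  refine grading_le (N := Submodule.comap (S.hopfData k).comul
    (⨆ p ∈ Finset.HasAntidiagonal.antidiagonal n,
      LinearMap.range (TensorProduct.mapIncl (grading size k p.1) (grading size k p.2)))) ?_ hx
  rintro a rfl
  rw [Submodule.mem_comap, comul_single]
  refine Submodule.sum_mem _ fun i hi => ?_
  have hi' : i ≤ S.len a := Nat.lt_succ_iff.1 (Finset.mem_range.1 hi)
  refine Submodule.mem_iSup_of_mem (size (S.left a i), size (S.right a i))
    (Submodule.mem_iSup_of_mem
      (Finset.HasAntidiagonal.mem_antidiagonal.2 (h.left_add_right a i hi')) ?_)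
  exact ⟨⟨_, single_mem_grading (S.left a i)⟩ ⊗ₜ ⟨_, single_mem_grading (S.right a i)⟩, rfl⟩

theorem IsSize.one_mem (h : S.IsSize size) : (S.hopfData k).one ∈ grading size k 0 := by
  have := single_mem_grading (size := size) (k := k) S.one
  rwa [(h.eq_zero_iff S.one).2 rfl] at this

theorem IsSize.antipodeLeft_mem (h : S.IsSize size) (x : P) :
    S.antipodeLeft k x ∈ grading size k (size x) := by
  induction hn : S.len x using Nat.strong_induction_on generalizing x with
  | _ n ih =>
    rw [antipodeLeft]
    split_ifs with h0
    · rw [(h.eq_zero_iff x).2 (S.eq_one h0)]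
      exact h.one_mem
    · refine Submodule.neg_mem _ (Submodule.sum_mem _ fun i _ => ?_)
      have hi := i.2
      rw [← h.left_add_right x i i.2.le]
      exact h.mul_mem _ _ _ (ih i (by omega) _ (S.len_left i.2.le)) _ (single_mem_grading _)

/-- The vector space spanned by the objects of a cut system is a graded connected Hopf algebra. -/
theorem IsSize.isGradedConnectedHopf (h : S.IsSize size) :
    IsGradedConnectedHopf (S.hopfData k) (grading size k) where
  mul_assoc := mul_assoc
  one_mul := one_mul
  mul_one := mul_one
  coassoc := coassoc
  counit_comul := counit_comul
  comul_counit := comul_counit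
  counit_one := counit_one
  counit_mul := counit_mul
  comul_one := comul_one
  comul_mul := comul_mul
  antipode := by
    refine ⟨Finsupp.lift (P →₀ k) k P (S.antipodeLeft k), ?_, ?_, fun n x hx => ?_⟩
    · refine Finsupp.hom_ext_single_one fun x => ?_
      simp only [LinearMap.comp_apply, comul_single, map_sum, LinearMap.rTensor_tmul,
        TensorProduct.lift.tmul, LinearMap.toSpanSingleton_apply, Finsupp.lift_apply, zero_smul,
        Finsupp.sum_single_index, one_smul]
      exact sum_antipodeLeft x
    · refine Finsupp.hom_ext_single_one fun x => ?_
      simp only [LinearMap.comp_apply, comul_single, map_sum, LinearMap.lTensor_tmul,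
        TensorProduct.lift.tmul, LinearMap.toSpanSingleton_apply, Finsupp.lift_apply, zero_smul,
        Finsupp.sum_single_index, one_smul, antipodeLeft_eq_antipodeRight]
      exact sum_antipodeRight x
    · refine grading_le (N := (grading size k n).comap _) ?_ hx
      rintro a rfl
      simp only [Submodule.mem_comap, Finsupp.lift_apply, zero_smul, Finsupp.sum_single_index,
        one_smul]
      exact h.antipodeLeft_mem a
  isInternal := isInternal_grading
  mul_mem := h.mul_mem
  comul_mem := h.comul_mem
  counit_eq_zero := fun n hn x hx => by
    refine grading_le (N := LinearMap.ker (S.hopfData k).counit) ?_ hx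
    rintro a rfl
    rw [LinearMap.mem_ker, counit_single, if_neg ((h.eq_zero_iff a).not.1 hn)]
  connected := by
    refine le_antisymm (grading_le fun x hx => ?_) ?_
    · rw [(h.eq_zero_iff x).1 hx]
      exact Submodule.mem_span_singleton_self _
    · rw [Submodule.span_singleton_le_iff_mem]
      exact h.one_mem

end Grading

end CutSystem

/-! ### Merging two words -/

/-- The shuffle of two lists according to a word in the letters `true` (take the next element of
the first list) and `false` (take the next element of the second list). -/
def mergeLists {α : Type*} : List α → List α → List Bool → List α
  | a :: l, l', true :: w => a :: mergeLists l l' w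
  | l, b :: l', false :: w => b :: mergeLists l l' w
  | _, _, _ => []

theorem mergeLists_swap {α : Type*} (l l' : List α) (w : List Bool) :
    mergeLists l' l (w.map not) = mergeLists l l' w := by
  induction w generalizing l l' with
  | nil => rcases l with _ | _ <;> rcases l' with _ | _ <;> rfl
  | cons c w ih =>
    cases c
    · rcases l' with _ | ⟨b, l'⟩
      · rcases l with _ | _ <;> rfl
      · simp [mergeLists, ih]
    · rcases l with _ | ⟨a, l⟩
      · rcases l' with _ | _ <;> rfl
      · simp [mergeLists, ih]

theorem sum_twoWords_succ {M : Type*} [AddCommMonoid M] (a b : ℕ) (F : List Bool → M) :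
    ∑ w ∈ twoWords (a + 1) (b + 1), F w =
      ∑ w ∈ twoWords a (b + 1), F (true :: w) + ∑ w ∈ twoWords (a + 1) b, F (false :: w) := by
  have h : twoWords (a + 1) (b + 1) = (twoWords a (b + 1)).image (true :: ·) ∪
      (twoWords (a + 1) b).image (false :: ·) := by
    ext w
    simp only [Finset.mem_union, Finset.mem_image, mem_twoWords]
    constructor
    · rintro ⟨h1, h2⟩
      rcases w with _ | ⟨_ | _, w⟩
      · simp at h1
      · simp at h1 h2
        exact Or.inr ⟨w, ⟨h1, h2⟩, rfl⟩
      · simp at h1 h2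
        exact Or.inl ⟨w, ⟨h1, h2⟩, rfl⟩
    · rintro (⟨w, ⟨h1, h2⟩, rfl⟩ | ⟨w, ⟨h1, h2⟩, rfl⟩) <;> simp [h1, h2]
  rw [h, Finset.sum_union, Finset.sum_image, Finset.sum_image]
  · intro v _ w _ h
    exact (List.cons_inj_right _).1 h
  · intro v _ w _ h
    exact (List.cons_inj_right _).1 h
  · rw [Finset.disjoint_left]
    intro w h1 h2
    rw [Finset.mem_image] at h1 h2
    obtain ⟨u, -, rfl⟩ := h1
    obtain ⟨v, -, h⟩ := h2
    simp at h

theorem sum_twoWords_swap {M : Type*} [AddCommMonoid M] (a b : ℕ) (F : List Bool → M) :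
    ∑ w ∈ twoWords a b, F w = ∑ w ∈ twoWords b a, F (w.map not) := by
  have hc : ∀ (w : List Bool), (w.map not).count true = w.count false ∧
      (w.map not).count false = w.count true := fun w => by
    induction w with
    | nil => simp
    | cons l w ih => cases l <;> simp [ih]
  have hn : ∀ w : List Bool, (w.map not).map not = w := fun w => by
    rw [List.map_map, Bool.involutive_not.comp_self, List.map_id]
  refine Finset.sum_nbij' (fun w => w.map not) (fun w => w.map not) ?_ ?_ (fun w _ => hn w)
    (fun w _ => hn w) (fun w _ => by rw [hn])
  all_goals
    intro w hw
    have := hc w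
    rw [mem_twoWords] at hw ⊢
    omega

theorem mergeLists_replicate_true {α : Type*} (l l' : List α) :
    mergeLists l l' (List.replicate l.length true) = l := by
  induction l with
  | nil => rcases l' with _ | _ <;> rfl
  | cons a l ih => simp [mergeLists, List.replicate_succ, ih]

/-- The shuffles, with multiplicities, are the mergings along all words. -/
theorem sum_listShuffles {α M : Type*} [AddCommMonoid M] (F : List α → M) (l l' : List α) :
    ((listShuffles l l').map F).sum =
      ∑ w ∈ twoWords l.length l'.length, F (mergeLists l l' w) := by
  induction l generalizing F l' with
  | nil =>
    rw [List.length_nil, twoWords_zero_left, Finset.sum_singleton, ← mergeLists_swap]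
    simp [listShuffles, mergeLists_replicate_true]
  | cons a l ih =>
    induction l' generalizing F with
    | nil =>
      rw [List.length_nil, twoWords_zero_right, Finset.sum_singleton,
        mergeLists_replicate_true]
      simp [listShuffles]
    | cons b l' ih' =>
      rw [listShuffles, List.map_append, List.sum_append, List.map_map, List.map_map, ih, ih',
        List.length_cons, List.length_cons, sum_twoWords_succ]
      simp [mergeLists]

namespace CutSystem

variable {P α : Type*} {S : CutSystem P α}

/-- The first `u.length` atoms of `x` and the first `s.length` atoms of `y` have been read. -/
theorem word_tangleFrom {x y : P} {w : List Bool} {u v s t : List α}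
    (hx : S.word x = u ++ v) (hy : S.word y = s ++ t) (hv : w.count true = v.length)
    (ht : w.count false = t.length) :
    S.word (S.tangleFrom x y u.length s.length w) = u ++ s ++ mergeLists v t w := by
  induction w generalizing y u v s t with
  | nil =>
    obtain rfl : v = [] := List.length_eq_zero_iff.1 hv.symm
    obtain rfl : t = [] := List.length_eq_zero_iff.1 ht.symm
    rw [tangleFrom, S.word_ins _ _ _ (by simp [hx]), S.word_left, hx, hy]
    simp [mergeLists]
  | cons c w ih =>
    cases c
    · rcases t with _ | ⟨b, t⟩
      · simp at ht
      · simp at hv ht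
        have := ih (y := y) (u := u) (v := v) (s := s ++ [b]) (t := t) hx (by simp [hy]) hv ht
        rw [List.length_append, List.length_singleton] at this
        rw [tangleFrom, this]
        simp [mergeLists]
    · rcases v with _ | ⟨a, v⟩
      · simp at hv
      · simp at hv ht
        have := ih (y := S.right y s.length) (u := u ++ [a]) (v := v) (s := []) (t := t)
          (by simp [hx]) (by simp [S.word_right, hy]) hv ht
        rw [List.length_append, List.length_singleton, List.length_nil] at this
        rw [tangleFrom, S.word_ins _ _ _ (by rw [this]; simp), this, S.word_left, hy]
        simp [mergeLists]

/-- The word of a tangled object is a shuffle of the words. -/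
theorem word_tangle {x y : P} {w : List Bool} (hx : w.count true = S.len x)
    (hy : w.count false = S.len y) :
    S.word (S.tangle x y w) = mergeLists (S.word x) (S.word y) w :=
  word_tangleFrom (u := []) (s := []) rfl rfl hx hy

/-- The product is commutative if the objects are determined by their words. -/
theorem mul_comm {P α : Type} {S : CutSystem P α} [DecidableEq P] {k : Type u} [Field k]
    (hS : Function.Injective S.word) (x y : P →₀ k) :
    (S.hopfData k).mul x y = (S.hopfData k).mul y x := by
  induction x using Finsupp.induction_single_one with
  | zero => simp
  | add x x' h h' => simp only [map_add, LinearMap.add_apply, h, h']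
  | smul c x h => simp only [map_smul, LinearMap.smul_apply, h]
  | single x =>
  induction y using Finsupp.induction_single_one with
  | zero => simp
  | add x x' h h' => simp only [map_add, LinearMap.add_apply, h, h']
  | smul c x h => simp only [map_smul, LinearMap.smul_apply, h]
  | single y =>
  rw [mul_single, mul_single, sum_twoWords_swap]
  refine Finset.sum_congr rfl fun w hw => ?_
  have hc : (w.map not).count true = w.count false ∧
      (w.map not).count false = w.count true := by
    clear hw
    induction w with
    | nil => simp
    | cons l w ih => cases l <;> simp [ih]
  rw [mem_twoWords] at hw
  congr 1
  refine hS ?_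
  rw [word_tangle (by omega) (by omega), word_tangle hw.1 hw.2, mergeLists_swap]

end CutSystem

/-! ### Factorization of permutations -/

namespace Permutation

theorem gdProd_fst (μ ν : Permutation) : (gdProd μ ν).1 = μ.1 + ν.1 := rfl

/-- The value at `i`, and `0` outside of the domain. -/
def val (ω : Permutation) (i : ℕ) : ℕ := if h : i < ω.1 then ω.2 ⟨i, h⟩ else 0

theorem val_of_lt {ω : Permutation} {i : ℕ} (h : i < ω.1) : ω.val i = ω.2 ⟨i, h⟩ := dif_pos h

theorem val_lt {ω : Permutation} {i : ℕ} (h : i < ω.1) : ω.val i < ω.1 := by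
  rw [val_of_lt h]
  exact (ω.2 ⟨i, h⟩).2

theorem ext_iff_val {a b : Permutation} :
    a = b ↔ a.1 = b.1 ∧ ∀ i < a.1, a.val i = b.val i := by
  constructor
  · rintro rfl
    exact ⟨rfl, fun _ _ => rfl⟩
  · rintro ⟨h1, h2⟩
    refine ext_val h1 fun i ha hb => ?_
    have := h2 i ha
    rwa [val_of_lt ha, val_of_lt hb] at this

theorem val_gdProd_left {μ ν : Permutation} {i : ℕ} (h : i < μ.1) :
    (gdProd μ ν).val i = μ.val i + ν.1 := by
  rw [val_of_lt h, val_of_lt (Nat.lt_add_right _ h), gdProd_left _ _ _ h]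

theorem val_gdProd_right {μ ν : Permutation} {i : ℕ} (h : i < ν.1) :
    (gdProd μ ν).val (μ.1 + i) = ν.val i := by
  rw [val_of_lt h, val_of_lt (Nat.add_lt_add_left h _), gdProd_right _ _ _ h]

theorem isGlobalDescent_iff {ω : Permutation} {γ : ℕ} :
    IsGlobalDescent ω γ ↔ γ ≤ ω.1 ∧ ∀ i < ω.1, i < γ ↔ ω.1 - γ ≤ ω.val i := by
  refine and_congr_right fun _ => ⟨fun h i hi => ?_, fun h i => ?_⟩
  · rw [val_of_lt hi]
    exact h ⟨i, hi⟩
  · have := h i i.2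
    rwa [val_of_lt i.2] at this

theorem isGlobalDescent_zero (ω : Permutation) : IsGlobalDescent ω 0 := by
  refine isGlobalDescent_iff.2 ⟨Nat.zero_le _, fun i hi => ?_⟩
  have := val_lt hi
  omega

/-- Global descents of the first factor. -/
theorem isGlobalDescent_gdProd_left {μ ν : Permutation} {γ : ℕ} (h : γ ≤ μ.1) :
    IsGlobalDescent (gdProd μ ν) γ ↔ IsGlobalDescent μ γ := by
  refine ⟨fun hg => ?_, fun hg => hg.gdProd ν⟩
  rw [isGlobalDescent_iff] at hg ⊢
  refine ⟨h, fun i hi => ?_⟩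
  have := hg.2 i (Nat.lt_add_right _ hi)
  rw [val_gdProd_left hi, gdProd_fst] at this
  omega

/-- Global descents of the second factor. -/
theorem isGlobalDescent_gdProd_right {μ ν : Permutation} {γ : ℕ} :
    IsGlobalDescent (gdProd μ ν) (μ.1 + γ) ↔ IsGlobalDescent ν γ := by
  rw [isGlobalDescent_iff, isGlobalDescent_iff, gdProd_fst]
  refine and_congr (by omega) ⟨fun h i hi => ?_, fun h i hi => ?_⟩
  · have := h (μ.1 + i) (by omega)
    rw [val_gdProd_right hi] at this
    omega
  · rcases lt_or_ge i μ.1 with hlt | hge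
    · rw [val_gdProd_left hlt]
      omega
    · obtain ⟨j, rfl⟩ := Nat.exists_eq_add_of_le hge
      have := h j (by omega)
      rw [val_gdProd_right (by omega)]
      omega

theorem gdProd_inj {μ ν μ' ν' : Permutation} (h : gdProd μ ν = gdProd μ' ν')
    (hs : μ.1 = μ'.1) : μ = μ' ∧ ν = ν' := by
  have hs' : ν.1 = ν'.1 := by
    have := congrArg Sigma.fst h
    rw [gdProd_fst, gdProd_fst] at this
    omega
  rw [ext_iff_val, ext_iff_val]
  refine ⟨⟨hs, fun i hi => ?_⟩, hs', fun i hi => ?_⟩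
  · have := congrArg (fun ω => val ω i) h
    rw [val_gdProd_left hi, val_gdProd_left (hs ▸ hi)] at this
    omega
  · rw [← val_gdProd_right (μ := μ) hi, h, hs, val_gdProd_right (hs' ▸ hi)]

theorem eq_eps_iff {ω : Permutation} : ω = eps ↔ ω.1 = 0 := by
  rw [ext_iff_val]
  refine ⟨fun h => h.1, fun h => ⟨h, fun i hi => ?_⟩⟩
  omega

theorem eps_gdProd (ω : Permutation) : gdProd eps ω = ω := by
  rw [ext_iff_val]
  have h : (gdProd eps ω).1 = ω.1 := Nat.zero_add _
  refine ⟨h, fun i hi => ?_⟩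
  have := val_gdProd_right (μ := eps) (h ▸ hi)
  rwa [show (eps : Permutation).1 = 0 from rfl, zero_add] at this

theorem gdProd_assoc (a b c : Permutation) : gdProd (gdProd a b) c = gdProd a (gdProd b c) := by
  rw [ext_iff_val]
  have ha := gdProd_fst a b
  have hb := gdProd_fst b c
  have hab := gdProd_fst (gdProd a b) c
  refine ⟨Nat.add_assoc _ _ _, fun i hi => ?_⟩
  rcases lt_or_ge i a.1 with h | h
  · rw [val_gdProd_left h, val_gdProd_left (by omega), val_gdProd_left h]
    omega
  obtain ⟨i, rfl⟩ := Nat.exists_eq_add_of_le h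
  rcases lt_or_ge i b.1 with h' | h'
  · rw [val_gdProd_left (by omega), val_gdProd_right h', val_gdProd_right (by omega),
      val_gdProd_left h']
  obtain ⟨i, rfl⟩ := Nat.exists_eq_add_of_le h'
  rw [← Nat.add_assoc, ← ha, val_gdProd_right (by omega), ha, Nat.add_assoc,
    val_gdProd_right (by omega), val_gdProd_right (by omega)]

theorem listProd_cons (a : Permutation) (l : List Permutation) :
    listProd (a :: l) = gdProd a (listProd l) := rfl

theorem listProd_append (l l' : List Permutation) :
    listProd (l ++ l') = gdProd (listProd l) (listProd l') := by
  induction l with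
  | nil => exact (eps_gdProd _).symm
  | cons a l ih => rw [List.cons_append, listProd_cons, ih, listProd_cons, gdProd_assoc]

theorem listProd_fst (l : List Permutation) : (listProd l).1 = (l.map Sigma.fst).sum := by
  induction l with
  | nil => rfl
  | cons a l ih => rw [listProd_cons, gdProd_fst, ih, List.map_cons, List.sum_cons]

/-- The list consists of nontrivial atomic permutations. -/
def IsFactorization (l : List Permutation) : Prop := ∀ a ∈ l, IsAtomic a ∧ a ≠ eps

/-- Unique factorization: the size of the first atom is the first positive global descent of the
product. -/
theorem IsFactorization.eq_of_listProd_eq {l l' : List Permutation} (hl : IsFactorization l)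
    (hl' : IsFactorization l') (h : listProd l = listProd l') : l = l' := by
  have hpos : ∀ a : Permutation, a ≠ eps → 0 < a.1 := fun a ha =>
    Nat.pos_of_ne_zero fun h0 => ha (eq_eps_iff.2 h0)
  have key : ∀ a b μ ν : Permutation, gdProd a μ = gdProd b ν → IsAtomic b → a ≠ eps →
      b.1 ≤ a.1 := by
    intro a b μ ν h hb ha
    by_contra! hlt
    have h1 : IsGlobalDescent (gdProd a μ) (a.1 + 0) :=
      isGlobalDescent_gdProd_right.2 (isGlobalDescent_zero μ)
    rw [h, add_zero, isGlobalDescent_gdProd_left hlt.le] at h1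
    have := hpos a ha
    rcases hb _ h1 with h2 | h2 <;> omega
  induction l generalizing l' with
  | nil =>
    rcases l' with _ | ⟨b, l'⟩
    · rfl
    · have := congrArg Sigma.fst h
      rw [listProd_cons, gdProd_fst] at this
      have h2 := hpos b (hl' b (by simp)).2
      change 0 = _ at this
      omega
  | cons a l ih =>
    rcases l' with _ | ⟨b, l'⟩
    · have := congrArg Sigma.fst h
      rw [listProd_cons, gdProd_fst] at this
      have h2 := hpos a (hl a (by simp)).2
      change _ = 0 at this
      omega
    · rw [listProd_cons, listProd_cons] at h
      have ha := hl a (by simp)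
      have hb := hl' b (by simp)
      obtain ⟨rfl, h'⟩ := gdProd_inj h
        (le_antisymm (key _ _ _ _ h.symm ha.1 hb.2) (key _ _ _ _ h hb.1 ha.2))
      rw [ih (fun c hc => hl c (by simp [hc])) (fun c hc => hl' c (by simp [hc])) h']

theorem isFactorization_atoms (ω : Permutation) : IsFactorization ω.atoms :=
  (exists_factorization ω).choose_spec.1

theorem listProd_atoms (ω : Permutation) : listProd ω.atoms = ω :=
  (exists_factorization ω).choose_spec.2

theorem IsFactorization.atoms_listProd {l : List Permutation} (hl : IsFactorization l) :
    (listProd l).atoms = l :=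
  (isFactorization_atoms _).eq_of_listProd_eq hl (listProd_atoms _)

theorem IsFactorization.append {l l' : List Permutation} (hl : IsFactorization l)
    (hl' : IsFactorization l') : IsFactorization (l ++ l') := fun a ha =>
  (List.mem_append.1 ha).elim (hl a) (hl' a)

theorem IsFactorization.take {l : List Permutation} (hl : IsFactorization l) (i : ℕ) :
    IsFactorization (l.take i) := fun a ha => hl a (List.mem_of_mem_take ha)

theorem IsFactorization.drop {l : List Permutation} (hl : IsFactorization l) (i : ℕ) :
    IsFactorization (l.drop i) := fun a ha => hl a (List.mem_of_mem_drop ha)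

theorem atoms_injective : Function.Injective atoms := fun a b h => by
  rw [← listProd_atoms a, h, listProd_atoms]

theorem atoms_eq_nil_iff {ω : Permutation} : ω.atoms = [] ↔ ω = eps := by
  constructor
  · intro h
    rw [← listProd_atoms ω, h]
    rfl
  · rintro rfl
    exact IsFactorization.atoms_listProd (l := []) (fun a ha => by simp at ha)

/-- The global descents are the total sizes of the first atoms. -/
theorem isGlobalDescent_listProd_iff {l : List Permutation} (hl : IsFactorization l) {γ : ℕ} :
    IsGlobalDescent (listProd l) γ ↔ ∃ i ≤ l.length, γ = (listProd (l.take i)).1 := by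
  induction l generalizing γ with
  | nil =>
    constructor
    · intro h
      exact ⟨0, le_rfl, Nat.le_zero.1 h.1⟩
    · rintro ⟨i, -, rfl⟩
      rw [List.take_nil]
      exact isGlobalDescent_zero _
  | cons a l ih =>
    have ha := hl a (by simp)
    have hl' : IsFactorization l := fun c hc => hl c (by simp [hc])
    constructor
    · intro h
      rw [listProd_cons] at h
      rcases lt_or_ge γ a.1 with hlt | hge
      · rw [isGlobalDescent_gdProd_left hlt.le] at h
        refine ⟨0, Nat.zero_le _, (ha.1 γ h).resolve_right hlt.ne⟩
      · obtain ⟨δ, rfl⟩ := Nat.exists_eq_add_of_le hge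
        rw [isGlobalDescent_gdProd_right, ih hl'] at h
        obtain ⟨i, hi, rfl⟩ := h
        exact ⟨i + 1, by simpa using hi, rfl⟩
    · rintro ⟨_ | i, hi, rfl⟩
      · exact isGlobalDescent_zero _
      · rw [List.take_succ_cons, listProd_cons, listProd_cons, gdProd_fst,
          isGlobalDescent_gdProd_right, ih hl']
        exact ⟨i, by simpa using hi, rfl⟩

/-- The cut system of permutations, where the words are the atomic factorizations. -/
noncomputable def cutSystem : CutSystem Permutation Permutation := by
  have h1 : ∀ (x : Permutation) i, (listProd (x.atoms.take i)).atoms = x.atoms.take i := fun x i =>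
    ((isFactorization_atoms x).take i).atoms_listProd
  have h2 : ∀ (x : Permutation) i, (listProd (x.atoms.drop i)).atoms = x.atoms.drop i := fun x i =>
    ((isFactorization_atoms x).drop i).atoms_listProd
  have h3 : ∀ (x : Permutation) i (y : Permutation),
      (listProd (x.atoms.take i ++ y.atoms ++ x.atoms.drop i)).atoms =
      x.atoms.take i ++ y.atoms ++ x.atoms.drop i := fun x i y =>
    ((((isFactorization_atoms x).take i).append (isFactorization_atoms y)).append
      ((isFactorization_atoms x).drop i)).atoms_listProd
  have t1 : ∀ (l : List Permutation) (n : ℕ), l.take (l.length + n) = l := fun l n =>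
    List.take_of_length_le (Nat.le_add_right _ _)
  have t2 : ∀ (l : List Permutation) (n : ℕ), l.take (n + l.length) = l := fun l n =>
    List.take_of_length_le (Nat.le_add_left _ _)
  have d1 : ∀ (l : List Permutation) (n : ℕ), l.drop (l.length + n) = [] := fun l n =>
    List.drop_eq_nil_of_le (Nat.le_add_right _ _)
  have d2 : ∀ (l : List Permutation) (n : ℕ), l.drop (n + l.length) = [] := fun l n =>
    List.drop_eq_nil_of_le (Nat.le_add_left _ _)
  have hs : ∀ (l : List Permutation) (i : ℕ), i ≤ l.length →
      ∃ u v, l = u ++ v ∧ u.length = i := fun l i hi =>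
    ⟨l.take i, l.drop i, (List.take_append_drop i l).symm, List.length_take_of_le hi⟩
  have hs3 : ∀ (l : List Permutation) (i j : ℕ), i + j ≤ l.length →
      ∃ u v t, l = u ++ v ++ t ∧ u.length = i ∧ v.length = j := fun l i j hi => by
    obtain ⟨u, t, rfl, hu⟩ := hs l (i + j) hi
    obtain ⟨u, v, rfl, hu'⟩ := hs u i (by omega)
    simp only [List.length_append] at hu
    exact ⟨u, v, t, rfl, hu', by omega⟩
  exact
  { word := atoms
    left := fun x i => listProd (x.atoms.take i)
    right := fun x i => listProd (x.atoms.drop i)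
    ins := fun x i y => listProd (x.atoms.take i ++ y.atoms ++ x.atoms.drop i)
    one := eps
    word_left := h1
    word_right := h2
    word_ins := fun x i y _ => h3 x i y
    word_eq_nil := fun x => atoms_eq_nil_iff
    left_length := fun x => by rw [List.take_length, listProd_atoms]
    right_zero := fun x => by rw [List.drop_zero, listProd_atoms]
    left_left := fun x i j hij _ => by
      rw [h1, List.take_take, min_eq_left hij]
    right_right := fun x i j _ => by rw [h2, List.drop_drop]
    right_left := fun x i j _ => by
      rw [h1, h2, List.drop_take, Nat.add_sub_cancel_left]
    ins_one := fun x i _ => by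
      rw [atoms_eq_nil_iff.2 rfl, List.append_nil, List.take_append_drop, listProd_atoms]
    one_ins := fun x => by
      rw [atoms_eq_nil_iff.2 rfl, List.take_nil, List.drop_nil, List.append_nil,
        List.nil_append, listProd_atoms]
    left_ins_le := fun x i j y hji hi => by
      rw [h3]
      obtain ⟨d, rfl⟩ := Nat.exists_eq_add_of_le hji
      obtain ⟨u, v, t, hu, rfl, rfl⟩ := hs3 _ _ _ hi
      simp [hu, List.take_append, t1]
    left_ins_mid := fun x i j y hi hj => by
      rw [h3, h1, h1]
      obtain ⟨u, v, hu, rfl⟩ := hs _ _ hi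
      obtain ⟨u', v', hu', rfl⟩ := hs _ _ hj
      simp [hu, hu', List.take_append, t1]
    left_ins_ge := fun x i j y hi => by
      rw [h3, h1]
      obtain ⟨u, v, t, hu, rfl, rfl⟩ := hs3 _ _ _ hi
      simp [hu, List.take_append, t1, Nat.add_assoc]
    right_ins_le := fun x i j y hi => by
      rw [h3, h2]
      obtain ⟨u, v, t, hu, rfl, rfl⟩ := hs3 _ _ _ hi
      simp [hu, List.take_append, List.drop_append, t1, d1]
    right_ins_mid := fun x i j y hi hj => by
      rw [h3, h2, h2]
      obtain ⟨u, v, hu, rfl⟩ := hs _ _ hi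
      obtain ⟨u', v', hu', rfl⟩ := hs _ _ hj
      simp [hu, hu', List.drop_append, d1]
    right_ins_ge := fun x i j y hi => by
      rw [h3]
      obtain ⟨u, v, t, hu, rfl, rfl⟩ := hs3 _ _ _ hi
      simp [hu, List.drop_append, d1, Nat.add_assoc]
    ins_ins_nested := fun x i j y z hi hj => by
      rw [h3, h3]
      obtain ⟨u, v, hu, rfl⟩ := hs _ _ hi
      obtain ⟨u', v', hu', rfl⟩ := hs _ _ hj
      simp [hu, hu', List.take_append, List.drop_append, t1, d1]
    ins_ins_parallel := fun x i j y z hij hj => by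
      rw [h3, h3]
      obtain ⟨d, rfl⟩ := Nat.exists_eq_add_of_lt hij
      obtain ⟨u, v, t, hu, rfl, hv⟩ := hs3 _ _ (d + 1) (by rwa [← Nat.add_assoc])
      simp [hu, List.take_append, List.drop_append, ← hv, Nat.add_assoc, t1, t2, d1, d2] }

theorem isSize_cutSystem : cutSystem.IsSize Sigma.fst where
  left_add_right x i _ := by
    change (listProd _).1 + (listProd _).1 = _
    rw [← gdProd_fst, ← listProd_append, List.take_append_drop, listProd_atoms]
  ins x i y _ := by
    change (listProd _).1 = _
    conv_rhs => rw [← listProd_atoms x, ← listProd_atoms y,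
      ← List.take_append_drop i x.atoms]
    simp only [listProd_append, gdProd_fst]
    omega
  eq_zero_iff x := eq_eps_iff.symm

end Permutation

/-- As permutations are determined by their atoms, tangling is the product of the shuffled
atoms. -/
theorem HS.hopfData_eq (k : Type u) [Field k] :
    HS.hopfData k = Permutation.cutSystem.hopfData k := by
  unfold HS.hopfData CutSystem.hopfData
  congr 2
  funext x
  congr 1
  funext y
  rw [sum_listShuffles]
  refine Finset.sum_congr rfl fun w hw => ?_
  rw [mem_twoWords] at hw
  have h := CutSystem.word_tangle (S := Permutation.cutSystem) hw.1 hw.2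
  rw [HS.basis, ← Permutation.listProd_atoms (Permutation.cutSystem.tangle x y w)]
  exact congrArg (fun l => Finsupp.single (Permutation.listProd l) 1) h.symm

theorem HS.isGradedConnectedHopf (k : Type u) [Field k] :
    IsGradedConnectedHopf (HS.hopfData k) (HS.grading k) := by
  rw [HS.hopfData_eq]
  exact Permutation.isSize_cutSystem.isGradedConnectedHopf

/-! ### The cut system of pipe dreams -/

namespace Permutation

theorem mem_globalDescents {ω : Permutation} {γ : ℕ} :
    γ ∈ ω.globalDescents ↔ IsGlobalDescent ω γ := by
  rw [globalDescents, Finset.mem_filter, Finset.mem_range, and_iff_right_iff_imp]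
  exact fun h => Nat.lt_succ_of_le h.1

/-- The total size of the first `i` atoms, which is the position of the gap after these. -/
noncomputable def cutPos (ω : Permutation) (i : ℕ) : ℕ := (listProd (ω.atoms.take i)).1

@[simp] theorem cutPos_zero (ω : Permutation) : ω.cutPos 0 = 0 := rfl

theorem cutPos_length (ω : Permutation) : ω.cutPos ω.atoms.length = ω.1 := by
  rw [cutPos, List.take_length, listProd_atoms]

theorem cutPos_mono (ω : Permutation) {i j : ℕ} (h : i ≤ j) : ω.cutPos i ≤ ω.cutPos j := by
  obtain ⟨d, rfl⟩ := Nat.exists_eq_add_of_le h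
  rw [cutPos, cutPos, List.take_add, listProd_append, gdProd_fst]
  exact Nat.le_add_right _ _

theorem cutPos_lt (ω : Permutation) {i j : ℕ} (h : i < j) (hj : j ≤ ω.atoms.length) :
    ω.cutPos i < ω.cutPos j := by
  refine lt_of_lt_of_le ?_ (ω.cutPos_mono (Nat.succ_le_of_lt h))
  have hi : i < ω.atoms.length := lt_of_lt_of_le h hj
  rw [cutPos, cutPos, Nat.succ_eq_add_one, List.take_succ_eq_append_getElem hi, listProd_append,
    gdProd_fst, Nat.lt_add_right_iff_pos, listProd_cons, gdProd_fst]
  have := (isFactorization_atoms ω _ (List.getElem_mem hi)).2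
  rw [Ne, eq_eps_iff] at this
  omega

theorem cutPos_le (ω : Permutation) (i : ℕ) : ω.cutPos i ≤ ω.1 := by
  rw [← cutPos_length, cutPos, ← min_self ω.atoms.length]
  rcases le_total i ω.atoms.length with h | h
  · rw [min_self]
    exact ω.cutPos_mono h
  · rw [min_self, List.take_of_length_le h, cutPos, List.take_length]

theorem isGlobalDescent_cutPos (ω : Permutation) (i : ℕ) : IsGlobalDescent ω (ω.cutPos i) := by
  have h := isGlobalDescent_listProd_iff (isFactorization_atoms ω) (γ := ω.cutPos i)
  rw [listProd_atoms] at h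
  rw [h]
  rcases le_total i ω.atoms.length with hi | hi
  · exact ⟨i, hi, rfl⟩
  · exact ⟨_, le_rfl, by rw [cutPos, List.take_of_length_le hi, List.take_length]⟩

theorem exists_cutPos {ω : Permutation} {γ : ℕ} (h : IsGlobalDescent ω γ) :
    ∃ i ≤ ω.atoms.length, γ = ω.cutPos i := by
  rw [← listProd_atoms ω, isGlobalDescent_listProd_iff (isFactorization_atoms ω)] at h
  exact h

/-- Cutting a permutation at a global descent. -/
theorem eq_listProd_of_gdProd_eq {μ ν ω : Permutation} {i : ℕ} (h : gdProd μ ν = ω)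
    (hμ : μ.1 = ω.cutPos i) :
    μ = listProd (ω.atoms.take i) ∧ ν = listProd (ω.atoms.drop i) := by
  refine gdProd_inj (h.trans ?_) hμ
  rw [← listProd_append, List.take_append_drop, listProd_atoms]

theorem cutPos_listProd_take {ω : Permutation} {i j : ℕ} (h : i ≤ j) :
    (listProd (ω.atoms.take j)).cutPos i = ω.cutPos i := by
  rw [cutPos, ((isFactorization_atoms ω).take j).atoms_listProd, List.take_take, min_eq_left h,
    cutPos]

theorem cutPos_listProd_drop {ω : Permutation} {i j : ℕ} :
    ω.cutPos i + (listProd (ω.atoms.drop i)).cutPos j = ω.cutPos (i + j) := by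
  rw [cutPos, cutPos, ((isFactorization_atoms ω).drop i).atoms_listProd, cutPos, List.take_add,
    listProd_append, gdProd_fst]

theorem atoms_insertion (ω π : Permutation) (i : ℕ) :
    (listProd (ω.atoms.take i ++ π.atoms ++ ω.atoms.drop i)).atoms =
      ω.atoms.take i ++ π.atoms ++ ω.atoms.drop i :=
  ((((isFactorization_atoms ω).take i).append (isFactorization_atoms π)).append
    ((isFactorization_atoms ω).drop i)).atoms_listProd

/-- Gaps before an inserted permutation. -/
theorem cutPos_insertion_le {ω π : Permutation} {i j : ℕ} (hji : j ≤ i)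
    (hi : i ≤ ω.atoms.length) :
    (listProd (ω.atoms.take i ++ π.atoms ++ ω.atoms.drop i)).cutPos j = ω.cutPos j := by
  rw [cutPos, atoms_insertion, List.append_assoc, List.take_append_of_le_length
    (by rw [List.length_take]; omega), List.take_take, min_eq_left hji, cutPos]

/-- Gaps within an inserted permutation. -/
theorem cutPos_insertion_mid {ω π : Permutation} {i j : ℕ}
    (hi : i ≤ ω.atoms.length) (hj : j ≤ π.atoms.length) :
    (listProd (ω.atoms.take i ++ π.atoms ++ ω.atoms.drop i)).cutPos (i + j) =
      ω.cutPos i + π.cutPos j := by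
  have hl : (ω.atoms.take i).length = i := List.length_take_of_le hi
  have h : (ω.atoms.take i ++ (π.atoms ++ ω.atoms.drop i)).take (i + j) =
      ω.atoms.take i ++ π.atoms.take j := by
    have h0 := List.take_length_add_append (l₁ := ω.atoms.take i)
      (l₂ := π.atoms ++ ω.atoms.drop i) j
    rw [hl] at h0
    rw [h0, List.take_append_of_le_length hj]
  rw [cutPos, atoms_insertion, List.append_assoc, h, listProd_append, gdProd_fst, cutPos, cutPos]

/-- Gaps after an inserted permutation. -/
theorem cutPos_insertion_ge {ω π : Permutation} {i j : ℕ} (hi : i ≤ ω.atoms.length) :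
    (listProd (ω.atoms.take i ++ π.atoms ++ ω.atoms.drop i)).cutPos (i + π.atoms.length + j) =
      ω.cutPos (i + j) + π.1 := by
  have hl : (ω.atoms.take i).length = i := List.length_take_of_le hi
  have h : (ω.atoms.take i ++ (π.atoms ++ ω.atoms.drop i)).take (i + π.atoms.length + j) =
      ω.atoms.take i ++ (π.atoms ++ (ω.atoms.drop i).take j) := by
    have h0 := List.take_length_add_append (l₁ := ω.atoms.take i) (l₂ := π.atoms ++ ω.atoms.drop i)
      (π.atoms.length + j)
    rw [hl] at h0
    rw [Nat.add_assoc, h0, List.take_length_add_append]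
  rw [cutPos, atoms_insertion, List.append_assoc, h, listProd_append, gdProd_fst, listProd_append,
    gdProd_fst, cutPos, List.take_add, listProd_append, gdProd_fst, listProd_atoms]
  omega

end Permutation

namespace PipeDream

open Permutation

theorem omega_fst (P : PipeDream) : P.omega.1 = P.1.n := rfl

theorem val_omega (P : PipeDream) {i : ℕ} (h : i < P.1.n) :
    P.omega.val i = P.1.north 0 (i + 1) - 1 := val_of_lt (ω := P.omega) h

/-- The exiting permutation is numbered from `0`, the pipes and columns from `1`. -/
theorem isGlobalDescent_omega {P : PipeDream} {γ : ℕ} :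
    IsGlobalDescent P.omega γ ↔ P.1.IsCut γ := by
  rw [isGlobalDescent_iff, omega_fst]
  refine and_congr_right fun hγ => ⟨fun h j hj1 hj => ?_, fun h i hi => ?_⟩
  · have := h (j - 1) (by omega)
    rw [val_omega P (by omega), Nat.sub_add_cancel hj1] at this
    have := P.2.north_pos hj1 hj
    omega
  · have := h (i + 1) (by omega) hi
    rw [val_omega P hi]
    have := P.2.north_pos (Nat.le_add_left 1 i) hi
    omega

theorem isCut_cutPos (P : PipeDream) (i : ℕ) : P.1.IsCut (P.omega.cutPos i) :=
  isGlobalDescent_omega.1 (isGlobalDescent_cutPos _ i)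

theorem isCut_zero (P : PipeDream) : P.1.IsCut 0 :=
  isGlobalDescent_omega.1 (isGlobalDescent_zero _)

theorem isCut_n (P : PipeDream) : P.1.IsCut P.1.n := by
  have := P.isCut_cutPos P.omega.atoms.length
  rwa [cutPos_length, omega_fst] at this

/-- The vertical packing at a cut. -/
def vCut (P : PipeDream) (γ : ℕ) (h : P.1.IsCut γ) : PipeDream := ⟨P.1.vPack γ, P.2.vPack h.1⟩

/-- The horizontal packing at a cut. -/
def hCut (P : PipeDream) (γ : ℕ) : PipeDream :=
  ⟨P.1.hPack (P.1.n - γ), P.2.hPack (Nat.sub_le _ _)⟩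

/-- The insertion at a cut. -/
def insertAt (P : PipeDream) (γ : ℕ) (h : P.1.IsCut γ) (Q : PipeDream) : PipeDream :=
  ⟨P.1.insert γ Q.1, P.2.insert Q.2 h⟩

/-- The packings at a global descent factor the exiting permutation. -/
theorem gdProd_omega {P : PipeDream} {γ : ℕ} (h : P.1.IsCut γ) :
    gdProd (P.vCut γ h).omega (P.hCut γ).omega = P.omega := by
  have hγ := h.1
  have hv : (P.vCut γ h).omega.1 = γ := rfl
  have hh : (P.hCut γ).omega.1 = P.1.n - γ := rfl
  refine ext_iff_val.2 ⟨Nat.add_sub_cancel' hγ, fun i hi => ?_⟩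
  rw [gdProd_fst, hv, hh] at hi
  rw [val_omega P (by omega)]
  rcases lt_or_ge i γ with hlt | hge
  · rw [val_gdProd_left hlt, hh, val_omega (P.vCut γ h) hlt]
    have h1 := P.2.north_vPack_cut h (j := i + 1) (by omega) hlt
    have h2 := (P.2.vPack hγ).north_pos (j := i + 1) (by omega) hlt
    change (P.1.vPack γ).north 0 (i + 1) - 1 + _ = _
    omega
  · obtain ⟨i, rfl⟩ := Nat.exists_eq_add_of_le hge
    have := val_gdProd_right (μ := (P.vCut γ h).omega) (ν := (P.hCut γ).omega) (i := i)
      (by omega)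
    rw [hv] at this
    rw [this, val_omega (P.hCut γ) (by rw [← omega_fst]; omega)]
    have h1 := P.2.north_hPack_cut h (j := i + 1) (by omega) (by omega)
    change (P.1.hPack (P.1.n - γ)).north 0 (i + 1) - 1 = _
    rw [h1, add_right_comm, add_comm i]

/-- Insertion of a pipe dream inserts its exiting permutation between both factors. -/
theorem omega_insertAt {P : PipeDream} {γ : ℕ} (h : P.1.IsCut γ) (Q : PipeDream) :
    (P.insertAt γ h Q).omega =
      gdProd (gdProd (P.vCut γ h).omega Q.omega) (P.hCut γ).omega := by
  have hγ := h.1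
  have hv : (P.vCut γ h).omega.1 = γ := rfl
  have hh : (P.hCut γ).omega.1 = P.1.n - γ := rfl
  have hn : (P.insertAt γ h Q).1.n = P.1.n + Q.1.n := rfl
  have hvq : (gdProd (P.vCut γ h).omega Q.omega).1 = γ + Q.1.n := rfl
  have hP := gdProd_omega h
  obtain ⟨hu1, hu2, hu3⟩ := Filling.insert_upper P.2.inTriangle Q.2 hγ (Nat.zero_le _)
  refine ext_iff_val.2 ⟨?_, fun i hi => ?_⟩
  · rw [omega_fst, gdProd_fst, hvq, hn, hh]
    omega
  rw [omega_fst, hn] at hi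
  rw [val_omega (P.insertAt γ h Q) hi]
  change (P.1.insert γ Q.1).north 0 (i + 1) - 1 = _
  rcases lt_or_ge i γ with hlt | hge
  · have h1 := val_gdProd_left (ν := (P.hCut γ).omega) (show i < (P.vCut γ h).omega.1 from hlt)
    rw [hP, val_omega P (by omega), hh] at h1
    rw [val_gdProd_left (by omega), val_gdProd_left (show i < (P.vCut γ h).omega.1 from hlt),
      (hu1 (i + 1) hlt).2.1, hh, omega_fst]
    have h2 := (h.2 (i + 1) (by omega) (by omega)).1 (by omega)
    unfold Filling.shift
    rw [if_neg (by omega)]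
    omega
  obtain ⟨i, rfl⟩ := Nat.exists_eq_add_of_le hge
  rcases lt_or_ge i Q.1.n with hlt | hge'
  · have h1 := val_gdProd_right (μ := (P.vCut γ h).omega) (show i < Q.omega.1 from hlt)
    rw [hv, val_omega Q hlt] at h1
    rw [val_gdProd_left (by omega), h1, hh, add_assoc, (hu2 (i + 1) (by omega) hlt).1]
    have := Q.2.north_pos (j := i + 1) (by omega) hlt
    omega
  · obtain ⟨i, rfl⟩ := Nat.exists_eq_add_of_le hge'
    have h1 := val_gdProd_right (μ := gdProd (P.vCut γ h).omega Q.omega)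
      (ν := (P.hCut γ).omega) (i := i) (by omega)
    have h2 := val_gdProd_right (μ := (P.vCut γ h).omega)
      (ν := (P.hCut γ).omega) (i := i) (by omega)
    rw [hvq, add_assoc] at h1
    rw [hP, hv, val_omega P (by omega)] at h2
    have h3 := h.2 (γ + i + 1) (by omega) (by omega)
    have h4 := (hu3 (γ + i + 1) (by omega) (by omega)).2.1
    rw [h1, ← h2, show γ + (Q.1.n + i) + 1 = γ + i + 1 + Q.1.n by omega, h4]
    unfold Filling.shift
    rw [if_pos (by omega)]

end PipeDream

namespace PipeDream

open Permutation

theorem ext_crosses {P Q : PipeDream} (h : P.1 = Q.1) : P = Q := Subtype.ext h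

theorem eq_elbow {P : PipeDream} (h : P.1.n = 0) : P = elbow := by
  refine ext_crosses (Filling.ext h ?_)
  change P.1.crosses = ∅
  rw [Finset.eq_empty_iff_forall_notMem]
  intro c hc
  have := P.2.1 c hc
  omega

theorem vPack_zero (P : PipeDream) : P.1.vPack 0 = ⟨0, ∅⟩ :=
  congrArg Subtype.val (eq_elbow (P := P.vCut 0 P.isCut_zero) rfl)

theorem hPack_zero (P : PipeDream) : P.1.hPack 0 = ⟨0, ∅⟩ :=
  congrArg Subtype.val (eq_elbow (P := ⟨P.1.hPack 0, P.2.hPack (Nat.zero_le _)⟩) rfl)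

theorem omega_eq_eps_iff {P : PipeDream} : P.omega = eps ↔ P = elbow := by
  rw [eq_eps_iff, omega_fst]
  refine ⟨eq_elbow, ?_⟩
  rintro rfl
  rfl

/-- The left part of a pipe dream, cut after the first `i` atoms of its exiting permutation. -/
noncomputable def left (P : PipeDream) (i : ℕ) : PipeDream :=
  P.vCut (P.omega.cutPos i) (P.isCut_cutPos i)

/-- The right part of a pipe dream, cut after the first `i` atoms of its exiting permutation. -/
noncomputable def right (P : PipeDream) (i : ℕ) : PipeDream := P.hCut (P.omega.cutPos i)

/-- The insertion after the first `i` atoms of the exiting permutation. -/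
noncomputable def ins (P : PipeDream) (i : ℕ) (Q : PipeDream) : PipeDream :=
  P.insertAt (P.omega.cutPos i) (P.isCut_cutPos i) Q

theorem omega_left (P : PipeDream) (i : ℕ) :
    (P.left i).omega = listProd (P.omega.atoms.take i) :=
  (eq_listProd_of_gdProd_eq (gdProd_omega (P.isCut_cutPos i)) rfl).1

theorem omega_right (P : PipeDream) (i : ℕ) :
    (P.right i).omega = listProd (P.omega.atoms.drop i) :=
  (eq_listProd_of_gdProd_eq (gdProd_omega (P.isCut_cutPos i)) rfl).2

theorem omega_ins (P : PipeDream) (i : ℕ) (Q : PipeDream) : (P.ins i Q).omega =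
    listProd (P.omega.atoms.take i ++ Q.omega.atoms ++ P.omega.atoms.drop i) := by
  refine (omega_insertAt (P.isCut_cutPos i) Q).trans ?_
  change gdProd (gdProd (P.left i).omega Q.omega) (P.right i).omega = _
  rw [omega_left, omega_right, listProd_append, listProd_append, listProd_atoms]

theorem cutPos_le_n (P : PipeDream) (i : ℕ) : P.omega.cutPos i ≤ P.1.n := cutPos_le _ i

theorem cutPos_right (P : PipeDream) (i j : ℕ) :
    (P.right i).omega.cutPos j = P.omega.cutPos (i + j) - P.omega.cutPos i := by
  have := cutPos_listProd_drop (ω := P.omega) (i := i) (j := j)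
  rw [omega_right]
  omega

theorem left_ins_le (P : PipeDream) {i j : ℕ} (Q : PipeDream) (hji : j ≤ i)
    (hi : i ≤ P.omega.atoms.length) : (P.ins i Q).left j = P.left j := by
  have hc := P.omega.cutPos_mono hji
  have hcut := (P.left j).isCut_n
  refine ext_crosses ?_
  change (P.1.insert _ Q.1).vPack ((P.ins i Q).omega.cutPos j) = P.1.vPack (P.omega.cutPos j)
  have := P.2.vPack_insert Q.2 (l := 0) (P.isCut_cutPos i) (P.cutPos_le_n j) (Nat.zero_le _)
    (fun _ => rfl) (fun h => by omega) (by rw [min_eq_right hc]; exact hcut)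
  rw [omega_ins, cutPos_insertion_le hji hi]
  rw [vPack_zero, Filling.insert_eq_self, add_zero] at this
  exact this

theorem left_ins_mid (P : PipeDream) {i j : ℕ} (Q : PipeDream)
    (hi : i ≤ P.omega.atoms.length) (hj : j ≤ Q.omega.atoms.length) :
    (P.ins i Q).left (i + j) = (P.left i).ins i (Q.left j) := by
  have hcut := (P.left i).isCut_n
  refine ext_crosses ?_
  change (P.1.insert _ Q.1).vPack ((P.ins i Q).omega.cutPos (i + j)) =
    (P.1.vPack (P.omega.cutPos i)).insert ((P.left i).omega.cutPos i)
      (Q.1.vPack (Q.omega.cutPos j))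
  have := P.2.vPack_insert Q.2 (P.isCut_cutPos i) (P.cutPos_le_n i) (Q.cutPos_le_n j)
    (fun h => absurd h (lt_irrefl _)) (fun h => absurd h (lt_irrefl _))
    (by rw [min_self]; exact hcut)
  rw [omega_ins, cutPos_insertion_mid hi hj, this, omega_left, cutPos_listProd_take le_rfl,
    min_self]

theorem left_ins_ge (P : PipeDream) {i j : ℕ} (Q : PipeDream)
    (hi : i + j ≤ P.omega.atoms.length) :
    (P.ins i Q).left (i + Q.omega.atoms.length + j) = (P.left (i + j)).ins i Q := by
  have hc := P.omega.cutPos_mono (Nat.le_add_right i j)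
  have hcut := (P.left (i + j)).isCut_cutPos i
  refine ext_crosses ?_
  change (P.1.insert _ Q.1).vPack ((P.ins i Q).omega.cutPos _) =
    (P.1.vPack (P.omega.cutPos (i + j))).insert ((P.left (i + j)).omega.cutPos i) Q.1
  rw [omega_left, cutPos_listProd_take (Nat.le_add_right i j)] at hcut ⊢
  have := P.2.vPack_insert Q.2 (P.isCut_cutPos i) (P.cutPos_le_n (i + j)) le_rfl
    (fun h => by omega) (fun _ => rfl) (by rw [min_eq_left hc]; exact hcut)
  rw [omega_ins, cutPos_insertion_ge (by omega), omega_fst, this, min_eq_left hc, Q.2.vPack_self]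

theorem right_ins_le (P : PipeDream) {i j : ℕ} (Q : PipeDream)
    (hi : i + j ≤ P.omega.atoms.length) :
    (P.ins (i + j) Q).right i = (P.right i).ins j Q := by
  have hc := P.omega.cutPos_mono (Nat.le_add_right i j)
  have hcut := (P.right i).isCut_cutPos j
  have h1 := P.cutPos_le_n i
  have h2 := P.cutPos_le_n (i + j)
  refine ext_crosses ?_
  change (P.1.insert _ Q.1).hPack (P.1.n + Q.1.n - (P.ins (i + j) Q).omega.cutPos i) =
    (P.1.hPack (P.1.n - P.omega.cutPos i)).insert ((P.right i).omega.cutPos j) Q.1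
  rw [cutPos_right] at hcut ⊢
  have := P.2.hPack_insert Q.2 (P.isCut_cutPos (i + j)) (Nat.sub_le _ (P.omega.cutPos i)) le_rfl
    (fun h => by omega) (fun _ => rfl) (by rw [Nat.sub_sub_self h1]; exact hcut)
  rw [Nat.sub_sub_self h1, Q.2.hPack_self] at this
  rw [omega_ins, cutPos_insertion_le (Nat.le_add_right i j) hi, Nat.sub_add_comm h1, this]

theorem right_ins_mid (P : PipeDream) {i j : ℕ} (Q : PipeDream)
    (hi : i ≤ P.omega.atoms.length) (hj : j ≤ Q.omega.atoms.length) :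
    (P.ins i Q).right (i + j) = (P.right i).ins 0 (Q.right j) := by
  have hcut := (P.right i).isCut_zero
  have h1 := P.cutPos_le_n i
  have h2 := Q.cutPos_le_n j
  refine ext_crosses ?_
  change (P.1.insert _ Q.1).hPack (P.1.n + Q.1.n - (P.ins i Q).omega.cutPos (i + j)) =
    (P.1.hPack (P.1.n - P.omega.cutPos i)).insert 0 (Q.1.hPack (Q.1.n - Q.omega.cutPos j))
  have := P.2.hPack_insert Q.2 (P.isCut_cutPos i) (Nat.sub_le _ (P.omega.cutPos i))
    (Nat.sub_le _ (Q.omega.cutPos j))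
    (fun h => by omega) (fun h => by omega) (by rw [Nat.sub_sub_self h1, Nat.sub_self]; exact hcut)
  rw [Nat.sub_sub_self h1, Nat.sub_self] at this
  rw [omega_ins, cutPos_insertion_mid hi hj, ← this]
  congr 1
  omega

theorem right_ins_ge (P : PipeDream) {i j : ℕ} (Q : PipeDream)
    (hi : i + j ≤ P.omega.atoms.length) :
    (P.ins i Q).right (i + Q.omega.atoms.length + j) = P.right (i + j) := by
  have hc := P.omega.cutPos_mono (Nat.le_add_right i j)
  have hcut := (P.right (i + j)).isCut_zero
  have h1 := P.cutPos_le_n (i + j)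
  refine ext_crosses ?_
  change (P.1.insert _ Q.1).hPack (P.1.n + Q.1.n - (P.ins i Q).omega.cutPos _) =
    P.1.hPack (P.1.n - P.omega.cutPos (i + j))
  have := P.2.hPack_insert Q.2 (l := 0) (P.isCut_cutPos i) (Nat.sub_le _ (P.omega.cutPos (i + j)))
    (Nat.zero_le _) (fun _ => rfl) (fun h => by omega)
    (by rw [Nat.sub_sub_self h1, Nat.sub_eq_zero_of_le hc]; exact hcut)
  rw [hPack_zero, Filling.insert_eq_self, add_zero] at this
  rw [omega_ins, cutPos_insertion_ge (by omega), omega_fst, Nat.add_sub_add_right, this]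

/-- The cut system of pipe dreams, where the words are the atomic factorizations of the exiting
permutations. -/
noncomputable def cutSystem : CutSystem PipeDream Permutation where
  word P := P.omega.atoms
  left := left
  right := right
  ins := ins
  one := elbow
  word_left P i := by
    rw [omega_left, ((isFactorization_atoms P.omega).take i).atoms_listProd]
  word_right P i := by
    rw [omega_right, ((isFactorization_atoms P.omega).drop i).atoms_listProd]
  word_ins P i Q _ := by rw [omega_ins, atoms_insertion]
  word_eq_nil P := by rw [atoms_eq_nil_iff, omega_eq_eps_iff]
  left_length P := by
    refine ext_crosses ?_
    change P.1.vPack (P.omega.cutPos _) = P.1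
    rw [cutPos_length, omega_fst, P.2.vPack_self]
  right_zero P := by
    refine ext_crosses ?_
    change P.1.hPack (P.1.n - P.omega.cutPos 0) = P.1
    rw [cutPos_zero, Nat.sub_zero, P.2.hPack_self]
  left_left P i j hij _ := by
    refine ext_crosses ?_
    change (P.1.vPack (P.omega.cutPos j)).vPack ((P.left j).omega.cutPos i) = _
    rw [omega_left, cutPos_listProd_take hij]
    exact P.2.vPack_vPack (P.omega.cutPos_mono hij) (P.cutPos_le_n j)
  right_right P i j _ := by
    have hc := P.omega.cutPos_mono (Nat.le_add_right i j)
    refine ext_crosses ?_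
    change (P.1.hPack (P.1.n - P.omega.cutPos i)).hPack
      (P.1.n - P.omega.cutPos i - (P.right i).omega.cutPos j) =
        P.1.hPack (P.1.n - P.omega.cutPos (i + j))
    rw [cutPos_right, show P.1.n - P.omega.cutPos i - (P.omega.cutPos (i + j) - P.omega.cutPos i) =
      P.1.n - P.omega.cutPos (i + j) by omega]
    exact P.2.hPack_hPack (by omega) (Nat.sub_le _ _)
  right_left P i j _ := by
    refine ext_crosses ?_
    change (P.1.vPack (P.omega.cutPos (i + j))).hPack
      (P.omega.cutPos (i + j) - (P.left (i + j)).omega.cutPos i) =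
        (P.1.hPack (P.1.n - P.omega.cutPos i)).vPack ((P.right i).omega.cutPos j)
    rw [cutPos_right, omega_left, cutPos_listProd_take (Nat.le_add_right i j)]
    exact P.2.hPack_vPack (P.isCut_cutPos i) (P.isCut_cutPos (i + j))
      (P.omega.cutPos_mono (Nat.le_add_right i j))
  ins_one P i _ := ext_crosses (Filling.insert_eq_self _ _)
  one_ins P := ext_crosses (Filling.elbow_insert _)
  left_ins_le P _ _ Q h h' := P.left_ins_le Q h h'
  left_ins_mid P _ _ Q h h' := P.left_ins_mid Q h h'
  left_ins_ge P _ _ Q h := P.left_ins_ge Q h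
  right_ins_le P _ _ Q h := P.right_ins_le Q h
  right_ins_mid P _ _ Q h h' := P.right_ins_mid Q h h'
  right_ins_ge P _ _ Q h := P.right_ins_ge Q h
  ins_ins_nested P i j Q R hi hj := by
    refine ext_crosses ?_
    change (P.1.insert _ Q.1).insert ((P.ins i Q).omega.cutPos (i + j)) R.1 = _
    rw [omega_ins, cutPos_insertion_mid hi hj]
    exact Filling.insert_insert_nested P.2.inTriangle Q.2.inTriangle (P.cutPos_le_n i)
      (Q.cutPos_le_n j) R.1
  ins_ins_parallel P i j Q R hij hj := by
    refine ext_crosses ?_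
    change (P.1.insert _ Q.1).insert ((P.ins i Q).omega.cutPos (j + Q.omega.atoms.length)) R.1 =
      (P.1.insert _ R.1).insert ((P.ins j R).omega.cutPos i) Q.1
    have h := cutPos_insertion_ge (ω := P.omega) (π := Q.omega) (i := i) (j := j - i) (by omega)
    rw [show i + Q.omega.atoms.length + (j - i) = j + Q.omega.atoms.length by omega,
      Nat.add_sub_cancel' hij.le] at h
    rw [omega_ins, omega_ins, cutPos_insertion_le hij.le hj, h]
    exact Filling.insert_insert_parallel P.2.inTriangle Q.2.inTriangle R.2.inTriangle
      (P.omega.cutPos_lt hij hj) (P.cutPos_le_n j)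

theorem isSize_cutSystem : cutSystem.IsSize fun P => P.1.n where
  left_add_right P i _ := Nat.add_sub_cancel' (P.cutPos_le_n i)
  ins _ _ _ _ := rfl
  eq_zero_iff P := ⟨eq_elbow, by rintro rfl; rfl⟩

end PipeDream

/-! ### Words of atoms and words of pipes -/

/-- Replace the letters of a word in atoms by blocks of letters, where the numbers of letters are
the sizes of the atoms of the first factor (letter `true`) and of the second factor
(letter `false`). -/
def expandWord : List ℕ → List ℕ → List Bool → List Bool
  | a :: l, l', true :: w => List.replicate a true ++ expandWord l l' w
  | l, b :: l', false :: w => List.replicate b false ++ expandWord l l' w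
  | _, _, _ => []

namespace ExpandWord

/-- The numbers of letters are the total sizes. -/
theorem count {l l' : List ℕ} {w : List Bool} (h1 : w.count true = l.length)
    (h2 : w.count false = l'.length) :
    (expandWord l l' w).count true = l.sum ∧ (expandWord l l' w).count false = l'.sum := by
  induction w generalizing l l' with
  | nil =>
    obtain rfl := List.length_eq_zero_iff.1 h1.symm
    obtain rfl := List.length_eq_zero_iff.1 h2.symm
    simp [expandWord]
  | cons c w ih =>
    cases c
    · rcases l' with _ | ⟨b, l'⟩
      · simp at h2
      · simp at h1 h2
        simp [expandWord, ih h1 h2, List.count_replicate]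
    · rcases l with _ | ⟨a, l⟩
      · simp at h1
      · simp at h1 h2
        simp [expandWord, ih h1 h2, List.count_replicate]

/-- A word in pipes that is compatible with the two lists of sizes of atoms. -/
def IsCompatible (l l' : List ℕ) (s : List Bool) : Prop :=
  s.count true = l.sum ∧ s.count false = l'.sum ∧
    (∀ u v, s = u ++ false :: v → ∃ i, u.count true = (l.take i).sum) ∧
    (∀ u v, s = u ++ true :: v → ∃ i, u.count false = (l'.take i).sum)

/-- A position in a word that starts with a block lies either in this block or after it. -/
theorem append_eq_replicate_append {a : ℕ} {c d : Bool} {u v s : List Bool}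
    (h : List.replicate a c ++ s = u ++ d :: v) :
    (∃ j < a, u = List.replicate j c ∧ d = c) ∨
      ∃ u', u = List.replicate a c ++ u' ∧ s = u' ++ d :: v := by
  rcases List.append_eq_append_iff.1 h with ⟨t, h1, h2⟩ | ⟨t, h1, h2⟩
  · exact Or.inr ⟨t, h1, h2⟩
  · rcases t with _ | ⟨e, t⟩
    · rw [List.append_nil] at h1
      exact Or.inr ⟨[], by rw [h1, List.append_nil], by simpa using h2.symm⟩
    · rw [List.cons_append, List.cons.injEq] at h2
      obtain ⟨rfl, -⟩ := h2
      rw [List.replicate_eq_append_iff] at h1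
      obtain ⟨ha, hu, ht⟩ := h1
      simp only [List.length_cons] at ha
      refine Or.inl ⟨u.length, by omega, hu, ?_⟩
      rw [List.eq_replicate_iff] at ht
      exact ht.2 _ (by simp)

/-- In an expanded word, a letter of one kind stands between complete blocks of the other kind. -/
theorem isCompatible {l l' : List ℕ} {w : List Bool} (h1 : w.count true = l.length)
    (h2 : w.count false = l'.length) : IsCompatible l l' (expandWord l l' w) := by
  refine ⟨(count h1 h2).1, (count h1 h2).2, ?_, ?_⟩
  all_goals
    induction w generalizing l l' with
    | nil => simp [expandWord]
    | cons c w ih =>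
      intro u v h
      cases c
      · rcases l' with _ | ⟨b, l'⟩
        · simp at h2
        · simp at h1 h2
          simp only [expandWord] at h
          rcases append_eq_replicate_append h with ⟨j, hj, rfl, hd⟩ | ⟨u', rfl, h'⟩
          · refine ⟨0, ?_⟩
            simp [List.count_replicate] at hd ⊢
          · obtain ⟨i, hi⟩ := ih h1 h2 u' v h'
            first
            | (refine ⟨i, ?_⟩; simp [List.count_replicate, hi]; done)
            | (refine ⟨i + 1, ?_⟩; simp [hi])
      · rcases l with _ | ⟨a, l⟩
        · simp at h1
        · simp at h1 h2
          simp only [expandWord] at h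
          rcases append_eq_replicate_append h with ⟨j, hj, rfl, hd⟩ | ⟨u', rfl, h'⟩
          · refine ⟨0, ?_⟩
            simp [List.count_replicate] at hd ⊢
          · obtain ⟨i, hi⟩ := ih h1 h2 u' v h'
            first
            | (refine ⟨i, ?_⟩; simp [List.count_replicate, hi]; done)
            | (refine ⟨i + 1, ?_⟩; simp [hi])

/-- Exchange of both factors. -/
theorem swap (l l' : List ℕ) (w : List Bool) :
    expandWord l' l (w.map not) = (expandWord l l' w).map not := by
  induction w generalizing l l' with
  | nil => rcases l with _ | _ <;> rcases l' with _ | _ <;> rfl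
  | cons c w ih =>
    cases c
    · rcases l' with _ | ⟨b, l'⟩
      · rcases l with _ | _ <;> rfl
      · simp [expandWord, ih]
    · rcases l with _ | ⟨a, l⟩
      · rcases l' with _ | _ <;> rfl
      · simp [expandWord, ih]

theorem count_map_not (w : List Bool) (c : Bool) : (w.map not).count c = w.count (!c) := by
  have := List.count_map_of_injective w not Bool.not_injective (!c)
  rwa [Bool.not_not] at this

theorem map_not_map_not (w : List Bool) : (w.map not).map not = w := by
  rw [List.map_map, Bool.involutive_not.comp_self, List.map_id]

theorem IsCompatible.swap {l l' : List ℕ} {s : List Bool} (h : IsCompatible l l' s) :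
    IsCompatible l' l (s.map not) := by
  obtain ⟨h1, h2, h3, h4⟩ := h
  have hs : ∀ u d v, s.map not = u ++ d :: v → s = u.map not ++ (!d) :: v.map not :=
    fun u d v h => by
      rw [← map_not_map_not s, h]
      simp
  refine ⟨by rw [count_map_not]; exact h2, by rw [count_map_not]; exact h1, fun u v h => ?_,
    fun u v h => ?_⟩
  · obtain ⟨i, hi⟩ := h4 _ _ (hs _ _ _ h)
    exact ⟨i, by rwa [count_map_not] at hi⟩
  · obtain ⟨i, hi⟩ := h3 _ _ (hs _ _ _ h)
    exact ⟨i, by rwa [count_map_not] at hi⟩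

/-- A compatible word starts with a complete block: otherwise a letter `false` would come after
`0 < j < a` letters `true`. -/
theorem IsCompatible.exists_append {a : ℕ} {l l' : List ℕ} {s : List Bool}
    (h : IsCompatible (a :: l) l' (true :: s)) (ha : 0 < a) :
    ∃ s', true :: s = List.replicate a true ++ s' ∧ IsCompatible l l' s' := by
  obtain ⟨h1, h2, h3, h4⟩ := h
  have key : ∀ j ≤ a, ∃ s', true :: s = List.replicate j true ++ s' := by
    intro j
    induction j with
    | zero => exact fun _ => ⟨true :: s, rfl⟩
    | succ j ih =>
      intro hj
      obtain ⟨s', hs'⟩ := ih (by omega)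
      rcases s' with _ | ⟨_ | _, s'⟩
      · rw [hs', List.append_nil, List.count_replicate_self, List.sum_cons] at h1
        omega
      · obtain ⟨i, hi⟩ := h3 _ _ hs'
        rw [List.count_replicate_self] at hi
        rcases j with _ | j
        · simp at hs'
        · rcases i with _ | i
          · simp at hi
          · rw [List.take_succ_cons, List.sum_cons] at hi
            omega
      · refine ⟨s', ?_⟩
        rw [hs', List.replicate_succ', List.append_assoc]
        rfl
  obtain ⟨s', hs'⟩ := key a le_rfl
  refine ⟨s', hs', ?_, ?_, fun u v h => ?_, fun u v h => ?_⟩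
  · rw [hs', List.count_append, List.count_replicate_self, List.sum_cons] at h1
    omega
  · rwa [hs', List.count_append, List.count_replicate, if_neg (by simp), zero_add] at h2
  · obtain ⟨i, hi⟩ := h3 (List.replicate a true ++ u) v (by rw [hs', h, List.append_assoc])
    rw [List.count_append, List.count_replicate_self] at hi
    rcases i with _ | i
    · rw [List.take_zero, List.sum_nil] at hi
      omega
    · rw [List.take_succ_cons, List.sum_cons] at hi
      exact ⟨i, by omega⟩
  · obtain ⟨i, hi⟩ := h4 (List.replicate a true ++ u) v (by rw [hs', h, List.append_assoc])
    rw [List.count_append, List.count_replicate, if_neg (by simp), zero_add] at hi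
    exact ⟨i, hi⟩

/-- Compatible words are expanded words. -/
theorem IsCompatible.exists_expandWord {l l' : List ℕ} {s : List Bool} (hl : ∀ a ∈ l, 0 < a)
    (hl' : ∀ a ∈ l', 0 < a) (h : IsCompatible l l' s) :
    ∃ w, w.count true = l.length ∧ w.count false = l'.length ∧ expandWord l l' w = s := by
  induction hn : s.length using Nat.strong_induction_on generalizing l l' s with
  | _ n ih =>
    have nil : ∀ l : List ℕ, (∀ a ∈ l, 0 < a) → l.sum = 0 → l = [] := fun l hl h0 => by
      rcases l with _ | ⟨a, l⟩
      · rfl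
      · have := hl a (by simp)
        rw [List.sum_cons] at h0
        omega
    have one : ∀ {l l' : List ℕ} {s : List Bool}, (∀ a ∈ l, 0 < a) → (∀ a ∈ l', 0 < a) →
        IsCompatible l l' (true :: s) → (true :: s).length = n →
        ∃ w, w.count true = l.length ∧ w.count false = l'.length ∧
          expandWord l l' w = true :: s := by
      intro l l' s hl hl' h hn
      rcases l with _ | ⟨a, l⟩
      · have := h.1
        simp at this
      · have ha := hl a (by simp)
        obtain ⟨s', hs', hc⟩ := h.exists_append ha
        obtain ⟨w, h1, h2, h3⟩ := ih s'.length (by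
          rw [← hn, hs', List.length_append, List.length_replicate]
          omega) (fun b hb => hl b (by simp [hb])) hl' hc rfl
        refine ⟨true :: w, by simp [h1], by simp [h2], ?_⟩
        rw [hs', ← h3]
        simp [expandWord]
    rcases s with _ | ⟨_ | _, s⟩
    · have h1 := h.1
      have h2 := h.2.1
      obtain rfl := nil l hl h1.symm
      obtain rfl := nil l' hl' h2.symm
      exact ⟨[], rfl, rfl, rfl⟩
    · obtain ⟨w, h1, h2, h3⟩ := one hl' hl h.swap (by simpa using hn)
      refine ⟨w.map not, by rw [count_map_not]; exact h2, by rw [count_map_not]; exact h1, ?_⟩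
      rw [ExpandWord.swap, h3]
      exact map_not_map_not (false :: s)
    · exact one hl hl' h hn

theorem injective {l l' : List ℕ} (hl : ∀ a ∈ l, 0 < a) (hl' : ∀ a ∈ l', 0 < a)
    {w w' : List Bool} (h1 : w.count true = l.length) (h2 : w.count false = l'.length)
    (h1' : w'.count true = l.length) (h2' : w'.count false = l'.length)
    (h : expandWord l l' w = expandWord l l' w') : w = w' := by
  induction w generalizing l l' w' with
  | nil =>
    obtain rfl := List.length_eq_zero_iff.1 h1.symm
    obtain rfl := List.length_eq_zero_iff.1 h2.symm
    have := w'.count_true_add_count_false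
    rw [h1', h2'] at this
    exact (List.length_eq_zero_iff.1 this.symm).symm
  | cons c w ih =>
    rcases w' with _ | ⟨c', w'⟩
    · obtain rfl := List.length_eq_zero_iff.1 h1'.symm
      obtain rfl := List.length_eq_zero_iff.1 h2'.symm
      cases c <;> simp at h1 h2
    · have pos : ∀ a : ℕ, 0 < a → ∀ c : Bool, List.replicate a c = c :: List.replicate (a - 1) c :=
        fun a ha c => by rw [← List.replicate_succ, Nat.sub_add_cancel ha]
      cases c <;> cases c'
      · rcases l' with _ | ⟨b, l'⟩
        · simp at h2
        · simp at h1 h2 h1' h2'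
          simp [expandWord] at h
          rw [ih hl (fun b hb => hl' b (by simp [hb])) h1 h2 h1' h2' h]
      · rcases l' with _ | ⟨b, l'⟩
        · simp at h2
        · rcases l with _ | ⟨a, l⟩
          · simp at h1'
          · simp [expandWord, pos a (hl a (by simp)), pos b (hl' b (by simp))] at h
      · rcases l' with _ | ⟨b, l'⟩
        · simp at h2'
        · rcases l with _ | ⟨a, l⟩
          · simp at h1
          · simp [expandWord, pos a (hl a (by simp)), pos b (hl' b (by simp))] at h
      · rcases l with _ | ⟨a, l⟩
        · simp at h1
        · simp at h1 h2 h1' h2'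
          simp [expandWord] at h
          rw [ih (fun b hb => hl b (by simp [hb])) hl' h1 h2 h1' h2' h]

theorem replicate_true_append {m : ℕ} {l l' : List ℕ} {w : List Bool} (h : m ≤ l.length) :
    expandWord l l' (List.replicate m true ++ w) =
      List.replicate (l.take m).sum true ++ expandWord (l.drop m) l' w := by
  induction m generalizing l with
  | zero => simp
  | succ m ih =>
    rcases l with _ | ⟨a, l⟩
    · simp at h
    · rw [List.replicate_succ, List.cons_append]
      simp only [expandWord]
      rw [ih (by simpa using h), List.take_succ_cons, List.sum_cons, List.replicate_add,
        List.append_assoc, List.drop_succ_cons]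

theorem replicate_false_append {m : ℕ} {l l' : List ℕ} {w : List Bool} (h : m ≤ l'.length) :
    expandWord l l' (List.replicate m false ++ w) =
      List.replicate (l'.take m).sum false ++ expandWord l (l'.drop m) w := by
  induction m generalizing l' with
  | zero => simp
  | succ m ih =>
    rcases l' with _ | ⟨a, l'⟩
    · simp at h
    · rw [List.replicate_succ, List.cons_append]
      simp only [expandWord]
      rw [ih (by simpa using h), List.take_succ_cons, List.sum_cons, List.replicate_add,
        List.append_assoc, List.drop_succ_cons]

/-- The first letter does not change. -/
theorem head?_eq {l l' : List ℕ} {w : List Bool} (hl : ∀ a ∈ l, 0 < a) (hl' : ∀ a ∈ l', 0 < a)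
    (h1 : w.count true = l.length) (h2 : w.count false = l'.length) :
    (expandWord l l' w).head? = w.head? := by
  have pos : ∀ a : ℕ, 0 < a → ∀ c : Bool, List.replicate a c = c :: List.replicate (a - 1) c :=
    fun a ha c => by rw [← List.replicate_succ, Nat.sub_add_cancel ha]
  rcases w with _ | ⟨_ | _, w⟩
  · rcases l with _ | _ <;> rcases l' with _ | _ <;> rfl
  · rcases l' with _ | ⟨b, l'⟩
    · simp at h2
    · simp [expandWord, pos b (hl' b (by simp))]
  · rcases l with _ | ⟨a, l⟩
    · simp at h1
    · simp [expandWord, pos a (hl a (by simp))]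

end ExpandWord

/-- The first maximal block of a word. -/
theorem List.splitBy_replicate_append {n : ℕ} {c : Bool} {s : List Bool} (hn : 0 < n)
    (hs : s.head? ≠ some c) : (List.replicate n c ++ s).splitBy (· == ·) =
      List.replicate n c :: s.splitBy (· == ·) := by
  have h0 : List.replicate n c ≠ [] := by simp; omega
  rw [List.splitBy_append]
  · have h : (List.replicate n c).splitBy (· == ·) = [List.replicate n c] := by
      refine List.splitBy_of_isChain h0 ?_
      exact List.isChain_replicate_of_rel n (by simp)
    rw [h]
    rfl
  · intro x hx y hy
    have h1 : x = c := (List.mem_replicate.1 (List.mem_of_mem_getLast? hx)).2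
    rw [h1, beq_eq_false_iff_ne]
    rintro rfl
    exact hs hy

theorem List.exists_eq_replicate_append (c : Bool) (w : List Bool) :
    ∃ m w', w = List.replicate m c ++ w' ∧ w'.head? ≠ some c := by
  induction w with
  | nil => exact ⟨0, [], rfl, by simp⟩
  | cons d w ih =>
    by_cases h : d = c
    · subst h
      obtain ⟨m, w', rfl, h'⟩ := ih
      exact ⟨m + 1, w', rfl, h'⟩
    · exact ⟨0, d :: w, rfl, by simpa using h⟩

/-! ### Tangling of pipe dreams along shuffles -/

namespace CutSystem

variable {P α : Type*} {S : CutSystem P α}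

/-- The pending block may be inserted before the later ones instead of after them, which moves the
later gaps to the right. -/
theorem tangleFrom_cons_true {x y : P} {i b : ℕ} {w : List Bool}
    (hx : i + (w.count true + 1) = S.len x) (hy : b + w.count false = S.len y) :
    S.tangleFrom x y i b (true :: w) =
      S.tangleFrom (S.ins x i (S.left y b)) (S.right y b) (i + b) 0 (true :: w) := by
  have hb : S.len (S.left y b) = b := S.len_left (by omega)
  have h := tangleFrom_ins_parallel (S := S) (f := x) (z := S.right y b) (a := S.left y b)
    (i := i) (k := i + 1) (b := 0) (t := w) (by omega) (by omega) (by rw [S.len_right]; omega)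
  have hx' : i + 1 + w.count true = S.len x := by omega
  have hy' : 0 + w.count false = S.len (S.right y b) := by rw [S.len_right]; omega
  have hl := len_tangleFrom hx' hy'
  rw [hb] at h
  rw [tangleFrom, tangleFrom, left_zero, S.right_zero, add_right_comm, h, S.ins_one]
  change _ ≤ S.len _
  rw [S.len_ins (by omega)]
  omega

/-- A block of atoms of `x` is skipped when no atoms of `y` are pending. -/
theorem tangleFrom_replicate_true_append {x y : P} {i m : ℕ} {w : List Bool}
    (hx : i + m ≤ S.len x) (hw : i + m + w.count true = S.len x)
    (hy : w.count false = S.len y) :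
    S.tangleFrom x y i 0 (List.replicate m true ++ w) = S.tangleFrom x y (i + m) 0 w := by
  induction m generalizing i with
  | zero => rfl
  | succ m ih =>
    have hx' : i + 1 + (List.replicate m true ++ w).count true = S.len x := by
      rw [List.count_append, List.count_replicate_self]
      omega
    have hy' : 0 + (List.replicate m true ++ w).count false = S.len y := by
      rw [List.count_append, List.count_replicate, if_neg (by simp)]
      omega
    have hl := len_tangleFrom hx' hy'
    rw [List.replicate_succ, List.cons_append, tangleFrom, left_zero, S.right_zero,
      S.ins_one _ _ (show i ≤ S.len _ by omega), ih (by omega) (by omega), add_right_comm,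
      add_assoc]

/-- Tangling from left to right, one maximal block of atoms of `y` at a time. -/
theorem tangleFrom_replicate_false_append {x y : P} {i m : ℕ} {w : List Bool}
    (hx : i + w.count true = S.len x) (hy : m + w.count false = S.len y)
    (hw : w.head? ≠ some false) :
    S.tangleFrom x y i 0 (List.replicate m false ++ w) =
      S.tangleFrom (S.ins x i (S.left y m)) (S.right y m) (i + m) 0 w := by
  rw [tangleFrom_replicate_append, zero_add]
  rcases w with _ | ⟨_ | _, w⟩
  · simp only [List.count_nil, add_zero] at hx hy
    rw [tangleFrom, tangleFrom, left_zero, S.ins_one]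
    change _ ≤ S.len _
    rw [S.len_ins hx.le, S.len_left hy.le]
    omega
  · simp at hw
  · simp at hx hy
    exact tangleFrom_cons_true hx (by omega)

end CutSystem

namespace Permutation

/-- The sizes of the atoms. -/
noncomputable def sizes (ω : Permutation) : List ℕ := ω.atoms.map Sigma.fst

theorem cutPos_eq_sum (ω : Permutation) (i : ℕ) : ω.cutPos i = (ω.sizes.take i).sum := by
  rw [cutPos, listProd_fst, List.map_take, sizes]

theorem sizes_pos {ω : Permutation} {a : ℕ} (h : a ∈ ω.sizes) : 0 < a := by
  obtain ⟨π, hπ, rfl⟩ := List.mem_map.1 h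
  have := (isFactorization_atoms ω π hπ).2
  rw [Ne, eq_eps_iff] at this
  omega

theorem sizes_length (ω : Permutation) : ω.sizes.length = ω.atoms.length := List.length_map _

theorem sizes_sum (ω : Permutation) : ω.sizes.sum = ω.1 := by
  rw [← cutPos_length, cutPos_eq_sum, ← sizes_length, List.take_length]

theorem isGlobalDescent_iff_sizes {ω : Permutation} {γ : ℕ} :
    IsGlobalDescent ω γ ↔ ∃ i, γ = (ω.sizes.take i).sum := by
  constructor
  · intro h
    obtain ⟨i, -, rfl⟩ := exists_cutPos h
    exact ⟨i, cutPos_eq_sum _ _⟩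
  · rintro ⟨i, rfl⟩
    rw [← cutPos_eq_sum]
    exact isGlobalDescent_cutPos ω i

end Permutation

namespace PipeDream

open Permutation

theorem isShuffle_iff {P Q : PipeDream} {s : List Bool} :
    IsShuffle P Q s ↔ ExpandWord.IsCompatible P.omega.sizes Q.omega.sizes s := by
  unfold IsShuffle ExpandWord.IsCompatible
  simp only [mem_globalDescents, isGlobalDescent_iff_sizes, sizes_sum, omega_fst]

open Classical in
/-- The shuffles of two pipe dreams are the words of atoms, with each atom replaced by a block. -/
theorem shuffles_eq (P Q : PipeDream) : shuffles P Q =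
    (twoWords (cutSystem.len P) (cutSystem.len Q)).image
      (expandWord P.omega.sizes Q.omega.sizes) := by
  have hP : cutSystem.len P = P.omega.sizes.length := (sizes_length _).symm
  have hQ : cutSystem.len Q = Q.omega.sizes.length := (sizes_length _).symm
  ext s
  have hs : s ∈ (List.replicate P.1.n true ++ List.replicate Q.1.n false).permutations.toFinset ↔
      s.count true = P.1.n ∧ s.count false = Q.1.n := mem_twoWords
  rw [shuffles, Finset.mem_filter, hs, Finset.mem_image, isShuffle_iff]
  constructor
  · rintro ⟨-, h⟩
    obtain ⟨w, h1, h2, h3⟩ := h.exists_expandWord (fun a => sizes_pos) (fun a => sizes_pos)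
    exact ⟨w, mem_twoWords.2 ⟨by rw [h1, hP], by rw [h2, hQ]⟩, h3⟩
  · rintro ⟨w, hw, rfl⟩
    rw [mem_twoWords, hP, hQ] at hw
    have h := ExpandWord.isCompatible hw.1 hw.2
    refine ⟨⟨?_, ?_⟩, h⟩
    · rw [h.1, sizes_sum, omega_fst]
    · rw [h.2.1, sizes_sum, omega_fst]

theorem sizes_ins (P Q : PipeDream) (i m : ℕ) (hi : i ≤ cutSystem.len P)
    (hm : m ≤ cutSystem.len Q) :
    (P.ins i (Q.left m)).omega.sizes.drop (i + m) = P.omega.sizes.drop i := by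
  have h := cutSystem.word_ins P i (Q.left m) hi
  have hl : (Q.left m).omega.atoms.length = m := cutSystem.len_left hm
  have hi' : (P.omega.atoms.take i).length = i := List.length_take_of_le hi
  unfold sizes
  rw [← List.map_drop, ← List.map_drop, show (P.ins i (Q.left m)).omega.atoms = _ from h]
  congr 1
  change (P.omega.atoms.take i ++ (Q.left m).omega.atoms ++ P.omega.atoms.drop i).drop (i + m) = _
  rw [List.drop_left' (by rw [List.length_append, hl, hi'])]

theorem cutPos_ins (P Q : PipeDream) (i m : ℕ) (hi : i ≤ cutSystem.len P)
    (hm : m ≤ cutSystem.len Q) :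
    (P.ins i (Q.left m)).omega.cutPos (i + m) = P.omega.cutPos i + Q.omega.cutPos m := by
  have hl : (Q.left m).omega.atoms.length = m := cutSystem.len_left hm
  rw [omega_ins, cutPos_insertion_mid hi hl.ge, omega_left, cutPos_listProd_take le_rfl]

/-- Tangling of fillings along a shuffle is tangling along the corresponding word in atoms. -/
theorem tangleBlocks_eq {P Q : PipeDream} {i : ℕ} {w : List Bool}
    (hP : i + w.count true = cutSystem.len P) (hQ : w.count false = cutSystem.len Q) :
    Filling.tangleBlocks P.1 Q.1 (P.omega.cutPos i)
      ((expandWord (P.omega.sizes.drop i) Q.omega.sizes w).splitBy (· == ·)) =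
    (cutSystem.tangleFrom P Q i 0 w).1 := by
  induction hn : w.length using Nat.strong_induction_on generalizing P Q i w with
  | _ n ih =>
    have hlP : (P.omega.sizes.drop i).length = w.count true := by
      rw [List.length_drop, sizes_length]
      change cutSystem.len P - i = _
      omega
    have hlQ : Q.omega.sizes.length = w.count false := by
      rw [sizes_length]
      exact hQ.symm
    have hpos1 : ∀ a ∈ P.omega.sizes.drop i, 0 < a := fun a ha =>
      sizes_pos (List.mem_of_mem_drop ha)
    have hpos2 : ∀ a ∈ Q.omega.sizes, 0 < a := fun a => sizes_pos
    have hsum : ∀ (l : List ℕ) (m : ℕ), (∀ a ∈ l, 0 < a) → 0 < m → m ≤ l.length →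
        0 < (l.take m).sum := fun l m hl hm hml => by
      rcases l with _ | ⟨a, l⟩
      · simp at hml
        omega
      · obtain ⟨m, rfl⟩ := Nat.exists_eq_add_of_lt hm
        have := hl a (by simp)
        rw [zero_add, List.take_succ_cons, List.sum_cons]
        omega
    have hhead : ∀ m : ℕ, 0 < m → ∀ c : Bool, (List.replicate m c).head? = some c :=
      fun m hm c => by
        obtain ⟨m, rfl⟩ := Nat.exists_eq_add_of_lt hm
        rfl
    rcases w with _ | ⟨c, w⟩
    · simp only [List.count_nil, add_zero] at hP hQ
      have h : expandWord (P.omega.sizes.drop i) Q.omega.sizes [] = [] := by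
        rcases P.omega.sizes.drop i with _ | _ <;> rcases Q.omega.sizes with _ | _ <;> rfl
      rw [h, List.splitBy_nil, Filling.tangleBlocks, CutSystem.tangleFrom, CutSystem.left_zero,
        cutSystem.ins_one _ _ hP.le]
    · -- a maximal block of `m` atoms is expanded to a maximal block of pipes
      obtain ⟨m, w', hw, hw'⟩ := List.exists_eq_replicate_append c (c :: w)
      have hm : 0 < m := by
        rcases m with _ | m
        · rw [List.replicate_zero, List.nil_append] at hw
          rw [← hw] at hw'
          simp at hw'
        · omega
      rw [hw] at hP hQ hlP hlQ hn ⊢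
      rw [List.length_append, List.length_replicate] at hn
      cases c
      · simp [List.count_replicate] at hP hQ hlP hlQ
        have hmQ : m ≤ Q.omega.sizes.length := by omega
        have hmQ' : m ≤ cutSystem.len Q := by omega
        have hn0 := hsum _ _ hpos2 hm hmQ
        have hs : (expandWord (P.omega.sizes.drop i) (Q.omega.sizes.drop m) w').head? ≠
            some false := by
          rw [ExpandWord.head?_eq hpos1 (fun a ha => hpos2 a (List.mem_of_mem_drop ha))
            (by rw [List.length_drop]; omega) (by rw [List.length_drop]; omega)]
          exact hw'
        rw [ExpandWord.replicate_false_append hmQ, List.splitBy_replicate_append hn0 hs,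
          Filling.tangleBlocks, hhead _ hn0, if_neg (by simp), List.length_replicate,
          CutSystem.tangleFrom_replicate_false_append hP (by omega) hw', ← cutPos_eq_sum]
        have hlen : cutSystem.len (P.ins i (Q.left m)) = cutSystem.len P + m := by
          have h1 := cutSystem.len_ins (x := P) (y := Q.left m) (i := i) (by omega)
          rw [show cutSystem.len (Q.left m) = m from cutSystem.len_left hmQ'] at h1
          exact h1
        have hr : cutSystem.len (Q.right m) = cutSystem.len Q - m := cutSystem.len_right Q m
        have := ih w'.length (by omega) (P := P.ins i (Q.left m)) (Q := Q.right m) (i := i + m)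
          (w := w') (by omega) (by omega) rfl
        rw [sizes_ins _ _ _ _ (by omega) hmQ', cutPos_ins _ _ _ _ (by omega) hmQ'] at this
        rw [show (Q.right m).omega.sizes = Q.omega.sizes.drop m by
          have h1 : (Q.right m).omega.atoms = _ := cutSystem.word_right Q m
          rw [sizes, h1, sizes, List.map_drop]
          rfl] at this
        exact this
      · simp [List.count_replicate] at hP hQ hlP hlQ
        have hmP : m ≤ (P.omega.sizes.drop i).length := by rw [List.length_drop]; omega
        have hn0 := hsum _ _ hpos1 hm hmP
        have hs : (expandWord ((P.omega.sizes.drop i).drop m) Q.omega.sizes w').head? ≠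
            some true := by
          rw [ExpandWord.head?_eq (fun a ha => hpos1 a (List.mem_of_mem_drop ha)) hpos2
            (by rw [List.length_drop, List.length_drop]; omega) (by omega)]
          exact hw'
        rw [ExpandWord.replicate_true_append hmP, List.splitBy_replicate_append hn0 hs,
          Filling.tangleBlocks, hhead _ hn0, if_pos rfl, List.length_replicate,
          CutSystem.tangleFrom_replicate_true_append (by omega) (by omega) hQ, List.drop_drop]
        have := ih w'.length (by omega) (P := P) (Q := Q) (i := i + m)
          (w := w') (by omega) (by omega) rfl
        rw [cutPos_eq_sum, List.take_add, List.sum_append, ← cutPos_eq_sum] at this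
        exact this

theorem tangle_expandWord {P Q : PipeDream} {w : List Bool}
    (hP : w.count true = cutSystem.len P) (hQ : w.count false = cutSystem.len Q) :
    Filling.tangle P.1 Q.1 (expandWord P.omega.sizes Q.omega.sizes w) =
      (cutSystem.tangle P Q w).1 :=
  tangleBlocks_eq (i := 0) (by rwa [zero_add]) hQ

theorem isPipeDream_tangle {P Q : PipeDream} {s : List Bool} (hs : s ∈ shuffles P Q) :
    (Filling.tangle P.1 Q.1 s).IsPipeDream := by
  rw [shuffles_eq, Finset.mem_image] at hs
  obtain ⟨w, hw, rfl⟩ := hs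
  rw [mem_twoWords] at hw
  rw [tangle_expandWord hw.1 hw.2]
  exact (cutSystem.tangle P Q w).2

/-- The global descents of the exiting permutation are the gaps between its atoms. -/
theorem globalDescents_eq (P : PipeDream) : P.omega.globalDescents =
    (Finset.range (cutSystem.len P + 1)).image P.omega.cutPos := by
  ext γ
  rw [mem_globalDescents, Finset.mem_image]
  constructor
  · intro h
    obtain ⟨i, hi, rfl⟩ := exists_cutPos h
    exact ⟨i, Finset.mem_range.2 (Nat.lt_succ_of_le hi), rfl⟩
  · rintro ⟨i, -, rfl⟩
    exact isGlobalDescent_cutPos _ i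

theorem cutPos_injOn (P : PipeDream) :
    Set.InjOn P.omega.cutPos (Finset.range (cutSystem.len P + 1)) := by
  intro i hi j hj h
  have hi' : i ≤ P.omega.atoms.length := Nat.lt_succ_iff.1 (Finset.mem_range.1 hi)
  have hj' : j ≤ P.omega.atoms.length := Nat.lt_succ_iff.1 (Finset.mem_range.1 hj)
  rcases lt_trichotomy i j with hlt | rfl | hlt
  · have := P.omega.cutPos_lt hlt hj'
    omega
  · rfl
  · have := P.omega.cutPos_lt hlt hi'
    omega

end PipeDream

namespace HP

open PipeDream

variable (k : Type u) [Field k]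

theorem ofFilling_coe (P : PipeDream) : ofFilling k P.1 = Finsupp.single P 1 := dif_pos P.2

/-- The sums over shuffles and over global descents are the sums over words in atoms and over gaps
between atoms. -/
theorem hopfData_eq : hopfData k = PipeDream.cutSystem.hopfData k := by
  have h1 : ∀ P Q : PipeDream, ∑ s ∈ shuffles P Q, ofFilling k (Filling.tangle P.1 Q.1 s) =
      ∑ w ∈ twoWords (cutSystem.len P) (cutSystem.len Q),
        Finsupp.single (cutSystem.tangle P Q w) 1 := by
    intro P Q
    rw [shuffles_eq, Finset.sum_image]
    · refine Finset.sum_congr rfl fun w hw => ?_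
      rw [mem_twoWords] at hw
      rw [tangle_expandWord hw.1 hw.2, ofFilling_coe]
    · intro v hv w hw h
      have hv' := mem_twoWords.1 hv
      have hw' := mem_twoWords.1 hw
      have hP : cutSystem.len P = P.omega.sizes.length := (Permutation.sizes_length _).symm
      have hQ : cutSystem.len Q = Q.omega.sizes.length := (Permutation.sizes_length _).symm
      exact ExpandWord.injective (fun a => Permutation.sizes_pos) (fun a => Permutation.sizes_pos)
        (by omega) (by omega) (by omega) (by omega) h
  have h2 : ∀ P : PipeDream, ∑ γ ∈ P.omega.globalDescents,
      ofFilling k (Filling.vPack γ P.1) ⊗ₜ[k] ofFilling k (Filling.hPack (P.1.n - γ) P.1) =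
      ∑ i ∈ Finset.range (cutSystem.len P + 1),
        Finsupp.single (cutSystem.left P i) 1 ⊗ₜ[k] Finsupp.single (cutSystem.right P i) 1 := by
    intro P
    rw [globalDescents_eq, Finset.sum_image P.cutPos_injOn]
    refine Finset.sum_congr rfl fun i _ => ?_
    exact congrArg₂ (· ⊗ₜ[k] ·) (ofFilling_coe k (P.left i)) (ofFilling_coe k (P.right i))
  unfold hopfData CutSystem.hopfData
  simp only [h1, h2]
  rfl

theorem isGradedConnectedHopf : IsGradedConnectedHopf (hopfData k) (grading k) := by
  rw [hopfData_eq]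
  exact PipeDream.isSize_cutSystem.isGradedConnectedHopf

end HP

/-! ### Pipe dreams with a given exiting permutation -/

namespace Filling

/-- The filling of size `n` whose crosses are the first `c i` boxes of each row `i`. -/
def ofRows (n : ℕ) (c : ℕ → ℕ) : Filling :=
  ⟨n, (Finset.range (n + 1)).biUnion fun i => {i} ×ˢ Finset.range (c i)⟩

theorem mem_ofRows {n : ℕ} {c : ℕ → ℕ} {i j : ℕ} :
    (i, j) ∈ (ofRows n c).crosses ↔ i ≤ n ∧ j < c i := by
  simp only [ofRows, Finset.mem_biUnion, Finset.mem_range, Finset.mem_product,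
    Finset.mem_singleton]
  constructor
  · rintro ⟨_, h, rfl, h'⟩
    exact ⟨by omega, h'⟩
  · rintro ⟨h, h'⟩
    exact ⟨i, by omega, rfl, h'⟩

/-- The pipe entering in row `i` passes straight below the pipes coming from below, up to the
column `c i`, where it turns up. -/
theorem north_ofRows {n : ℕ} {c : ℕ → ℕ} {i : ℕ} (hi : i ≤ n) {u v : List ℕ}
    (hc : c i = u.length) (hlen : (u ++ v).length = n - i)
    (h : ∀ j (hj : j < (u ++ v).length), (ofRows n c).north (i + 1) j = (u ++ v)[j]) :
    ∀ j (hj : j < (u ++ i :: v).length), (ofRows n c).north i j = (u ++ i :: v)[j] := by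
  have hw : ∀ j, j ≤ u.length → (ofRows n c).west i j = i := by
    intro j
    induction j with
    | zero => exact fun _ => west_zero _ _
    | succ j ih =>
      intro hj
      rw [west, if_pos (mem_ofRows.2 ⟨hi, by omega⟩), ih (by omega)]
  have hs : ∀ j (hj : j < (u ++ v).length), (ofRows n c).south i j = (u ++ v)[j] := by
    intro j hj
    rw [south_eq_north (show i + j < n by omega), h j hj]
  intro j hj
  rw [north]
  rcases lt_trichotomy j u.length with hlt | rfl | hgt
  · rw [if_pos (mem_ofRows.2 ⟨hi, by omega⟩), hs j (by rw [List.length_append]; omega),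
      List.getElem_append_left hlt, List.getElem_append_left hlt]
  · rw [if_neg (fun h => by have := (mem_ofRows.1 h).2; omega), hw _ le_rfl]
    simp
  · rw [if_neg (fun h => by have := (mem_ofRows.1 h).2; omega)]
    obtain ⟨d, rfl⟩ := Nat.exists_eq_add_of_lt hgt
    rw [west, if_neg (fun h => by have := (mem_ofRows.1 h).2; omega), hs _ (by simp at hj ⊢; omega),
      List.getElem_append_right (by omega), List.getElem_append_right (by omega)]
    simp [Nat.add_assoc]

/-- Any order of the labels with `0` in front is realized by left-justified rows of crosses. The
pipe entering in row `i` crosses the larger labels that leave before it. -/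
theorem exists_isPipeDream {n : ℕ} {L : List ℕ} (hnd : (0 :: L).Nodup)
    (hmem : ∀ x, x ∈ 0 :: L ↔ x ≤ n) :
    ∃ X : Filling, X.IsPipeDream ∧ X.n = n ∧
      ∀ j (hj : j < (0 :: L).length), X.north 0 j = (0 :: L)[j] := by
  -- the number of larger labels that come before the label `i`
  let c : ℕ → ℕ := fun i => ((0 :: L).filter (i ≤ ·)).idxOf i
  -- the labels from `i` on arise from the labels from `i + 1` on by inserting `i` in place `c i`
  have step : ∀ i ≤ n, ∃ u v : List ℕ, (0 :: L).filter (i ≤ ·) = u ++ i :: v ∧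
      (0 :: L).filter (i + 1 ≤ ·) = u ++ v ∧ c i = u.length := by
    intro i hi
    obtain ⟨u, v, huv⟩ := List.append_of_mem ((hmem i).2 hi)
    rw [huv, List.nodup_append, List.nodup_cons] at hnd
    have hu : i ∉ u := fun h => hnd.2.2 i h i (by simp) rfl
    have hv : i ∉ v := hnd.2.1.1
    have hf : ∀ l : List ℕ, i ∉ l → l.filter (i + 1 ≤ ·) = l.filter (i ≤ ·) := fun l hl =>
      List.filter_congr fun x hx => by
        have : x ≠ i := fun h => hl (h ▸ hx)
        simp only [decide_eq_decide]
        omega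
    have h1 : (0 :: L).filter (i ≤ ·) = u.filter (i ≤ ·) ++ i :: v.filter (i ≤ ·) := by
      rw [huv, List.filter_append, List.filter_cons_of_pos (by simp)]
    refine ⟨u.filter (i ≤ ·), v.filter (i ≤ ·), h1, ?_, ?_⟩
    · rw [huv, List.filter_append, List.filter_cons_of_neg (by simp), hf u hu, hf v hv]
    · change ((0 :: L).filter (i ≤ ·)).idxOf i = _
      rw [h1, List.idxOf_append_of_notMem (fun h => hu (List.mem_of_mem_filter h)),
        List.idxOf_cons_self, add_zero]
  -- the pipes leaving row `i` at the top are those with label at least `i`, in the final order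
  have main : ∀ d i, i + d = n + 1 → ((0 :: L).filter (i ≤ ·)).length = d ∧
      ∀ j (hj : j < ((0 :: L).filter (i ≤ ·)).length),
        (ofRows n c).north i j = ((0 :: L).filter (i ≤ ·))[j] := by
    intro d
    induction d with
    | zero =>
      intro i hi
      have : (0 :: L).filter (i ≤ ·) = [] := by
        rw [List.filter_eq_nil_iff]
        intro x hx
        have := (hmem x).1 hx
        simp
        omega
      rw [this]
      exact ⟨rfl, fun j hj => absurd hj (Nat.not_lt_zero j)⟩
    | succ d ih =>
      intro i hi
      obtain ⟨u, v, h1, h2, h3⟩ := step i (by omega)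
      obtain ⟨h4, h5⟩ := ih (i + 1) (by omega)
      simp only [h2] at h4 h5
      simp only [h1]
      refine ⟨?_, north_ofRows (by omega) h3 (by omega) h5⟩
      simp only [List.length_append, List.length_cons] at h4 ⊢
      omega
  have hc : ∀ i ≤ n, c i ≤ n - i := by
    intro i hi
    obtain ⟨u, v, h1, h2, h3⟩ := step i hi
    have := (main (n - i) (i + 1) (by omega)).1
    rw [h2, List.length_append] at this
    omega
  have hall : (0 :: L).filter (0 ≤ ·) = 0 :: L := by
    rw [List.filter_eq_self]
    simp
  have hc0 : c 0 = 0 := by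
    change ((0 :: L).filter (0 ≤ ·)).idxOf 0 = 0
    rw [hall, List.idxOf_cons_self]
  refine ⟨ofRows n c, isPipeDream_iff.2 ⟨?_, ?_, ?_⟩, rfl, ?_⟩
  · rintro ⟨i, j⟩ h
    obtain ⟨h1, h2⟩ := mem_ofRows.1 h
    have := hc i h1
    change i + j < n
    omega
  · intro h
    have := (mem_ofRows.1 h).2
    omega
  · rintro ⟨i, j⟩ h
    obtain ⟨h1, h2⟩ := mem_ofRows.1 h
    have h3 := hc i h1
    change (ofRows n c).west i j < (ofRows n c).south i j
    have hw : ∀ j, j ≤ c i → (ofRows n c).west i j = i := by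
      intro j
      induction j with
      | zero => exact fun _ => west_zero _ _
      | succ j ih =>
        intro hj
        rw [west, if_pos (mem_ofRows.2 ⟨h1, by omega⟩), ih (by omega)]
    obtain ⟨h4, h5⟩ := main (n - i) (i + 1) (by omega)
    have hj : j < ((0 :: L).filter (i + 1 ≤ ·)).length := by omega
    rw [hw j (by omega), south_eq_north (show i + j < n by omega), h5 j hj]
    have := List.of_mem_filter (List.getElem_mem hj)
    simpa using this
  · have := (main (n + 1) 0 (by omega)).2
    simp only [hall] at this
    exact this

end Filling

namespace PipeDream

open Permutation

/-- Every permutation is an exiting permutation. -/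
theorem omega_surjective : Function.Surjective omega := by
  intro ω
  let L : List ℕ := List.ofFn fun i : Fin ω.1 => (ω.2 i : ℕ) + 1
  have hL : ∀ x, x ∈ L ↔ 1 ≤ x ∧ x ≤ ω.1 := by
    intro x
    rw [List.mem_ofFn]
    constructor
    · rintro ⟨i, rfl⟩
      exact ⟨Nat.le_add_left _ _, (ω.2 i).2⟩
    · rintro ⟨h1, h2⟩
      refine ⟨ω.2.symm ⟨x - 1, by omega⟩, ?_⟩
      simp
      omega
  have hnd : (0 :: L).Nodup := by
    rw [List.nodup_cons, hL]
    refine ⟨by omega, List.nodup_ofFn.2 fun i j h => ?_⟩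
    exact ω.2.injective (Fin.ext (Nat.succ_injective h))
  obtain ⟨X, hX, hn, h⟩ := Filling.exists_isPipeDream (n := ω.1) hnd (fun x => by
    rw [List.mem_cons, hL]
    omega)
  refine ⟨⟨X, hX⟩, ext_iff_val.2 ⟨hn, fun i hi => ?_⟩⟩
  rw [omega_fst] at hi
  have hi' : i < ω.1 := by rw [← hn]; exact hi
  rw [val_omega _ hi, val_of_lt hi']
  have := h (i + 1) (by simp [L, hi'])
  change X.north 0 (i + 1) - 1 = _
  rw [this]
  simp [L]

end PipeDream

/-! ### Morphisms -/

namespace CutSystem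

variable {P Q α : Type} {S : CutSystem P α} {T : CutSystem Q α} {f : P → Q}

/-- A map that preserves words preserves tanglings, if the target objects are determined by their
words. -/
theorem map_tangle (hT : Function.Injective T.word) (hf : ∀ x, T.word (f x) = S.word x)
    {x y : P} {w : List Bool} (hx : w.count true = S.len x) (hy : w.count false = S.len y) :
    f (S.tangle x y w) = T.tangle (f x) (f y) w := by
  refine hT ?_
  rw [hf, word_tangle hx hy, word_tangle (by rw [hx, len, len, hf]) (by rw [hy, len, len, hf]),
    hf, hf]

variable [DecidableEq P] [DecidableEq Q] (k : Type u) [Field k]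

theorem mapDomain_mul (hT : Function.Injective T.word) (hf : ∀ x, T.word (f x) = S.word x)
    (x y : P →₀ k) : Finsupp.lmapDomain k k f ((S.hopfData k).mul x y) =
      (T.hopfData k).mul (Finsupp.lmapDomain k k f x) (Finsupp.lmapDomain k k f y) := by
  have hlen : ∀ x, T.len (f x) = S.len x := fun x => by rw [len, hf, len]
  induction x using Finsupp.induction_single_one with
  | zero => simp
  | add x x' h h' => simp only [map_add, LinearMap.add_apply, h, h']
  | smul c x h => simp only [map_smul, LinearMap.smul_apply, h]
  | single x =>
  induction y using Finsupp.induction_single_one with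
  | zero => simp
  | add x x' h h' => simp only [map_add, h, h']
  | smul c x h => simp only [map_smul, h]
  | single y =>
  simp only [Finsupp.lmapDomain_apply, Finsupp.mapDomain_single, mul_single,
    Finsupp.mapDomain_finsetSum, hlen]
  refine Finset.sum_congr rfl fun w hw => ?_
  rw [mem_twoWords] at hw
  rw [map_tangle hT hf hw.1 hw.2]

theorem mapDomain_counit (hf : ∀ x, T.word (f x) = S.word x) :
    (T.hopfData k).counit ∘ₗ Finsupp.lmapDomain k k f = (S.hopfData k).counit := by
  refine Finsupp.hom_ext_single_one fun x => ?_
  rw [LinearMap.comp_apply, Finsupp.lmapDomain_apply, Finsupp.mapDomain_single, counit_single,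
    counit_single]
  have : f x = T.one ↔ x = S.one := by
    rw [← T.word_eq_nil, hf, S.word_eq_nil]
  simp only [this]

theorem mapDomain_comul (hT : Function.Injective T.word) (hf : ∀ x, T.word (f x) = S.word x) :
    TensorProduct.map (Finsupp.lmapDomain k k f) (Finsupp.lmapDomain k k f) ∘ₗ
      (S.hopfData k).comul = (T.hopfData k).comul ∘ₗ Finsupp.lmapDomain k k f := by
  refine Finsupp.hom_ext_single_one fun x => ?_
  have hlen : T.len (f x) = S.len x := by rw [len, hf, len]
  simp only [LinearMap.comp_apply, comul_single, Finsupp.lmapDomain_apply,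
    Finsupp.mapDomain_single, map_sum, TensorProduct.map_tmul, hlen]
  refine Finset.sum_congr rfl fun i _ => ?_
  rw [show f (S.left x i) = T.left (f x) i from hT (by rw [hf, S.word_left, T.word_left, hf]),
    show f (S.right x i) = T.right (f x) i from hT (by rw [hf, S.word_right, T.word_right, hf])]

end CutSystem

/-- A morphism of bialgebras between Hopf algebras commutes with the antipodes, as both
composites are convolution inverses of the morphism. -/
theorem BialgHom.map_antipode {k A B : Type*} [CommSemiring k] [Semiring A] [Semiring B]
    [HopfAlgebra k A] [HopfAlgebra k B] (Φ : A →ₐc[k] B) (x : A) :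
    Φ (HopfAlgebra.antipode k x) = HopfAlgebra.antipode k (Φ x) := by
  have h : WithConv.toConv ((Φ : A →ₗ[k] B) ∘ₗ HopfAlgebra.antipode k) =
      WithConv.toConv (HopfAlgebra.antipode k ∘ₗ (Φ : A →ₗ[k] B)) := by
    apply left_inv_eq_right_inv (a := WithConv.toConv (Φ : A →ₗ[k] B))
    · ext c
      rw [(Coalgebra.Repr.arbitrary k c).convMul_apply]
      have := congrArg Φ
        (HopfAlgebra.sum_antipode_mul_eq_algebraMap_counit (Coalgebra.Repr.arbitrary k c))
      simp only [map_sum, map_mul] at this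
      refine this.trans ?_
      simp only [LinearMap.convOne_apply]
      rw [Algebra.algebraMap_eq_smul_one, _root_.map_smul, _root_.map_one,
        ← Algebra.algebraMap_eq_smul_one]
    · ext c
      rw [(Coalgebra.Repr.arbitrary k c).convMul_apply]
      have := HopfAlgebra.sum_mul_antipode_eq_algebraMap_counit
        ((Coalgebra.Repr.arbitrary k c).induced Φ)
      refine Eq.trans ?_ (this.trans ?_)
      · rfl
      · simp
  exact LinearMap.congr_fun (WithConv.toConv_injective h) x

namespace HP

variable (k : Type u) [Field k]

theorem omega_basis (P : PipeDream) : omega k (basis k P) = HS.basis k P.omega :=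
  Finsupp.mapDomain_single

theorem omega_mem_grading {n : ℕ} {x : HP k} (hx : x ∈ grading k n) :
    omega k x ∈ HS.grading k n := by
  refine Submodule.span_le (p := (HS.grading k n).comap (omega k)).2 ?_ hx
  rintro _ ⟨P, rfl, rfl⟩
  change omega k (basis k P) ∈ HS.grading k P.1.n
  rw [omega_basis]
  exact Submodule.subset_span ⟨P.omega, rfl, rfl⟩

theorem omega_surjective : Function.Surjective (omega k) :=
  Finsupp.mapDomain_surjective PipeDream.omega_surjective

theorem omega_mul (x y : HP k) :
    omega k ((hopfData k).mul x y) = (HS.hopfData k).mul (omega k x) (omega k y) := by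
  rw [hopfData_eq, HS.hopfData_eq]
  exact CutSystem.mapDomain_mul k (S := PipeDream.cutSystem) (T := Permutation.cutSystem)
    Permutation.atoms_injective (fun _ => rfl) x y

theorem omega_one : omega k (hopfData k).one = (HS.hopfData k).one := by
  refine (omega_basis k PipeDream.elbow).trans ?_
  rw [PipeDream.omega_eq_eps_iff.2 rfl]
  rfl

theorem counit_omega : (HS.hopfData k).counit ∘ₗ omega k = (hopfData k).counit := by
  rw [hopfData_eq, HS.hopfData_eq]
  exact CutSystem.mapDomain_counit k (S := PipeDream.cutSystem) (T := Permutation.cutSystem)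
    (fun _ => rfl)

theorem comul_omega : TensorProduct.map (omega k) (omega k) ∘ₗ (hopfData k).comul =
    (HS.hopfData k).comul ∘ₗ omega k := by
  rw [hopfData_eq, HS.hopfData_eq]
  exact CutSystem.mapDomain_comul k (S := PipeDream.cutSystem) (T := Permutation.cutSystem)
    Permutation.atoms_injective (fun _ => rfl)

/-- The exiting permutation as a morphism of bialgebras. -/
noncomputable def omegaHom (hP : IsGradedConnectedHopf (hopfData k) (grading k))
    (hS : IsGradedConnectedHopf (HS.hopfData k) (HS.grading k)) : hP.Carrier →ₐc[k] hS.Carrier where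
  toFun := omega k
  map_add' := (omega k).map_add
  map_smul' := (omega k).map_smul
  counit_comp := counit_omega k
  map_comp_comul := comul_omega k
  map_one' := omega_one k
  map_mul' := omega_mul k

end HP

/-! ### The Hopf algebra of pipe dreams and its morphism to permutations -/

theorem mainTheorem2 (k : Type u) [Field k] :
    -- untangling, insertion and tangling produce pipe dreams
    (∀ (P : PipeDream), ∀ γ ∈ P.omega.globalDescents,
      (Filling.vPack γ P.1).IsPipeDream ∧ (Filling.hPack (P.1.n - γ) P.1).IsPipeDream) ∧
    (∀ (P Q : PipeDream), ∀ γ ∈ P.omega.globalDescents, (Filling.insert P.1 γ Q.1).IsPipeDream) ∧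
    (∀ (P Q : PipeDream), ∀ s ∈ PipeDream.shuffles P Q,
      (Filling.tangle P.1 Q.1 s).IsPipeDream) ∧
    -- `HP` and `HS` are graded connected Hopf algebras
    ∃ (hP : IsGradedConnectedHopf (HP.hopfData k) (HP.grading k))
      (hS : IsGradedConnectedHopf (HS.hopfData k) (HS.grading k)),
      (∀ x y : hS.Carrier, x * y = y * x) ∧
      -- the exiting permutation gives a surjective morphism of graded Hopf algebras
      ∃ Φ : hP.Carrier →ₐc[k] hS.Carrier,
        (∀ x : HP k, Φ (hP.of x) = hS.of (HP.omega k x)) ∧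
        (∀ n, ∀ x ∈ HP.grading k n, HP.omega k x ∈ HS.grading k n) ∧
        (∀ x : hP.Carrier, Φ (HopfAlgebra.antipode k x) = HopfAlgebra.antipode k (Φ x)) ∧
        Function.Surjective Φ := by
  have hcut : ∀ (P : PipeDream), ∀ γ ∈ P.omega.globalDescents, P.1.IsCut γ := fun P γ h =>
    PipeDream.isGlobalDescent_omega.1 (Permutation.mem_globalDescents.1 h)
  refine ⟨fun P γ h => ⟨P.2.vPack (hcut P γ h).1, P.2.hPack (Nat.sub_le _ _)⟩,
    fun P Q γ h => P.2.insert Q.2 (hcut P γ h), fun P Q s => PipeDream.isPipeDream_tangle,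
    HP.isGradedConnectedHopf k, HS.isGradedConnectedHopf k, fun x y => ?_,
    HP.omegaHom k _ _, fun _ => rfl, fun n x => HP.omega_mem_grading k,
    BialgHom.map_antipode _, HP.omega_surjective k⟩
  change (HS.hopfData k).mul x y = (HS.hopfData k).mul y x
  rw [HS.hopfData_eq]
  exact CutSystem.mul_comm (S := Permutation.cutSystem) Permutation.atoms_injective x y
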